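/- Let $1\le j<m$ be integers and $\alpha\in(0,1)$. For $r\in(0,1)$ let $x_r=x_r^{m,j}:M=\mathbb S^j\times\mathbb S^{m-j}\to N=\mathbb S^{m+1}$ be the Clifford torus $x_r(p,q)=(rp,\sqrt{1-r^2}\,q)$, with unit normal field $\vec n_r(p,q)=(\sqrt{1-r^2}\,p,-rq)$ in the unit round sphere $N$. Consider the area $\mathcal A$ and the enclosed volume $\mathcal V$ (the volume of the component of $N\setminus y(M)$ that contains $\{0\}\times\mathbb S^{m-j}$) as functionals of unparameterized $C^{2,\alpha}$ embeddings $[y]$ of $M$ into $N$ near $[x_r]$, in the local chart that assigns to a small $u\in C^{2,\alpha}(M)$ the class of $x\mapsto\exp_{x_r(x)}(u(x)\,\vec n_r(x))$; thus the tangent space at $[x_r]$ is $C^{2,\alpha}(M)$. Each $[x_r]$ is a critical point of $\mathcal A$ subject to $\mathcal V=\mathrm{const}$: there is exactly one $\lambda_r\in\mathbb R$ such that $[x_r]$ is a critical point of $\mathcal A+\lambda_r\mathcal V$. Let $B_r$ be the second variation of $\mathcal A+\lambda_r\mathcal V$ at $[x_r]$. The strong (respectively weak) Morse index of $[x_r]$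 is the maximal dimension of a subspace of $C^{2,\alpha}(M)$ (respectively of the kernel of $d\mathcal V([x_r])$ in $C^{2,\alpha}(M)$) on which $B_r$ is negative definite. The $\mathrm{SO}(m+2)$-orbit of $[x_r]$ is nondegenerate if the kernel of $B_r$ equals the tangent space to the orbit at $[x_r]$, i.e. $\{\langle h\,x_r,\vec n_r\rangle : h\in\mathfrak{so}(m+2)\}$; otherwise it is degenerate. For $i,l\ge3$ put $$r_i=\sqrt{\frac{(i-2)(j+i-1)}{m-j+(i-2)(j+i-1)}},\qquad s_l=\sqrt{\frac{j}{j+(l-2)(m-j+l-1)}},$$ which lie in $(0,1)$. Then: (a) for every $r\in(0,1)$ both Morse indices of $[x_r]$ are finite, and the strong Morse index equals the weak Morse index plus $1$; (b) for $r\in(0,1)$, the $\mathrm{SO}(m+2)$-orbit of $[x_r]$ is degenerate if and only if $r=r_i$ for some $i\ge3$ or $r=s_l$ for some $l\ge3$; (c) at each degeneracy instant the (strong and weak) Morse index jumps: it is constant on a small interval to the left and on a small interval to the right of the instant, and the two values differ, in absolute value, by the positive integer $$\binom{j+i-1}{i-1}-\binom{j+i-3}{i-3}\ \text{ at } r_i,\qquad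 \binom{m-j+l-1}{l-1}-\binom{m-j+l-3}{l-3}\ \text{ at } s_l.$$ -/

import Mathlib

open Set MeasureTheory
open scoped NNReal ENNReal

noncomputable section

namespace CliffordCMC

/-- The Euclidean space `ℝ^(d+1)`. -/
abbrev Euc (d : ℕ) : Type := EuclideanSpace ℝ (Fin (d + 1))

/-- The unit sphere `𝕊^d ⊂ ℝ^(d+1)`. -/
abbrev Sph (d : ℕ) : Type := Metric.sphere (0 : Euc d) 1

/-- The source manifold `M = 𝕊^j × 𝕊^k`. -/
abbrev Prd (j k : ℕ) : Type := Sph j × Sph k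

/-- The Euclidean space `ℝ^(j+1) × ℝ^(k+1) = ℝ^(j+k+2)`, with its Euclidean norm.  It contains
`M = 𝕊^j × 𝕊^k`, and the target manifold `N = 𝕊^(j+k+1)` is its unit sphere. -/
abbrev Amb (j k : ℕ) : Type := WithLp 2 (Euc j × Euc k)

/-- The point `(p, q)` of `M`, seen in `ℝ^(j+1) × ℝ^(k+1)`. -/
def pt {j k : ℕ} (x : Prd j k) : Amb j k := WithLp.toLp 2 ((x.1 : Euc j), (x.2 : Euc k))

/-! ### Calculus on `M` -/

/-- The radial projection `a ↦ a / ‖a‖` of `ℝ^(d+1) \ {0}` onto the unit sphere. -/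
def radial {d : ℕ} (a : Euc d) (ha : a ≠ 0) : Sph d :=
  ⟨‖a‖⁻¹ • a, by
    rw [mem_sphere_zero_iff_norm, norm_smul, norm_inv, norm_norm,
      inv_mul_cancel₀ (norm_ne_zero_iff.2 ha)]⟩

/-- The open set `(ℝ^(j+1) \ {0}) × (ℝ^(k+1) \ {0})`, of which `M` is a smooth retract. -/
def offAxes (j k : ℕ) : Set (Amb j k) := {z | z.fst ≠ 0 ∧ z.snd ≠ 0}

open Classical in
/-- The extension `(a, b) ↦ y (a/‖a‖, b/‖b‖)` of a map `y` on `M` to `offAxes j k`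
(by the value `0` elsewhere).  Since `(a, b) ↦ (a/‖a‖, b/‖b‖)` is a smooth retraction onto `M`,
`y` and its extension have the same regularity, and the differential of `y` at a point of `M` is the
restriction of the differential of the extension to the tangent space of `M`. -/
def radialExt {j k : ℕ} {F : Type*} [Zero F] (y : Prd j k → F) (z : Amb j k) : F :=
  if h : z.fst ≠ 0 ∧ z.snd ≠ 0 then y (radial z.fst h.1, radial z.snd h.2) else 0

/-- Functions `f : M → ℝ` of class `C^{2,α}`: twice continuously differentiable, with locally
(equivalently, as `M` is compact, globally) `α`-Hölder second derivatives. -/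
def IsC2Holder {j k : ℕ} (α : ℝ≥0) (f : Prd j k → ℝ) : Prop :=
  ContDiffOn ℝ 2 (radialExt f) (offAxes j k) ∧
    ∀ z ∈ offAxes j k, ∃ U ∈ nhds z, ∃ C : ℝ≥0,
      HolderOnWith C α (iteratedFDeriv ℝ 2 (radialExt f)) U

/-- The tangent space of `M = 𝕊^j × 𝕊^k` at `(p, q)`: the pairs `(v, w)` with `v ⟂ p`, `w ⟂ q`,
with the inner product induced by the ambient Euclidean space (the product of the round metrics
of radius 1). -/
def tangent {j k : ℕ} (x : Prd j k) : Submodule ℝ (Amb j k) where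
  carrier := {v | inner ℝ (x.1 : Euc j) v.fst = 0 ∧ inner ℝ (x.2 : Euc k) v.snd = 0}
  zero_mem' := by simp
  add_mem' := by
    rintro a b ⟨h1, h2⟩ ⟨h3, h4⟩
    constructor
    · simp [inner_add_right, h1, h3]
    · simp [inner_add_right, h2, h4]
  smul_mem' := by
    rintro c a ⟨h1, h2⟩
    constructor
    · simp [inner_smul_right, h1]
    · simp [inner_smul_right, h2]

/-- The differential `dy(x) : T_x M → ℝ^(j+k+2)` of a map `y : M → ℝ^(j+k+2)`. -/
def diffAt {j k : ℕ} (y : Prd j k → Amb j k) (x : Prd j k) : tangent x →L[ℝ] Amb j k :=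
  fderiv ℝ (radialExt y) (pt x) ∘L (tangent x).subtypeL

/-- The Riemannian measure of the product of the unit round metrics on `M = 𝕊^j × 𝕊^k`. -/
def prdMeasure (j k : ℕ) : Measure (Prd j k) :=
  (volume : Measure (Euc j)).toSphere.prod (volume : Measure (Euc k)).toSphere

/-- The endomorphism `dy(x)^* dy(x)` of `T_x M`. -/
def gram {j k : ℕ} (y : Prd j k → Amb j k) (x : Prd j k) : tangent x →L[ℝ] tangent x :=
  ContinuousLinearMap.adjoint (𝕜 := ℝ) (E := tangent x) (F := Amb j k) (diffAt y x) ∘L diffAt y x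

/-! ### The area and the volume functional -/

/-- The area `∫_M det (dy(x)^* dy(x))^{1/2}` of a map `y : M → N ⊂ ℝ^(j+k+2)`. -/
def area {j k : ℕ} (y : Prd j k → Amb j k) : ℝ :=
  ∫ x, Real.sqrt (gram y x).det ∂(prdMeasure j k)

/-- For a map `y : M → N`, the part of `N \ y(M)` consisting of the connected components of
`N \ y(M)` that meet the focal sphere `{0} × 𝕊^k`.  For the embeddings `y` close to a Clifford torus,
`N \ y(M)` has two connected components and this is one of them. -/
def region {j k : ℕ} (y : Prd j k → Amb j k) : Set (Amb j k) :=
  ⋃ q : Sph k, connectedComponentIn (Metric.sphere (0 : Amb j k) 1 \ range y)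
    (WithLp.toLp 2 ((0 : Euc j), (q : Euc k)))

/-- The volume of the region `region y` bounded by `y` in the round sphere `N = 𝕊^(j+k+1)`. -/
def enclosedVolume {j k : ℕ} (y : Prd j k → Amb j k) : ℝ :=
  ((volume : Measure (Amb j k)).toSphere
    ((fun z : Metric.sphere (0 : Amb j k) 1 => (z : Amb j k)) ⁻¹' region y)).toReal

/-! ### The Clifford tori and the local chart around them -/

/-- The Clifford torus `x_r(p, q) = (r p, √(1 - r²) q)`. -/
def clifford (j k : ℕ) (r : ℝ) (x : Prd j k) : Amb j k :=
  WithLp.toLp 2 (r • (x.1 : Euc j), Real.sqrt (1 - r ^ 2) • (x.2 : Euc k))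

/-- The unit normal field `(√(1 - r²) p, - r q)` of the Clifford torus `x_r` in `N`; it points out of
the component of the complement of the torus that contains `{0} × 𝕊^k`. -/
def normal (j k : ℕ) (r : ℝ) (x : Prd j k) : Amb j k :=
  WithLp.toLp 2 (Real.sqrt (1 - r ^ 2) • (x.1 : Euc j), -(r • (x.2 : Euc k)))

/-- The map `x ↦ exp_{x_r(x)} (u(x) n(x))`, where `n` is the unit normal field of `x_r` and `exp` is
the exponential map of the unit sphere `N`.  The map `u ↦ [normalGraph j k r u]`, for `u` of class
`C^{2,α}` near `0`, is (the inverse of) the local chart around `[x_r]` of the manifold of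
unparameterized embeddings `M → N`; in particular it identifies the tangent space at `[x_r]` with the
space of `C^{2,α}` functions on `M`. -/
def normalGraph (j k : ℕ) (r : ℝ) (u : Prd j k → ℝ) (x : Prd j k) : Amb j k :=
  Real.cos (u x) • clifford j k r x + Real.sin (u x) • normal j k r x

/-- The functional `𝒜_lam = 𝒜 + lam 𝒱` in the local chart around `[x_r]`. -/
def lagrangian (j k : ℕ) (r lam : ℝ) (u : Prd j k → ℝ) : ℝ :=
  area (normalGraph j k r u) + lam * enclosedVolume (normalGraph j k r u)

/-- `[x_r]` is a critical point of `𝒜_lam`, i.e. `lam` is a Lagrange multiplier of the constrained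
critical point `[x_r]` of `𝒜`, subject to `𝒱 = const`. -/
def IsLagrangeMultiplier (j k : ℕ) (α : ℝ≥0) (r lam : ℝ) : Prop :=
  ∀ f : Prd j k → ℝ, IsC2Holder α f →
    HasDerivAt (fun t : ℝ => lagrangian j k r lam (t • f)) 0 0

/-- The second variation `d²𝒜_lam([x_r])(f, g)`, the second derivative in the local chart. -/
def secondVariation (j k : ℕ) (r lam : ℝ) (f g : Prd j k → ℝ) : ℝ :=
  deriv (fun s : ℝ => deriv (fun t : ℝ => lagrangian j k r lam (s • f + t • g)) 0) 0

/-- `f` lies in the kernel of `d𝒱([x_r])`, i.e. is tangent to the level hypersurface of `𝒱`. -/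
def TangentToConstraint (j k : ℕ) (r : ℝ) (f : Prd j k → ℝ) : Prop :=
  HasDerivAt (fun t : ℝ => enclosedVolume (normalGraph j k r (t • f))) 0 0

/-- The tangent space at `[x_r]` to the `SO(j+k+2)`-orbit of `[x_r]`: the normal components
`⟨h(x_r), n⟩` of the infinitesimal rotations `h ∈ so(j+k+2)` along `x_r`. -/
def orbitTangent (j k : ℕ) (r : ℝ) : Set (Prd j k → ℝ) :=
  {f | ∃ h : Amb j k →ₗ[ℝ] Amb j k, (∀ v w, inner ℝ (h v) w = -inner ℝ v (h w)) ∧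
    ∀ x, f x = inner ℝ (h (clifford j k r x)) (normal j k r x)}

/-- The critical orbit of `[x_r]` is nondegenerate: the kernel of `d²𝒜_lam([x_r])` in the tangent
space at `[x_r]` is the tangent space to the orbit. -/
def IsNondegenerate (j k : ℕ) (α : ℝ≥0) (r lam : ℝ) : Prop :=
  {f : Prd j k → ℝ | IsC2Holder α f ∧
      ∀ g : Prd j k → ℝ, IsC2Holder α g → secondVariation j k r lam f g = 0} =
    orbitTangent j k r

/-- The strong Morse index: the maximal dimension of a space of `C^{2,α}` functions on which
`d²𝒜_lam([x_r])` is negative definite. -/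
def strongMorseIndex (j k : ℕ) (α : ℝ≥0) (r lam : ℝ) : ℕ∞ :=
  ⨆ (W : Submodule ℝ (Prd j k → ℝ)) (_ : ∀ f ∈ W, IsC2Holder α f)
    (_ : ∀ f ∈ W, f ≠ 0 → secondVariation j k r lam f f < 0), Cardinal.toENat (Module.rank ℝ W)

/-- The weak Morse index: the maximal dimension of a space of `C^{2,α}` functions tangent to the
constraint on which `d²𝒜_lam([x_r])` is negative definite. -/
def weakMorseIndex (j k : ℕ) (α : ℝ≥0) (r lam : ℝ) : ℕ∞ :=
  ⨆ (W : Submodule ℝ (Prd j k → ℝ))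
    (_ : ∀ f ∈ W, IsC2Holder α f ∧ TangentToConstraint j k r f)
    (_ : ∀ f ∈ W, f ≠ 0 → secondVariation j k r lam f f < 0), Cardinal.toENat (Module.rank ℝ W)

/-- At `r₀` the function `μ` has a jump of absolute value `d`: near `r₀` it is finite and constant on
either side of `r₀`, and the two values differ by `d` in absolute value. -/
def HasJump (μ : ℝ → ℕ∞) (r₀ : ℝ) (d : ℤ) : Prop :=
  ∃ ε > (0 : ℝ), ∃ a b : ℕ, (∀ r ∈ Ioo (r₀ - ε) r₀, μ r = a) ∧ (∀ r ∈ Ioo r₀ (r₀ + ε), μ r = b) ∧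
    |(b : ℤ) - (a : ℤ)| = d

/-! ### The sequences of degeneracy instants -/

/-- `β_i(j) = (i - 2)(j + i - 1)`. -/
def beta (j i : ℕ) : ℝ := ((i : ℝ) - 2) * ((j : ℝ) + i - 1)

/-- `r_i = √(β_i(j) / (m - j + β_i(j)))`. -/
def rInst (m j i : ℕ) : ℝ := Real.sqrt (beta j i / ((m : ℝ) - j + beta j i))

/-- `s_l = √(j / (j + γ_l))` with `γ_l = (l - 2)(m - j + l - 1)`. -/
def sInst (m j l : ℕ) : ℝ :=
  Real.sqrt ((j : ℝ) / ((j : ℝ) + ((l : ℝ) - 2) * ((m : ℝ) - j + l - 1)))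

/-- `C(d+i-1, i-1) - C(d+i-3, i-3)`, used only for `i ≥ 3`. -/
def mult (d i : ℕ) : ℤ := ((d + i - 1).choose (i - 1) : ℤ) - ((d + i - 3).choose (i - 3) : ℤ)

end CliffordCMC

end

noncomputable section

namespace CliffordCMC

/-! ### Differentiation under the integral sign over compact spaces -/

section Parametric

variable {X : Type*} [TopologicalSpace X] [CompactSpace X] [MeasurableSpace X] [BorelSpace X]
  (μ : Measure X) [IsFiniteMeasure μ]

/-! Put k = m - j and r = sin θ. The normal graph of u over x_r is (sin w · p, cos w · q) with w = θ
+ u, so near x_r both functionals become explicit integrals over M. The volume is the integral of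
`capVol` (w), whose derivative is sin^j cos^k (`region_graphMap`, `enclosedVolume_graphMap`). The
area is the integral of sin^j w cos^k w √(1 + |∇₁w|²/sin²w + |∇₂w|²/cos²w), where ∇₁ and ∇₂ are the
gradients along the two spheres (`det_gram_graphMap`).

Let G(θ) = sin^j θ cos^k θ, with logarithmic derivative ℓ(θ). The first variation of 𝒜 + λ𝒱 is G(ℓ +
λ)∫f, hence λ_r = -ℓ(θ). For this λ the second variation (`secondVariation_eq`) is G times the
integral of (|∇₁f|² - j f²)/r² + (|∇₂f|² - k f²)/(1 - r²). It is diagonal in products of spherical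
harmonics of degrees a and b, with eigenvalue μ(a,b) = (a-1)(a+j)/r² + (b-1)(b+k)/(1-r²)
(`jacobiForm_mode`).

Everything is read off from these numbers. The indices count negative modes (`iSup_rank_eq_card`).
The constraint ∫f = 0 removes exactly the constant mode (0,0), which is always negative; this is the
difference 1 between the two indices. The mode (1,1) is always null and consists of the functions
⟨Ap, q⟩, that is, of the tangent space to the orbit (`mem_orbitTangent_iff`, `isNondegenerate_iff`).
All other modes with a, b ≥ 1 are positive, while (1,0) and (0,1) are always negative. There remain
(a,0) and (0,b) with a, b ≥ 2: each vanishes for exactly one r, namely r_{a+1} or s_{b+1}, and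
changes sign there, and no two vanish at the same r. The jump is therefore the dimension of one
space of spherical harmonics (`hasJump_of_mode`).

The spectral part needs no elliptic theory. Harmonics of degree n are the orthogonal complement,
within homogeneous polynomials of degree n on the sphere, of those of degree n - 2. Green's formula
follows from the rotation invariance of the measure, completeness from the Stone-Weierstrass
theorem, and semiboundedness of the form replaces a spectral theorem (`form_nonneg_of_coeff`). -/

theorem integrable_of_continuous {f : X → ℝ} (hf : Continuous f) : Integrable f μ :=
  hf.integrable_of_hasCompactSupport (HasCompactSupport.of_compactSpace f)

/-- The integrand sees x only through a continuous map c into a normed space, so smoothness is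
needed in (t, c) alone. The tube lemma yields a compact product of an interval and `range c` inside
O; the derivative is bounded there, and a constant dominates because the measure is finite. -/
theorem hasDerivAt_integral_of_contDiffOn {E : Type*} [NormedAddCommGroup E] [NormedSpace ℝ E]
    {K : ℝ × E → ℝ} {O : Set (ℝ × E)} (hO : IsOpen O) (hK : ContDiffOn ℝ 1 K O)
    {c : X → E} (hc : Continuous c) {t₀ : ℝ} (h : ∀ x, (t₀, c x) ∈ O) :
    HasDerivAt (fun t => ∫ x, K (t, c x) ∂μ) (∫ x, fderiv ℝ K (t₀, c x) (1, 0) ∂μ) t₀ := by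
  have hcomp : IsCompact (range c) := isCompact_range hc
  obtain ⟨u, v, hu, hv, htu, hcv, huv⟩ := generalized_tube_lemma (isCompact_singleton (x := t₀))
    hcomp hO (by
      rintro ⟨a, b⟩ ⟨ha, x, rfl⟩
      obtain rfl : a = t₀ := ha
      exact h x)
  obtain ⟨ε, hε, hεu⟩ := Metric.nhds_basis_closedBall.mem_iff.1
    (hu.mem_nhds (singleton_subset_iff.1 htu))
  have hsub : Metric.closedBall t₀ ε ×ˢ range c ⊆ O := (prod_mono hεu hcv).trans huv
  have hfd : ContinuousOn (fun z => fderiv ℝ K z (1, 0)) O :=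
    (hK.continuousOn_fderiv_of_isOpen hO le_rfl).clm_apply continuousOn_const
  obtain ⟨C, hC⟩ := ((isCompact_closedBall t₀ ε).prod hcomp).exists_bound_of_continuousOn
    (hfd.mono hsub)
  have hcont : ∀ t ∈ Metric.closedBall t₀ ε, Continuous fun x => K (t, c x) := fun t ht =>
    hK.continuousOn.comp_continuous (by fun_prop) fun x => hsub ⟨ht, x, rfl⟩
  have ht₀ : t₀ ∈ Metric.closedBall t₀ ε := Metric.mem_closedBall_self hε.le
  refine (hasDerivAt_integral_of_dominated_loc_of_deriv_le (μ := μ) (bound := fun _ => C)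
    (F' := fun t x => fderiv ℝ K (t, c x) (1, 0))
    (Metric.closedBall_mem_nhds t₀ hε) ?_ ?_ ?_ ?_ ?_ ?_).2
  · filter_upwards [Metric.closedBall_mem_nhds t₀ hε] with t ht
    exact (integrable_of_continuous μ (hcont t ht)).aestronglyMeasurable
  · exact integrable_of_continuous μ (hcont t₀ ht₀)
  · exact (integrable_of_continuous μ (hfd.comp_continuous (by fun_prop)
      fun x => hsub ⟨ht₀, x, rfl⟩)).aestronglyMeasurable
  · exact Filter.Eventually.of_forall fun x t ht => hC _ ⟨ht, x, rfl⟩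
  · exact integrable_const _
  · refine Filter.Eventually.of_forall fun x t ht => ?_
    have hd : HasFDerivAt K (fderiv ℝ K (t, c x)) (t, c x) :=
      ((hK.differentiableOn one_ne_zero).differentiableAt
        (hO.mem_nhds (hsub ⟨ht, x, rfl⟩))).hasFDerivAt
    exact hd.comp_hasDerivAt t ((hasDerivAt_id t).prodMk (hasDerivAt_const t (c x)))

/-- The integral of the derivative of a function along a measure preserving flow vanishes. -/
theorem integral_eq_zero_of_flow {φ : ℝ → X → X} (hφ : ∀ τ, MeasurePreserving (φ τ) μ μ)
    (h0 : ∀ x, φ 0 x = x) {F D : X → ℝ} (hF : Continuous F) (hD : Continuous D)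
    (hd : ∀ τ x, HasDerivAt (fun τ => F (φ τ x)) (D (φ τ x)) τ) : ∫ x, D x ∂μ = 0 := by
  obtain ⟨C, hC⟩ := isCompact_univ.exists_bound_of_continuousOn hD.continuousOn
  -- By invariance of μ the integral does not depend on τ; the claim is that its derivative at 0,
  -- taken under the integral sign, vanishes.
  have hconst : ∀ τ, ∫ x, F (φ τ x) ∂μ = ∫ x, F x ∂μ := fun τ => by
    rw [← integral_map (hφ τ).measurable.aemeasurable
      (by rw [(hφ τ).map_eq]; exact (integrable_of_continuous μ hF).aestronglyMeasurable),
      (hφ τ).map_eq]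
  have hmeas : ∀ {f : X → ℝ}, Continuous f → ∀ τ,
      AEStronglyMeasurable (fun x => f (φ τ x)) μ := fun hf τ =>
    (integrable_of_continuous μ hf).aestronglyMeasurable.comp_quasiMeasurePreserving
      (hφ τ).quasiMeasurePreserving
  have key := (hasDerivAt_integral_of_dominated_loc_of_deriv_le (μ := μ) (bound := fun _ => C)
    (F := fun τ x => F (φ τ x)) (F' := fun τ x => D (φ τ x)) (x₀ := 0)
    Filter.univ_mem (Filter.Eventually.of_forall fun τ => hmeas hF τ)
    (by simpa [h0] using integrable_of_continuous μ hF)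
    (hmeas hD 0) (Filter.Eventually.of_forall fun x τ _ => hC _ (mem_univ _))
    (integrable_const _) (Filter.Eventually.of_forall fun x τ _ => hd τ x)).2
  simp only [hconst, h0] at key
  exact key.unique (hasDerivAt_const _ _)

end Parametric

/-! ### Plane rotations -/

section Rotation

variable {V : Type*} [NormedAddCommGroup V] [InnerProductSpace ℝ V]

/-- The infinitesimal rotation in the plane spanned by `u` and `v`. -/
def planeSkew (u v : V) : V →L[ℝ] V :=
  (innerSL ℝ u).smulRight v - (innerSL ℝ v).smulRight u

theorem planeSkew_apply (u v x : V) :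
    planeSkew u v x = inner ℝ u x • v - inner ℝ v x • u := by
  simp [planeSkew]

theorem inner_planeSkew_self (u v x : V) : inner ℝ x (planeSkew u v x) = 0 := by
  rw [planeSkew_apply, inner_sub_right, inner_smul_right, inner_smul_right,
    real_inner_comm x u, real_inner_comm x v]
  ring

/-- The rotation by the angle `τ` in the plane spanned by `u` and `v`. -/
def planeRotLin (u v : V) (τ : ℝ) : V →ₗ[ℝ] V :=
  LinearMap.id
    + ((Real.cos τ - 1) • (innerₛₗ ℝ u) - Real.sin τ • (innerₛₗ ℝ v)).smulRight u
    + ((Real.cos τ - 1) • (innerₛₗ ℝ v) + Real.sin τ • (innerₛₗ ℝ u)).smulRight v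

theorem planeRotLin_apply (u v x : V) (τ : ℝ) : planeRotLin u v τ x =
    x + ((Real.cos τ - 1) * inner ℝ u x - Real.sin τ * inner ℝ v x) • u
      + ((Real.cos τ - 1) * inner ℝ v x + Real.sin τ * inner ℝ u x) • v := by
  simp [planeRotLin]

theorem norm_planeRotLin {u v : V} (hu : ‖u‖ = 1) (hv : ‖v‖ = 1) (huv : inner ℝ u v = 0)
    (τ : ℝ) (x : V) : ‖planeRotLin u v τ x‖ = ‖x‖ := by
  have h1 : inner ℝ u u = (1 : ℝ) := by rw [real_inner_self_eq_norm_sq, hu]; norm_num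
  have h2 : inner ℝ v v = (1 : ℝ) := by rw [real_inner_self_eq_norm_sq, hv]; norm_num
  have h3 : inner ℝ v u = (0 : ℝ) := by rw [real_inner_comm]; exact huv
  rw [← sq_eq_sq₀ (norm_nonneg _) (norm_nonneg _), ← real_inner_self_eq_norm_sq,
    ← real_inner_self_eq_norm_sq, planeRotLin_apply]
  simp only [inner_add_left, inner_add_right, inner_smul_left, inner_smul_right, h1, h2, h3, huv,
    RCLike.conj_to_real]
  rw [real_inner_comm u x, real_inner_comm v x]
  have := Real.sin_sq_add_cos_sq τ
  linear_combination ((inner ℝ u x) ^ 2 + (inner ℝ v x) ^ 2) * this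

/-- The rotation by the angle `τ` in the plane spanned by the orthonormal vectors `u` and `v`. -/
def planeRot [FiniteDimensional ℝ V] {u v : V} (hu : ‖u‖ = 1) (hv : ‖v‖ = 1)
    (huv : inner ℝ u v = 0) (τ : ℝ) : V ≃ₗᵢ[ℝ] V :=
  LinearIsometry.toLinearIsometryEquiv ⟨planeRotLin u v τ, norm_planeRotLin hu hv huv τ⟩ rfl

variable [FiniteDimensional ℝ V]

theorem planeRot_apply {u v : V} (hu : ‖u‖ = 1) (hv : ‖v‖ = 1) (huv : inner ℝ u v = 0) (τ : ℝ)
    (x : V) : planeRot hu hv huv τ x = planeRotLin u v τ x := rfl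

theorem planeRot_zero {u v : V} (hu : ‖u‖ = 1) (hv : ‖v‖ = 1) (huv : inner ℝ u v = 0) (x : V) :
    planeRot hu hv huv 0 x = x := by
  simp [planeRot_apply, planeRotLin_apply]

/-- The derivative is expressed at the moving point and not at x: this is the flow equation that
`integral_eq_zero_of_flow` asks for. -/
theorem hasDerivAt_planeRot {u v : V} (hu : ‖u‖ = 1) (hv : ‖v‖ = 1) (huv : inner ℝ u v = 0)
    (τ : ℝ) (x : V) :
    HasDerivAt (fun τ => planeRot hu hv huv τ x) (planeSkew u v (planeRot hu hv huv τ x)) τ := by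
  have h1 : inner ℝ u u = (1 : ℝ) := by rw [real_inner_self_eq_norm_sq, hu]; norm_num
  have h2 : inner ℝ v v = (1 : ℝ) := by rw [real_inner_self_eq_norm_sq, hv]; norm_num
  have h3 : inner ℝ v u = (0 : ℝ) := by rw [real_inner_comm]; exact huv
  simp only [planeRot_apply, planeRotLin_apply]
  have hc := (Real.hasDerivAt_cos τ).sub_const 1
  have hs := Real.hasDerivAt_sin τ
  convert! ((((hc.mul_const (inner ℝ u x)).sub (hs.mul_const (inner ℝ v x))).smul_const u).const_add
    x).add (((hc.mul_const (inner ℝ v x)).add (hs.mul_const (inner ℝ u x))).smul_const v) using 1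
  simp only [planeSkew_apply, inner_add_right, inner_smul_right, h1, h2, h3, huv]
  module

end Rotation

/-! ### Isometries of the sphere -/

section SphereIsometry

variable {V : Type*} [NormedAddCommGroup V] [InnerProductSpace ℝ V] [FiniteDimensional ℝ V]
  [MeasurableSpace V] [BorelSpace V]

/-- The action of a linear isometry on the unit sphere. -/
def sphereMap (R : V ≃ₗᵢ[ℝ] V) (x : Metric.sphere (0 : V) 1) : Metric.sphere (0 : V) 1 :=
  ⟨R x, by simp⟩

omit [FiniteDimensional ℝ V] [MeasurableSpace V] [BorelSpace V] in
@[simp] theorem coe_sphereMap (R : V ≃ₗᵢ[ℝ] V) (x : Metric.sphere (0 : V) 1) :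
    (sphereMap R x : V) = R x := rfl

open scoped Pointwise in
-- The spherical measure of s is the dimension times the Lebesgue measure of the cone (0,1)·s. A
-- linear isometry carries cones to cones and preserves Lebesgue measure.
theorem measurePreserving_sphereMap (R : V ≃ₗᵢ[ℝ] V) :
    MeasurePreserving (sphereMap R) (volume : Measure V).toSphere (volume : Measure V).toSphere := by
  have hm : Measurable (sphereMap R) :=
    (Continuous.subtype_mk (by fun_prop) _ : Continuous (sphereMap R)).measurable
  refine ⟨hm, Measure.ext fun s hs => ?_⟩
  rw [Measure.map_apply hm hs, Measure.toSphere_apply' _ (hm hs), Measure.toSphere_apply' _ hs]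
  congr 1
  have hR := R.measurePreserving.measure_preimage_equiv (f := R.toMeasurableEquiv)
    (Ioo (0 : ℝ) 1 • ((↑) '' s : Set V))
  rw [← hR]
  congr 1
  ext z
  simp only [Set.mem_smul, mem_image, mem_preimage]
  constructor
  · rintro ⟨t, ht, _, ⟨x, hx, rfl⟩, rfl⟩
    exact ⟨t, ht, _, ⟨_, hx, rfl⟩, by simp⟩
  · rintro ⟨t, ht, _, ⟨x, hx, rfl⟩, h⟩
    refine ⟨t, ht, _, ⟨sphereMap R.symm x, ?_, rfl⟩, ?_⟩
    · convert hx
      ext1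
      simp
    · apply R.injective
      simp only [coe_sphereMap, map_smul, LinearIsometryEquiv.apply_symm_apply]
      exact h

end SphereIsometry

/-! ### Polynomials on Euclidean space and their infinitesimal rotations -/

section Polynomials

open MvPolynomial

variable {d : ℕ}

/-- The value of a polynomial at a point of `ℝ^(d+1)`. -/
def polyEval (P : MvPolynomial (Fin (d + 1)) ℝ) (x : Euc d) : ℝ := MvPolynomial.eval x.ofLp P

theorem sum_smul_proj_apply (c : Fin (d + 1) → ℝ) (v : Euc d) :
    (∑ i, c i • (EuclideanSpace.proj i : Euc d →L[ℝ] ℝ)) v = ∑ i, c i * v.ofLp i := by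
  simp

theorem hasFDerivAt_polyEval (P : MvPolynomial (Fin (d + 1)) ℝ) (x : Euc d) :
    HasFDerivAt (polyEval P)
      (∑ i, polyEval (pderiv i P) x • (EuclideanSpace.proj i : Euc d →L[ℝ] ℝ)) x := by
  induction P using MvPolynomial.induction_on with
  | C a =>
    have hfun : polyEval (C a) = fun _ : Euc d => a := by ext y; simp [polyEval]
    rw [hfun]
    exact (hasFDerivAt_const a x).congr_fderiv (by simp [polyEval])
  | add p q hp hq =>
    have hfun : polyEval (p + q) = polyEval p + polyEval q := by ext y; simp [polyEval]
    rw [hfun]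
    refine (hp.add hq).congr_fderiv ?_
    simp only [polyEval, map_add, add_smul, Finset.sum_add_distrib]
  | mul_X p i hp =>
    have hX : HasFDerivAt (fun x : Euc d => x.ofLp i) (EuclideanSpace.proj i : Euc d →L[ℝ] ℝ) x :=
      (EuclideanSpace.proj i : Euc d →L[ℝ] ℝ).hasFDerivAt
    have hprod := hp.mul hX
    have hfun : polyEval (p * X i) = fun x : Euc d => polyEval p x * x.ofLp i := by
      ext y; simp [polyEval]
    rw [hfun]
    refine hprod.congr_fderiv ?_
    ext v
    have h1 : ∀ l, polyEval (pderiv l (p * X i)) x * v.ofLp l =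
        polyEval p x * (if l = i then v.ofLp l else 0)
          + x.ofLp i * (polyEval (pderiv l p) x * v.ofLp l) := fun l => by
      by_cases hl : l = i
      · subst hl; simp [polyEval]; ring
      · simp [polyEval, pderiv_X, hl, Ne.symm hl]; ring
    rw [sum_smul_proj_apply, Finset.sum_congr rfl fun l _ => h1 l]
    simp [Finset.sum_add_distrib, Finset.mul_sum]

theorem contDiff_polyEval (P : MvPolynomial (Fin (d + 1)) ℝ) {n : WithTop ℕ∞} :
    ContDiff ℝ n (polyEval P) := by
  induction P using MvPolynomial.induction_on with
  | C a =>
    have : polyEval (C a) = fun _ : Euc d => a := by ext y; simp [polyEval]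
    rw [this]; exact contDiff_const
  | add p q hp hq =>
    have : polyEval (p + q) = fun x => polyEval p x + polyEval q x := by ext; simp [polyEval]
    rw [this]; exact hp.add hq
  | mul_X p i hp =>
    have : polyEval (p * X i) = fun x => polyEval p x * x.ofLp i := by ext; simp [polyEval]
    rw [this]
    exact hp.mul (EuclideanSpace.proj i : Euc d →L[ℝ] ℝ).contDiff

/-- The derivation `x_a ∂_b - x_b ∂_a`. -/
def rotDer (a b : Fin (d + 1)) (P : MvPolynomial (Fin (d + 1)) ℝ) : MvPolynomial (Fin (d + 1)) ℝ :=
  X a * pderiv b P - X b * pderiv a P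

theorem rotDer_mul (a b : Fin (d + 1)) (P Q : MvPolynomial (Fin (d + 1)) ℝ) :
    rotDer a b (P * Q) = rotDer a b P * Q + P * rotDer a b Q := by
  simp only [rotDer, Derivation.leibniz, smul_eq_mul]
  ring

/-- The standard basis vector of `ℝ^(d+1)`. -/
abbrev stdVec (a : Fin (d + 1)) : Euc d := EuclideanSpace.single a (1 : ℝ)

theorem planeSkew_stdVec (a b : Fin (d + 1)) (x : Euc d) :
    planeSkew (stdVec a) (stdVec b) x = x.ofLp a • stdVec b - x.ofLp b • stdVec a := by
  simp [planeSkew_apply, EuclideanSpace.inner_single_left]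

/-- This is the link between algebra and geometry: the derivation `rotDer` is differentiation along
the rotation field of a coordinate plane. -/
theorem sum_polyEval_pderiv_planeSkew (a b : Fin (d + 1)) (P : MvPolynomial (Fin (d + 1)) ℝ)
    (x : Euc d) :
    (∑ i, polyEval (pderiv i P) x • (EuclideanSpace.proj i : Euc d →L[ℝ] ℝ))
      (planeSkew (stdVec a) (stdVec b) x) = polyEval (rotDer a b P) x := by
  rw [planeSkew_stdVec]
  simp [rotDer, polyEval, sub_mul, ite_mul, Finset.sum_sub_distrib, mul_comm]

theorem stdVec_inner {a b : Fin (d + 1)} (h : a ≠ b) : inner ℝ (stdVec a) (stdVec b) = 0 := by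
  simp [EuclideanSpace.inner_single_left, h]

theorem norm_stdVec (a : Fin (d + 1)) : ‖stdVec a‖ = 1 := by simp

/-- The rotation in a coordinate plane. -/
def coordRot {a b : Fin (d + 1)} (h : a ≠ b) (τ : ℝ) : Euc d ≃ₗᵢ[ℝ] Euc d :=
  planeRot (norm_stdVec a) (norm_stdVec b) (stdVec_inner h) τ

theorem coordRot_zero {a b : Fin (d + 1)} (h : a ≠ b) (x : Euc d) : coordRot h 0 x = x :=
  planeRot_zero _ _ _ x

theorem hasDerivAt_coordRot {a b : Fin (d + 1)} (h : a ≠ b) (τ : ℝ) (x : Euc d) :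
    HasDerivAt (fun τ => coordRot h τ x)
      (planeSkew (stdVec a) (stdVec b) (coordRot h τ x)) τ :=
  hasDerivAt_planeRot _ _ _ τ x

theorem rotDer_self (a : Fin (d + 1)) (P : MvPolynomial (Fin (d + 1)) ℝ) : rotDer a a P = 0 := by
  simp [rotDer]

/-- Twice the spherical Laplacian, on polynomials. -/
def rotLap (P : MvPolynomial (Fin (d + 1)) ℝ) : MvPolynomial (Fin (d + 1)) ℝ :=
  ∑ a, ∑ b, rotDer a b (rotDer a b P)

/-- The Euclidean Laplacian, on polynomials. -/
def polyLap (P : MvPolynomial (Fin (d + 1)) ℝ) : MvPolynomial (Fin (d + 1)) ℝ :=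
  ∑ i, pderiv i (pderiv i P)

theorem rotDer_isHomogeneous {n : ℕ} {P : MvPolynomial (Fin (d + 1)) ℝ} (h : P.IsHomogeneous n)
    (a b : Fin (d + 1)) : (rotDer a b P).IsHomogeneous n := by
  -- Degree 0 is separated because partial derivatives have degree n - 1 in truncated subtraction.
  rcases n with _ | n
  · obtain ⟨c, rfl⟩ : ∃ c, P = C c :=
      ⟨_, totalDegree_eq_zero_iff_eq_C.1 ((totalDegree_zero_iff_isHomogeneous _).2 h)⟩
    simp [rotDer, isHomogeneous_zero]
  · have h1 : ∀ a b : Fin (d + 1), (X a * pderiv b P).IsHomogeneous (n + 1) := fun a b => by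
      have := (isHomogeneous_X ℝ a).mul (h.pderiv (i := b))
      rwa [Nat.add_sub_cancel, add_comm 1 n] at this
    exact (homogeneousSubmodule _ ℝ (n + 1)).sub_mem (h1 a b) (h1 b a)

theorem rotLap_isHomogeneous {n : ℕ} {P : MvPolynomial (Fin (d + 1)) ℝ} (h : P.IsHomogeneous n) :
    (rotLap P).IsHomogeneous n :=
  (homogeneousSubmodule _ ℝ n).sum_mem fun a _ => (homogeneousSubmodule _ ℝ n).sum_mem fun b _ =>
    rotDer_isHomogeneous (rotDer_isHomogeneous h a b) a b

/-- The square of the norm, as a polynomial. -/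
def normSqPoly (d : ℕ) : MvPolynomial (Fin (d + 1)) ℝ := ∑ i, X i ^ 2

/-- Euler's identity twice: for P, of degree n, and for its partial derivatives, of degree n - 1. -/
theorem sum_X_mul_pderiv_pderiv {n : ℕ} {P : MvPolynomial (Fin (d + 1)) ℝ}
    (h : P.IsHomogeneous n) :
    ∑ a, ∑ b, X a * X b * pderiv a (pderiv b P) = C ((n : ℝ) * (n - 1)) * P := by
  have h1 : ∀ b, ∑ a, X a * pderiv a (pderiv b P) = C ((n : ℝ) - 1) * pderiv b P := fun b => by
    rcases n with _ | n
    · obtain ⟨c, rfl⟩ : ∃ c, P = C c :=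
        ⟨_, totalDegree_eq_zero_iff_eq_C.1 ((totalDegree_zero_iff_isHomogeneous _).2 h)⟩
      simp
    · rw [(h.pderiv (i := b)).sum_X_mul_pderiv, Nat.add_sub_cancel]
      simp
  rw [Finset.sum_comm]
  calc ∑ b, ∑ a, X a * X b * pderiv a (pderiv b P)
      = ∑ b, X b * ∑ a, X a * pderiv a (pderiv b P) := by
        refine Finset.sum_congr rfl fun b _ => ?_
        rw [Finset.mul_sum]
        exact Finset.sum_congr rfl fun a _ => by ring
    _ = C ((n : ℝ) - 1) * ∑ b, X b * pderiv b P := by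
        rw [Finset.mul_sum]
        exact Finset.sum_congr rfl fun b _ => by rw [h1]; ring
    _ = _ := by
        rw [h.sum_X_mul_pderiv, C_mul, nsmul_eq_mul]
        simp only [map_natCast]
        ring

theorem pderiv_X_eq_ite (a b : Fin (d + 1)) :
    pderiv b (X a : MvPolynomial (Fin (d + 1)) ℝ) = if a = b then 1 else 0 := by
  rw [pderiv_X, Pi.single_apply]

/-- The Casimir identity. When the squares are expanded, the second-order terms give |x|²Δ twice and
-n(n-1) twice, the first-order terms give -(d+1)n twice, and the diagonal correction gives +2n. -/
theorem rotLap_eq {n : ℕ} {P : MvPolynomial (Fin (d + 1)) ℝ} (h : P.IsHomogeneous n) :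
    rotLap P = 2 * (normSqPoly d * polyLap P) - C (2 * ((n : ℝ) * (n + d - 1))) * P := by
  have hE : ∑ i, X i * pderiv i P = C (n : ℝ) * P := by
    rw [h.sum_X_mul_pderiv, nsmul_eq_mul, map_natCast]
  have hEE := sum_X_mul_pderiv_pderiv h
  have hEE' : ∑ a, ∑ b, X a * X b * pderiv b (pderiv a P) = C ((n : ℝ) * (n - 1)) * P := by
    rw [← hEE, Finset.sum_comm]
    exact Finset.sum_congr rfl fun a _ => Finset.sum_congr rfl fun b _ => by ring
  -- The conditional term comes from ∂_b x_a = δ_ab.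
  have hpt : ∀ a b, rotDer a b (rotDer a b P) =
      X a ^ 2 * pderiv b (pderiv b P) + X b ^ 2 * pderiv a (pderiv a P)
      - X a * X b * pderiv a (pderiv b P) - X a * X b * pderiv b (pderiv a P)
      - X a * pderiv a P - X b * pderiv b P
      + (if a = b then X a * pderiv a P + X b * pderiv b P else 0) := fun a b => by
    simp only [rotDer, map_sub, Derivation.leibniz, smul_eq_mul, pderiv_X_eq_ite]
    by_cases hab : a = b
    · subst hab; simp; ring
    · have hba : ¬ b = a := fun h => hab h.symm
      simp [hab, hba]; ring
  have e1 : ∑ a, ∑ b, (X a : MvPolynomial (Fin (d + 1)) ℝ) ^ 2 * pderiv b (pderiv b P) =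
      normSqPoly d * polyLap P := by
    simp only [normSqPoly, polyLap, Finset.sum_mul_sum]
  have e2 : ∑ a, ∑ b, (X b : MvPolynomial (Fin (d + 1)) ℝ) ^ 2 * pderiv a (pderiv a P) =
      normSqPoly d * polyLap P := by
    rw [← e1, Finset.sum_comm]
  have e3 : ∑ a : Fin (d + 1), ∑ _b : Fin (d + 1), X a * pderiv a P =
      C ((d : ℝ) + 1) * (C (n : ℝ) * P) := by
    rw [← hE, Finset.sum_comm]
    simp
  have e4 : ∑ _a : Fin (d + 1), ∑ b : Fin (d + 1), X b * pderiv b P =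
      C ((d : ℝ) + 1) * (C (n : ℝ) * P) := by
    rw [← e3, Finset.sum_comm]
  have e5 : ∑ a : Fin (d + 1), ∑ b : Fin (d + 1),
      (if a = b then X a * pderiv a P + X b * pderiv b P else 0) = 2 * (C (n : ℝ) * P) := by
    simp only [Finset.sum_ite_eq, Finset.mem_univ, if_true, ← two_mul, ← Finset.mul_sum, hE]
  unfold rotLap
  simp only [hpt, Finset.sum_add_distrib, Finset.sum_sub_distrib, hEE, hEE', e1, e2, e3, e4, e5]
  simp only [map_mul, map_sub, map_add, map_one, map_natCast, map_ofNat]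
  ring

theorem polyLap_isHomogeneous {n : ℕ} {P : MvPolynomial (Fin (d + 1)) ℝ}
    (h : P.IsHomogeneous (n + 2)) : (polyLap P).IsHomogeneous n :=
  (homogeneousSubmodule _ ℝ n).sum_mem fun i _ => (h.pderiv (i := i)).pderiv (i := i)

theorem polyLap_eq_zero {n : ℕ} (hn : n < 2) {P : MvPolynomial (Fin (d + 1)) ℝ}
    (h : P.IsHomogeneous n) : polyLap P = 0 := by
  refine Finset.sum_eq_zero fun i _ => ?_
  have h1 : (pderiv i P).IsHomogeneous 0 := by
    have := h.pderiv (i := i)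
    rwa [show n - 1 = 0 by omega] at this
  rw [totalDegree_eq_zero_iff_eq_C.1 ((totalDegree_zero_iff_isHomogeneous _).2 h1), pderiv_C]

theorem polyEval_normSqPoly (x : Sph d) : polyEval (normSqPoly d) (x : Euc d) = 1 := by
  have := EuclideanSpace.norm_sq_eq (x : Euc d)
  simp only [norm_eq_of_mem_sphere, Real.norm_eq_abs, sq_abs] at this
  simp [polyEval, normSqPoly, ← this]

end Polynomials

/-! ### Spherical harmonics -/

section Harmonics

open MvPolynomial

variable {d : ℕ}

/-- The round measure of the unit sphere. -/
abbrev sphMeasure (d : ℕ) : Measure (Sph d) := (volume : Measure (Euc d)).toSphere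

/-- The restriction of polynomials to the sphere. -/
def sphRestrict (d : ℕ) : MvPolynomial (Fin (d + 1)) ℝ →ₐ[ℝ] C(Sph d, ℝ) :=
  aeval fun i => ⟨fun x : Sph d => (x : Euc d).ofLp i, by fun_prop⟩

theorem sphRestrict_apply (P : MvPolynomial (Fin (d + 1)) ℝ) (x : Sph d) :
    sphRestrict d P x = polyEval P (x : Euc d) := by
  induction P using MvPolynomial.induction_on with
  | C a => simp [sphRestrict, polyEval]
  | add p q hp hq => simpa [polyEval] using congr_arg₂ (· + ·) hp hq
  | mul_X p i hp =>
    rw [map_mul, ContinuousMap.mul_apply, hp]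
    simp [sphRestrict, polyEval]

/-- The class in `L²` of the restriction of a polynomial to the sphere. -/
def sphL2 (d : ℕ) : MvPolynomial (Fin (d + 1)) ℝ →ₗ[ℝ] Lp ℝ 2 (sphMeasure d) :=
  (ContinuousMap.toLp 2 (sphMeasure d) ℝ).toLinearMap ∘ₗ (sphRestrict d).toLinearMap

theorem inner_sphL2 (P Q : MvPolynomial (Fin (d + 1)) ℝ) :
    inner ℝ (sphL2 d P) (sphL2 d Q) =
      ∫ x : Sph d, polyEval P (x : Euc d) * polyEval Q (x : Euc d) ∂sphMeasure d := by
  refine (ContinuousMap.inner_toLp (sphMeasure d) (sphRestrict d P) (sphRestrict d Q)).trans ?_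
  simp [sphRestrict_apply, mul_comm]

theorem sphL2_eq_iff {P Q : MvPolynomial (Fin (d + 1)) ℝ} :
    sphL2 d P = sphL2 d Q ↔ ∀ x : Sph d, polyEval P (x : Euc d) = polyEval Q (x : Euc d) := by
  simp only [← sphRestrict_apply]
  refine (ContinuousMap.toLp_injective (sphMeasure d)).eq_iff.trans ?_
  exact ContinuousMap.ext_iff

theorem polyEval_smul {n : ℕ} {P : MvPolynomial (Fin (d + 1)) ℝ} (h : P.IsHomogeneous n)
    (t : ℝ) (x : Euc d) : polyEval P (t • x) = t ^ n * polyEval P x := by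
  simp only [polyEval, eval_eq', Finset.mul_sum]
  refine Finset.sum_congr rfl fun m hm => ?_
  have hdeg : ∑ i, m i = n := by
    rw [← Finsupp.degree_eq_sum]
    by_contra hne
    exact (mem_support_iff.1 hm) (h.coeff_eq_zero hne)
  simp only [PiLp.smul_apply, smul_eq_mul, mul_pow, Finset.prod_mul_distrib,
    Finset.prod_pow_eq_pow_sum, hdeg]
  ring

/-- Scaling extends the vanishing from the sphere to all nonzero points and density to the origin;
over an infinite field a polynomial is determined by its values. -/
theorem homogeneous_eq_zero_of_sphere {n : ℕ} {P : MvPolynomial (Fin (d + 1)) ℝ}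
    (h : P.IsHomogeneous n) (hP : ∀ x : Sph d, polyEval P (x : Euc d) = 0) : P = 0 := by
  have hne : ∀ x : Euc d, x ≠ 0 → polyEval P x = 0 := fun x hx => by
    have h1 := polyEval_smul h ‖x‖⁻¹ x
    rw [← show ((radial x hx : Sph d) : Euc d) = ‖x‖⁻¹ • x from rfl, hP] at h1
    exact (mul_eq_zero.1 h1.symm).resolve_left
      (pow_ne_zero _ (inv_ne_zero (norm_ne_zero_iff.2 hx)))
  have hall : ∀ x : Euc d, polyEval P x = 0 := fun x => by
    have hc : Continuous (polyEval P : Euc d → ℝ) := (contDiff_polyEval (n := 0) P).continuous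
    have hd : Dense ({0}ᶜ : Set (Euc d)) := dense_compl_singleton 0
    exact congr_fun (hc.ext_on hd continuous_const fun y hy => hne y hy) x
  refine MvPolynomial.funext fun x => ?_
  simpa [polyEval] using hall (WithLp.toLp 2 x)

/-- The monomials of degree n in d + 1 variables form a basis, and stars and bars counts them. -/
theorem finrank_homogeneousSubmodule (d n : ℕ) :
    Module.finrank ℝ (homogeneousSubmodule (Fin (d + 1)) ℝ n) = (d + n).choose n := by
  have hset : {m : Fin (d + 1) →₀ ℕ | m.degree = n} =
      ((Finset.univ : Finset (Fin (d + 1))).finsuppAntidiag n : Set (Fin (d + 1) →₀ ℕ)) := by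
    ext m
    simp [Finset.mem_finsuppAntidiag, Finsupp.degree_eq_sum]
  have hli : LinearIndependent ℝ
      (fun m : (Finset.univ : Finset (Fin (d + 1))).finsuppAntidiag n =>
        (monomial (m : Fin (d + 1) →₀ ℕ) (1 : ℝ))) :=
    (basisMonomials (Fin (d + 1)) ℝ).linearIndependent.comp _ Subtype.val_injective
  have h1 := finrank_span_eq_card hli
  have h2 : homogeneousSubmodule (Fin (d + 1)) ℝ n = Submodule.span ℝ (range
      (fun m : (Finset.univ : Finset (Fin (d + 1))).finsuppAntidiag n =>
        (monomial (m : Fin (d + 1) →₀ ℕ) (1 : ℝ)))) := by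
    rw [homogeneousSubmodule_eq_finsupp_supported, AddMonoidAlgebra.supported_eq_span_single, hset]
    congr 1
    ext p
    simp [single_eq_monomial]
  rw [h2, h1, Fintype.card_coe, Finset.card_finsuppAntidiag_nat_eq_choose, Finset.card_univ,
    Fintype.card_fin]
  congr 1
  omega

/-- The restrictions to the sphere of the homogeneous polynomials of degree `n`, in `L²`. -/
def homSpace (d n : ℕ) : Submodule ℝ (Lp ℝ 2 (sphMeasure d)) :=
  (homogeneousSubmodule (Fin (d + 1)) ℝ n).map (sphL2 d)

theorem finrank_homSpace (d n : ℕ) : Module.finrank ℝ (homSpace d n) = (d + n).choose n := by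
  have hinj : Function.Injective
      ((sphL2 d).domRestrict (homogeneousSubmodule (Fin (d + 1)) ℝ n)) := by
    refine (injective_iff_map_eq_zero _).2 fun P hP => Subtype.ext ?_
    have h0 : sphL2 d P.1 = sphL2 d 0 := by simpa using hP
    exact homogeneous_eq_zero_of_sphere P.2 fun x => by
      rw [sphL2_eq_iff.1 h0 x]; simp [polyEval]
  rw [homSpace, ← LinearMap.range_domRestrict, LinearMap.finrank_range_of_inj hinj,
    finrank_homogeneousSubmodule]

instance (n : ℕ) : FiniteDimensional ℝ (homSpace d n) := by
  have : Module.Finite ℝ (homogeneousSubmodule (Fin (d + 1)) ℝ n) :=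
    Module.Finite.iff_fg.2 (homogeneousSubmodule_fg _ _ n)
  exact Module.Finite.map _ _

/-- The polynomials of degree `n - 2`, seen among those of degree `n` by restriction to the
sphere. -/
def lowSpace (d : ℕ) : ℕ → Submodule ℝ (Lp ℝ 2 (sphMeasure d))
  | 0 => ⊥
  | 1 => ⊥
  | n + 2 => homSpace d n

/-- Multiplication by |x|² raises the degree by 2 and does not change the values on the sphere. -/
theorem lowSpace_le (d : ℕ) : ∀ n, lowSpace d n ≤ homSpace d n
  | 0 => bot_le
  | 1 => bot_le
  | n + 2 => by
    rintro _ ⟨P, hP, rfl⟩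
    have hr : (normSqPoly d).IsHomogeneous 2 :=
      (homogeneousSubmodule _ ℝ 2).sum_mem fun i _ => isHomogeneous_X_pow i 2
    refine ⟨normSqPoly d * P, ?_, ?_⟩
    · have := hr.mul hP
      rwa [add_comm 2 n] at this
    · refine sphL2_eq_iff.2 fun x => ?_
      have := polyEval_normSqPoly x
      simp only [polyEval, map_mul] at *
      rw [this, one_mul]

/-- The spherical harmonics of degree `n`, in `L²`. -/
def harmSpace (d n : ℕ) : Submodule ℝ (Lp ℝ 2 (sphMeasure d)) := (lowSpace d n)ᗮ ⊓ homSpace d n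

instance (n : ℕ) : FiniteDimensional ℝ (harmSpace d n) :=
  Submodule.finiteDimensional_of_le (inf_le_right : harmSpace d n ≤ homSpace d n)

/-- The dimension of the space of spherical harmonics of degree `n` on `𝕊^d`. -/
def harmDim (d n : ℕ) : ℕ := Module.finrank ℝ (harmSpace d n)

/-- Since harmonics are defined as an orthogonal complement, their number is a difference of two
binomial coefficients at once. That they are eigenfunctions is recovered in
`rotLap_of_mem_harmSpace`. -/
theorem finrank_lowSpace_add (d n : ℕ) :
    Module.finrank ℝ (lowSpace d n) + harmDim d n = (d + n).choose n :=
  (Submodule.finrank_add_inf_finrank_orthogonal (lowSpace_le d n)).trans (finrank_homSpace d n)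

theorem harmDim_zero (d : ℕ) : harmDim d 0 = 1 := by
  have h := finrank_lowSpace_add d 0
  rw [lowSpace, finrank_bot] at h
  simpa using h

theorem harmDim_one (d : ℕ) : harmDim d 1 = d + 1 := by
  have h := finrank_lowSpace_add d 1
  rw [lowSpace, finrank_bot] at h
  simpa using h

/-- The index i of an instant corresponds to degree i - 1. For i ≥ 3 none of the natural
subtractions in `mult` is truncated. -/
theorem harmDim_eq_mult (d : ℕ) {i : ℕ} (hi : 3 ≤ i) : (harmDim d (i - 1) : ℤ) = mult d i := by
  obtain ⟨n, rfl⟩ := Nat.exists_eq_add_of_le' hi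
  have := finrank_lowSpace_add d (n + 2)
  rw [lowSpace, finrank_homSpace] at this
  have e1 : n + 3 - 1 = n + 2 := rfl
  have e2 : d + (n + 3) - 1 = d + (n + 2) := rfl
  have e3 : d + (n + 3) - 3 = d + n := rfl
  rw [mult, e1, e2, e3, Nat.add_sub_cancel]
  omega

/-! ### Rotation invariance -/

/-- The integrand is the derivative of P along a flow of isometries of the sphere. -/
theorem integral_rotDer (a b : Fin (d + 1)) (P : MvPolynomial (Fin (d + 1)) ℝ) :
    ∫ x : Sph d, polyEval (rotDer a b P) (x : Euc d) ∂sphMeasure d = 0 := by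
  by_cases h : a = b
  · subst h
    simp [rotDer_self, polyEval]
  have hc : ∀ Q : MvPolynomial (Fin (d + 1)) ℝ, Continuous fun x : Sph d => polyEval Q (x : Euc d) :=
    fun Q => (contDiff_polyEval (n := 0) Q).continuous.comp continuous_subtype_val
  refine integral_eq_zero_of_flow (sphMeasure d) (φ := fun τ => sphereMap (coordRot h τ))
    (fun τ => measurePreserving_sphereMap _)
    (fun x => Subtype.ext (coordRot_zero h _)) (hc P) (hc _) fun τ x => ?_
  have := (hasFDerivAt_polyEval P (coordRot h τ (x : Euc d))).comp_hasDerivAt τ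
    (hasDerivAt_coordRot h τ (x : Euc d))
  rwa [sum_polyEval_pderiv_planeSkew] at this

theorem integrable_polyEval (P : MvPolynomial (Fin (d + 1)) ℝ) :
    Integrable (fun x : Sph d => polyEval P (x : Euc d)) (sphMeasure d) :=
  integrable_of_continuous _
    ((contDiff_polyEval (n := 0) P).continuous.comp continuous_subtype_val)

theorem inner_rotDer (a b : Fin (d + 1)) (P Q : MvPolynomial (Fin (d + 1)) ℝ) :
    inner ℝ (sphL2 d (rotDer a b P)) (sphL2 d Q) =
      -inner ℝ (sphL2 d P) (sphL2 d (rotDer a b Q)) := by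
  have h := integral_rotDer a b (P * Q)
  have e : ∀ x : Sph d, polyEval (rotDer a b (P * Q)) (x : Euc d) =
      polyEval (rotDer a b P * Q) (x : Euc d) + polyEval (P * rotDer a b Q) (x : Euc d) :=
    fun x => by simp [rotDer_mul, polyEval]
  rw [integral_congr_ae (.of_forall e),
    integral_add (integrable_polyEval _) (integrable_polyEval _)] at h
  simp only [inner_sphL2]
  simp only [polyEval, map_mul] at h ⊢
  linarith

/-- Each `rotDer` is skew-adjoint, so its square is self-adjoint. -/
theorem inner_rotLap (P Q : MvPolynomial (Fin (d + 1)) ℝ) :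
    inner ℝ (sphL2 d (rotLap P)) (sphL2 d Q) = inner ℝ (sphL2 d P) (sphL2 d (rotLap Q)) := by
  simp only [rotLap, map_sum, sum_inner, inner_sum]
  simp only [inner_rotDer, neg_neg]

/-- The eigenvalue of the spherical Laplacian on spherical harmonics of degree `n`. -/
def sphEig (d n : ℕ) : ℝ := (n : ℝ) * (n + d - 1)

/-- On the sphere |x|² = 1, so by `rotLap_eq` the defect in the eigenvalue equation is 2ΔP, of
degree n - 2. It is also orthogonal to all polynomials of degree n - 2, because `rotLap` is
self-adjoint and preserves degrees. Being in `lowSpace` and orthogonal to it, it vanishes. -/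
theorem rotLap_of_mem_harmSpace {n : ℕ} {P : MvPolynomial (Fin (d + 1)) ℝ}
    (hP : P.IsHomogeneous n) (h : sphL2 d P ∈ harmSpace d n) (x : Sph d) :
    polyEval (rotLap P) (x : Euc d) = -(2 * sphEig d n) * polyEval P (x : Euc d) := by
  have hW : sphL2 d (rotLap P) + (2 * sphEig d n) • sphL2 d P = (2 : ℝ) • sphL2 d (polyLap P) := by
    rw [← map_smul, ← map_add, ← map_smul]
    refine sphL2_eq_iff.2 fun x => ?_
    have := polyEval_normSqPoly x
    rw [rotLap_eq hP]
    simp only [polyEval, map_mul, map_add, map_sub, smul_eval, eval_C, map_ofNat, sphEig] at *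
    rw [this]
    ring
  have hlow : (2 : ℝ) • sphL2 d (polyLap P) ∈ lowSpace d n := by
    refine Submodule.smul_mem _ _ ?_
    rcases lt_or_ge n 2 with hn | hn
    · rw [polyLap_eq_zero hn hP, map_zero]
      exact Submodule.zero_mem _
    · obtain ⟨n, rfl⟩ := Nat.exists_eq_add_of_le' hn
      exact ⟨_, polyLap_isHomogeneous hP, rfl⟩
  have horth : (2 : ℝ) • sphL2 d (polyLap P) ∈ (lowSpace d n)ᗮ := by
    rw [← hW]
    refine Submodule.add_mem _ ?_ (Submodule.smul_mem _ _ h.1)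
    rcases lt_or_ge n 2 with hn | hn
    · have : lowSpace d n = ⊥ := by interval_cases n <;> rfl
      rw [this, Submodule.bot_orthogonal_eq_top]
      trivial
    · obtain ⟨n, rfl⟩ := Nat.exists_eq_add_of_le' hn
      rw [Submodule.mem_orthogonal]
      rintro _ ⟨Q, hQ, rfl⟩
      rw [← inner_rotLap]
      exact (Submodule.mem_orthogonal _ _).1 h.1 _ ⟨_, rotLap_isHomogeneous hQ, rfl⟩
  have hzero : (2 : ℝ) • sphL2 d (polyLap P) = 0 :=
    inner_self_eq_zero.1 ((Submodule.mem_orthogonal _ _).1 horth _ hlow)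
  rw [hzero, ← map_smul, ← map_add, ← map_zero (sphL2 d)] at hW
  have := sphL2_eq_iff.1 hW x
  simp only [polyEval, map_add, smul_eval, map_zero] at *
  linarith

/-- For d = 0 the degrees 0 and 1 would share the eigenvalue 0; from d = 1 on, n(n + d - 1) is
strictly increasing. -/
theorem sphEig_injective (hd : 1 ≤ d) : Function.Injective (sphEig d) := by
  have hd' : (1 : ℝ) ≤ d := by exact_mod_cast hd
  refine StrictMono.injective (strictMono_nat_of_lt_succ fun n => ?_)
  have : (0 : ℝ) ≤ n := n.cast_nonneg
  simp only [sphEig]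
  push_cast
  nlinarith

/-- The index set of the spherical harmonics. -/
abbrev HarmIdx (d : ℕ) : Type := Σ n : ℕ, Fin (harmDim d n)

theorem exists_harmonic_poly (d : ℕ) (i : HarmIdx d) : ∃ P : MvPolynomial (Fin (d + 1)) ℝ,
    P.IsHomogeneous i.1 ∧ sphL2 d P = (stdOrthonormalBasis ℝ (harmSpace d i.1) i.2 : Lp ℝ 2 _) := by
  obtain ⟨P, hP, h⟩ := (stdOrthonormalBasis ℝ (harmSpace d i.1) i.2).2.2
  exact ⟨P, hP, h⟩

/-- An orthonormal basis of spherical harmonics, as homogeneous polynomials. -/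
def harmPoly (i : HarmIdx d) : MvPolynomial (Fin (d + 1)) ℝ := (exists_harmonic_poly d i).choose

theorem harmPoly_isHomogeneous (i : HarmIdx d) : (harmPoly i).IsHomogeneous i.1 :=
  (exists_harmonic_poly d i).choose_spec.1

theorem sphL2_harmPoly (i : HarmIdx d) :
    sphL2 d (harmPoly i) = (stdOrthonormalBasis ℝ (harmSpace d i.1) i.2 : Lp ℝ 2 _) :=
  (exists_harmonic_poly d i).choose_spec.2

theorem sphL2_harmPoly_mem (i : HarmIdx d) : sphL2 d (harmPoly i) ∈ harmSpace d i.1 := by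
  rw [sphL2_harmPoly]; exact Subtype.property _

theorem rotLap_harmPoly (i : HarmIdx d) (x : Sph d) :
    polyEval (rotLap (harmPoly i)) (x : Euc d) =
      -(2 * sphEig d i.1) * polyEval (harmPoly i) (x : Euc d) :=
  rotLap_of_mem_harmSpace (harmPoly_isHomogeneous i) (sphL2_harmPoly_mem i) x

/-- Within one degree the basis was chosen orthonormal; different degrees have different eigenvalues
of a symmetric operator. -/
theorem inner_harmPoly (hd : 1 ≤ d) (i i' : HarmIdx d) :
    inner ℝ (sphL2 d (harmPoly i)) (sphL2 d (harmPoly i')) = if i = i' then (1 : ℝ) else 0 := by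
  have hL : ∀ i : HarmIdx d,
      sphL2 d (rotLap (harmPoly i)) = (-(2 * sphEig d i.1)) • sphL2 d (harmPoly i) := fun i => by
    rw [← map_smul]
    exact sphL2_eq_iff.2 fun x => by rw [rotLap_harmPoly]; simp [polyEval, smul_eval]
  obtain ⟨n, a⟩ := i
  obtain ⟨n', a'⟩ := i'
  by_cases hn : n = n'
  · subst hn
    rw [sphL2_harmPoly, sphL2_harmPoly, ← Submodule.coe_inner,
      orthonormal_iff_ite.1 (stdOrthonormalBasis ℝ (harmSpace d n)).orthonormal a a']
    by_cases ha : a = a'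
    · subst ha
      exact (if_pos rfl).trans (if_pos rfl).symm
    · exact (if_neg ha).trans (if_neg fun h => ha (by cases h; rfl)).symm
  · have h := inner_rotLap (harmPoly ⟨n, a⟩) (harmPoly ⟨n', a'⟩)
    rw [hL, hL, inner_smul_left, inner_smul_right, RCLike.conj_to_real] at h
    have hne : sphEig d n ≠ sphEig d n' := fun h => hn (sphEig_injective hd h)
    rw [if_neg (fun h => hn (congr_arg Sigma.fst h))]
    have h2 : (sphEig d n - sphEig d n') *
        inner ℝ (sphL2 d (harmPoly ⟨n, a⟩)) (sphL2 d (harmPoly ⟨n', a'⟩)) = 0 := by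
      linear_combination (-1 / 2 : ℝ) * h
    exact (mul_eq_zero.1 h2).resolve_left (sub_ne_zero.2 hne)

theorem integral_harmPoly (hd : 1 ≤ d) (i i' : HarmIdx d) :
    ∫ x : Sph d, polyEval (harmPoly i) (x : Euc d) * polyEval (harmPoly i') (x : Euc d)
      ∂sphMeasure d = if i = i' then 1 else 0 := by
  rw [← inner_sphL2, inner_harmPoly hd]

theorem harmSpace_le_span (d n : ℕ) :
    harmSpace d n ≤ Submodule.span ℝ (range fun i : HarmIdx d => sphL2 d (harmPoly i)) := by
  intro f hf
  have h := (stdOrthonormalBasis ℝ (harmSpace d n)).toBasis.sum_repr ⟨f, hf⟩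
  have h' := congr_arg Subtype.val h
  simp only [Submodule.coe_sum, Submodule.coe_smul, OrthonormalBasis.coe_toBasis] at h'
  rw [← h']
  exact Submodule.sum_mem _ fun a _ => Submodule.smul_mem _ _
    (Submodule.subset_span ⟨⟨n, a⟩, sphL2_harmPoly ⟨n, a⟩⟩)

/-- Strong induction on the degree: degree n splits orthogonally into degree n - 2 and harmonics. -/
theorem homSpace_le_span (d n : ℕ) :
    homSpace d n ≤ Submodule.span ℝ (range fun i : HarmIdx d => sphL2 d (harmPoly i)) := by
  induction n using Nat.strong_induction_on with
  | _ n ih =>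
    have : FiniteDimensional ℝ (lowSpace d n) :=
      Submodule.finiteDimensional_of_le (lowSpace_le d n)
    rw [← Submodule.sup_orthogonal_inf_of_hasOrthogonalProjection (lowSpace_le d n)]
    refine sup_le ?_ (harmSpace_le_span d n)
    match n, ih with
    | 0, _ => exact bot_le
    | 1, _ => exact bot_le
    | n + 2, ih => exact ih n (by omega)

theorem sphL2_mem_span (P : MvPolynomial (Fin (d + 1)) ℝ) :
    sphL2 d P ∈ Submodule.span ℝ (range fun i : HarmIdx d => sphL2 d (harmPoly i)) := by
  rw [← sum_homogeneousComponent P, map_sum]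
  exact Submodule.sum_mem _ fun n _ =>
    homSpace_le_span d n ⟨_, homogeneousComponent_isHomogeneous n P, rfl⟩

/-- An identity in L² between continuous functions on the sphere holds pointwise, so the expansion
in harmonics is an identity of functions. -/
theorem polyEval_mem_span (P : MvPolynomial (Fin (d + 1)) ℝ) :
    (fun x : Sph d => polyEval P (x : Euc d)) ∈
      Submodule.span ℝ (range fun (i : HarmIdx d) (x : Sph d) =>
        polyEval (harmPoly i) (x : Euc d)) := by
  obtain ⟨c, hc⟩ := (Finsupp.mem_span_range_iff_exists_finsupp).1 (sphL2_mem_span P)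
  have hc' : sphL2 d (c.sum fun i a => a • harmPoly i) = sphL2 d P := by
    rw [← hc, map_finsuppSum]
    simp only [map_smul]
  rw [Finsupp.mem_span_range_iff_exists_finsupp]
  refine ⟨c, funext fun x => ?_⟩
  rw [← sphL2_eq_iff.1 hc' x]
  simp [Finsupp.sum, polyEval, smul_eval]

end Harmonics

/-! ### Calculus on the product of spheres -/

section Calculus

variable {j k : ℕ}

/-- Continuity of scalar multiplication, with the instance arguments that occur in `HasDerivAt`. -/
def HasContinuousSMul (F : Type*) [AddCommGroup F] [Module ℝ F] [TopologicalSpace F] : Prop :=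
  ContinuousSMul ℝ F

theorem hasContinuousSMul_of_normed {F : Type*} [NormedAddCommGroup F] [NormedSpace ℝ F] :
    HasContinuousSMul F :=
  inferInstanceAs (ContinuousSMul ℝ F)

theorem hasContinuousSMul_amb (j k : ℕ) : HasContinuousSMul (Amb j k) :=
  hasContinuousSMul_of_normed

theorem HasContinuousSMul.continuousSMul {F : Type*} [AddCommGroup F] [Module ℝ F]
    [TopologicalSpace F] (h : HasContinuousSMul F) : ContinuousSMul ℝ F := h

/-- A shortcut, as instance search has difficulties to find this instance. -/
instance continuousSMul_amb (j k : ℕ) :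
    type_of% (hasContinuousSMul_amb j k).continuousSMul :=
  (hasContinuousSMul_amb j k).continuousSMul

/-- The continuous linear isomorphism `ℝ^(j+1) × ℝ^(k+1) → ℝ^(j+k+2)`. -/
def toAmb (j k : ℕ) : (Euc j × Euc k) ≃L[ℝ] Amb j k :=
  (WithLp.prodContinuousLinearEquiv 2 ℝ (Euc j) (Euc k)).symm

/-- The projections of the ambient space. -/
def ambFst (j k : ℕ) : Amb j k →L[ℝ] Euc j := WithLp.fstL 2 ℝ (Euc j) (Euc k)

/-- The projections of the ambient space. -/
def ambSnd (j k : ℕ) : Amb j k →L[ℝ] Euc k := WithLp.sndL 2 ℝ (Euc j) (Euc k)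

@[simp] theorem ambFst_apply (z : Amb j k) : ambFst j k z = z.fst := rfl

@[simp] theorem ambSnd_apply (z : Amb j k) : ambSnd j k z = z.snd := rfl

theorem isOpen_offAxes (j k : ℕ) : IsOpen (offAxes j k) :=
  (isOpen_ne.preimage (ambFst j k).continuous).inter (isOpen_ne.preimage (ambSnd j k).continuous)

theorem sph_ne_zero {d : ℕ} (x : Sph d) : (x : Euc d) ≠ 0 := by
  intro h
  have := norm_eq_of_mem_sphere x
  rw [h, norm_zero] at this
  exact zero_ne_one this

theorem pt_mem_offAxes (x : Prd j k) : pt x ∈ offAxes j k := ⟨sph_ne_zero x.1, sph_ne_zero x.2⟩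

theorem continuous_pt : Continuous (pt : Prd j k → Amb j k) :=
  (toAmb j k).continuous.comp
    ((continuous_subtype_val.comp continuous_fst).prodMk (continuous_subtype_val.comp continuous_snd))

theorem radial_coe {d : ℕ} (x : Sph d) (h : (x : Euc d) ≠ 0) : radial (x : Euc d) h = x := by
  ext1; simp [radial]

theorem radialExt_pt {F : Type*} [Zero F] (y : Prd j k → F) (x : Prd j k) :
    radialExt y (pt x) = y x := by
  refine (dif_pos (pt_mem_offAxes x)).trans ?_
  simp [pt, radial_coe]

theorem radialExt_of_mem {F : Type*} [Zero F] (y : Prd j k → F) {z : Amb j k}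
    (hz : z ∈ offAxes j k) : radialExt y z = y (radial z.fst hz.1, radial z.snd hz.2) :=
  dif_pos hz

/-- The retraction of `offAxes j k` onto `M`, as a map of the ambient space. -/
def retr (z : Amb j k) : Amb j k := WithLp.toLp 2 (‖z.fst‖⁻¹ • z.fst, ‖z.snd‖⁻¹ • z.snd)

theorem pt_radial {z : Amb j k} (hz : z ∈ offAxes j k) :
    pt (radial z.fst hz.1, radial z.snd hz.2) = retr z := rfl

theorem retr_pt (x : Prd j k) : retr (pt x) = pt x := by simp [retr, pt]

theorem contDiffOn_retr {n : WithTop ℕ∞} : ContDiffOn ℝ n (retr : Amb j k → Amb j k) (offAxes j k) := by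
  have h1 : ContDiffOn ℝ n (fun z : Amb j k => z.fst) (offAxes j k) := (ambFst j k).contDiff.contDiffOn
  have h2 : ContDiffOn ℝ n (fun z : Amb j k => z.snd) (offAxes j k) := (ambSnd j k).contDiff.contDiffOn
  exact (toAmb j k).contDiff.comp_contDiffOn
    ((((h1.norm ℝ fun z hz => hz.1).inv fun z hz => norm_ne_zero_iff.2 hz.1).smul h1).prodMk
      (((h2.norm ℝ fun z hz => hz.2).inv fun z hz => norm_ne_zero_iff.2 hz.2).smul h2))

/-- The norm is differentiated as the square root of the smooth function ‖a‖². The result is the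
orthogonal projection onto the complement of p. -/
theorem hasFDerivAt_normalize {V : Type*} [NormedAddCommGroup V] [InnerProductSpace ℝ V] {p : V}
    (hp : ‖p‖ = 1) : HasFDerivAt (fun a : V => ‖a‖⁻¹ • a)
      (ContinuousLinearMap.id ℝ V - (innerSL ℝ p).smulRight p) p := by
  have h1 : HasFDerivAt (fun a : V => ‖a‖ ^ 2) (2 • (innerSL ℝ p)) p :=
    (hasStrictFDerivAt_norm_sq p).hasFDerivAt
  have h2 := (hasDerivAt_inv (by simp [hp] : √(‖p‖ ^ 2) ≠ 0)).comp_hasFDerivAt p (h1.sqrt (by simp [hp]))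
  have h3 := h2.smul (hasFDerivAt_id p)
  have e : (fun a : V => ‖a‖⁻¹ • a) = fun a : V => (√(‖a‖ ^ 2))⁻¹ • id a := by
    ext a; simp [Real.sqrt_sq (norm_nonneg a)]
  rw [e]
  refine h3.congr_fderiv ?_
  ext v
  simp [hp]
  module

theorem continuous_toDual_symm_fderiv {V X : Type*} [NormedAddCommGroup V]
    [InnerProductSpace ℝ V] [CompleteSpace V] [TopologicalSpace X] {φ : V → ℝ} {O : Set V}
    (hO : IsOpen O) (hφ : ContDiffOn ℝ 1 φ O) {c : X → V} (hc : Continuous c) (h : ∀ x, c x ∈ O) :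
    Continuous fun x => (InnerProductSpace.toDual ℝ V).symm (fderiv ℝ φ (c x)) :=
  (InnerProductSpace.toDual ℝ V).symm.continuous.comp
    ((hφ.continuousOn_fderiv_of_isOpen hO le_rfl).comp_continuous hc h)

/-- Used with the two coordinate projections, which intertwine `retr` with normalization of a single
vector; the differential of `retr` is thus found one factor at a time. -/
theorem clm_fderiv_of_semiconj {V W : Type*} [NormedAddCommGroup V] [NormedSpace ℝ V]
    [NormedAddCommGroup W] [NormedSpace ℝ W] {ρ : V → V} {z : V} (hρ : DifferentiableAt ℝ ρ z)
    (π : V →L[ℝ] W) {g : W → W} {g' : W →L[ℝ] W} (hg : HasFDerivAt g g' (π z))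
    (h : ∀ y, π (ρ y) = g (π y)) (v : V) : π (fderiv ℝ ρ z v) = g' (π v) := by
  have h1 := π.hasFDerivAt.comp z hρ.hasFDerivAt
  have h2 := hg.comp z π.hasFDerivAt
  have e : (π ∘ ρ) = g ∘ π := funext h
  rw [e] at h1
  exact DFunLike.congr_fun (h1.unique h2) v

theorem fderiv_comp_of_fixed {V : Type*} [NormedAddCommGroup V] [NormedSpace ℝ V]
    {Φ : V → ℝ} {ρ : V → V} {z v : V} (hz : ρ z = z) (hΦ : DifferentiableAt ℝ Φ z)
    (hρ : DifferentiableAt ℝ ρ z) (hv : fderiv ℝ ρ z v = v) :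
    fderiv ℝ (Φ ∘ ρ) z v = fderiv ℝ Φ z v := by
  rw [fderiv_comp z (by rwa [hz]) hρ, ContinuousLinearMap.comp_apply, hv, hz]

/-- The differential of the retraction at `p` is the orthogonal projection to the tangent space. -/
theorem differentiableAt_retr (x : Prd j k) :
    DifferentiableAt ℝ (retr : Amb j k → Amb j k) (pt x) :=
  ((contDiffOn_retr (n := 1)).differentiableOn one_ne_zero).differentiableAt
    ((isOpen_offAxes j k).mem_nhds (pt_mem_offAxes x))

theorem fderiv_retr_apply (x : Prd j k) {v : Amb j k} (hv : v ∈ tangent x) :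
    fderiv ℝ (retr : Amb j k → Amb j k) (pt x) v = v := by
  obtain ⟨hv1, hv2⟩ := hv
  have h1 := clm_fderiv_of_semiconj (differentiableAt_retr x) (ambFst j k)
    (hasFDerivAt_normalize (norm_eq_of_mem_sphere x.1)) (fun y => rfl) v
  have h2 := clm_fderiv_of_semiconj (differentiableAt_retr x) (ambSnd j k)
    (hasFDerivAt_normalize (norm_eq_of_mem_sphere x.2)) (fun y => rfl) v
  simp only [ambFst_apply, ambSnd_apply] at h1 h2
  apply (WithLp.prodContinuousLinearEquiv 2 ℝ (Euc j) (Euc k)).injective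
  ext1
  · exact h1.trans (by simp [pt, hv1])
  · exact h2.trans (by simp [pt, hv2])

/-- Functions of class `C¹` on `M`. -/
def IsC1 (f : Prd j k → ℝ) : Prop := ContDiffOn ℝ 1 (radialExt f) (offAxes j k)

theorem IsC2Holder.isC1 {α : ℝ≥0} {f : Prd j k → ℝ} (h : IsC2Holder α f) : IsC1 f :=
  h.1.of_le (by norm_num)

theorem IsC1.continuous {f : Prd j k → ℝ} (h : IsC1 f) : Continuous f := by
  have : f = radialExt f ∘ pt := funext fun x => (radialExt_pt f x).symm
  rw [this]
  exact ContinuousOn.comp_continuous (ContDiffOn.continuousOn h) continuous_pt pt_mem_offAxes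

theorem IsC1.differentiableAt {f : Prd j k → ℝ} (h : IsC1 f) (x : Prd j k) :
    DifferentiableAt ℝ (radialExt f) (pt x) :=
  (ContDiffOn.differentiableOn h one_ne_zero).differentiableAt
    ((isOpen_offAxes j k).mem_nhds (pt_mem_offAxes x))

theorem IsC1.add {f g : Prd j k → ℝ} (hf : IsC1 f) (hg : IsC1 g) : IsC1 (f + g) :=
  (ContDiffOn.add hf hg).congr fun z hz => by simp [radialExt_of_mem _ hz]

theorem IsC1.mul {f g : Prd j k → ℝ} (hf : IsC1 f) (hg : IsC1 g) : IsC1 (f * g) :=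
  (ContDiffOn.mul hf hg).congr fun z hz => by simp [radialExt_of_mem _ hz]

theorem IsC1.smul {f : Prd j k → ℝ} (c : ℝ) (hf : IsC1 f) : IsC1 (c • f) :=
  (ContDiffOn.const_smul c hf).congr fun z hz => by simp [radialExt_of_mem _ hz]

/-- One derivative to spare makes the second derivative locally Lipschitz, and on a bounded set
Lipschitz implies Hölder of any smaller exponent. -/
theorem isC2Holder_of_contDiff {α : ℝ≥0} (hα : α < 1) {Φ : Amb j k → ℝ} (hΦ : ContDiff ℝ 3 Φ) :
    IsC2Holder α fun x => Φ (pt x) := by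
  have hcongr : ∀ z ∈ offAxes j k, radialExt (fun x : Prd j k => Φ (pt x)) z = Φ (retr z) :=
    fun z hz => by rw [radialExt_of_mem _ hz, pt_radial hz]
  have h3 : ContDiffOn ℝ 3 (radialExt fun x : Prd j k => Φ (pt x)) (offAxes j k) :=
    (hΦ.comp_contDiffOn contDiffOn_retr).congr hcongr
  refine ⟨h3.of_le (by norm_num), fun z hz => ?_⟩
  have hat : ContDiffAt ℝ 3 (radialExt fun x : Prd j k => Φ (pt x)) z :=
    h3.contDiffAt ((isOpen_offAxes j k).mem_nhds hz)
  have hit : ContDiffAt ℝ 1 (iteratedFDeriv ℝ 2 (radialExt fun x : Prd j k => Φ (pt x))) z :=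
    hat.iteratedFDeriv_right (by norm_num)
  obtain ⟨K, t, ht, hK⟩ := hit.exists_lipschitzOnWith
  -- The passage to a smaller exponent needs a bound for distances; in a ball of radius 1 it is 2.
  refine ⟨t ∩ Metric.ball z 1, Filter.inter_mem ht (Metric.ball_mem_nhds z one_pos), _,
    HolderOnWith.of_le (D := 2) (fun x hx y hy => ?_)
      ((holderOnWith_one.2 hK).mono inter_subset_left) hα.le⟩
  rw [edist_dist]
  have h1 := Metric.mem_ball.1 hx.2
  have h2 := Metric.mem_ball'.1 hy.2
  have h3 := dist_triangle x z y
  exact ENNReal.ofReal_le_of_le_toReal (by simp; linarith)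

/-- The gradient of a function on `M`, as a vector of the ambient space. -/
def grad (f : Prd j k → ℝ) (x : Prd j k) : Amb j k :=
  (InnerProductSpace.toDual ℝ (Amb j k)).symm (fderiv ℝ (radialExt f) (pt x))

theorem inner_grad (f : Prd j k → ℝ) (x : Prd j k) (v : Amb j k) :
    inner ℝ (grad f x) v = fderiv ℝ (radialExt f) (pt x) v :=
  InnerProductSpace.toDual_symm_apply

theorem IsC1.continuous_grad {f : Prd j k → ℝ} (h : IsC1 f) : Continuous (grad f) :=
  continuous_toDual_symm_fderiv (isOpen_offAxes j k) h continuous_pt pt_mem_offAxes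

theorem hasDerivAt_line {V : Type*} [NormedAddCommGroup V] [NormedSpace ℝ V]
    {φ : V → ℝ} {z : V} (hφ : DifferentiableAt ℝ φ z) (v : V) :
    HasDerivAt (fun t : ℝ => φ (z + t • v)) (fderiv ℝ φ z v) 0 := by
  have h1 : HasDerivAt (fun t : ℝ => z + t • v) v 0 := by
    simpa using ((hasDerivAt_id (0 : ℝ)).smul_const v).const_add z
  exact HasFDerivAt.comp_hasDerivAt (f := fun t : ℝ => z + t • v) 0
    (by simpa using hφ.hasFDerivAt) h1

theorem fderiv_eq_zero_of_eventually_const {V : Type*} [NormedAddCommGroup V] [NormedSpace ℝ V]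
    {φ : V → ℝ} {z v : V} {c : ℝ} (hφ : DifferentiableAt ℝ φ z)
    (hv : ∀ᶠ t : ℝ in nhds 0, φ (z + t • v) = c) : fderiv ℝ φ z v = 0 :=
  ((hasDerivAt_line hφ v).congr_of_eventuallyEq (hv.mono fun _ ht => ht.symm)).unique
    (hasDerivAt_const _ _)

/-- The radial extension is constant along the rays in each factor, so its gradient is orthogonal to
(p, 0) and to (0, q). -/
theorem grad_mem_tangent {f : Prd j k → ℝ} (h : IsC1 f) (x : Prd j k) : grad f x ∈ tangent x := by
  have key : ∀ v : Amb j k, (∀ᶠ t : ℝ in nhds 0, radialExt f (pt x + t • v) = f x) →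
      inner ℝ (grad f x) v = 0 := fun v hv => by
    rw [inner_grad]
    exact fderiv_eq_zero_of_eventually_const (h.differentiableAt x) hv
  have hpos : ∀ᶠ t : ℝ in nhds 0, 0 < 1 + t :=
    (continuous_const.add continuous_id).continuousAt.eventually_const_lt (by norm_num)
  have hrad : ∀ {d : ℕ} (p : Sph d) (t : ℝ), 0 < 1 + t → ∀ h : (1 + t) • (p : Euc d) ≠ 0,
      radial ((1 + t) • (p : Euc d)) h = p := fun p t ht h => by
    ext1
    simp [radial, norm_smul, abs_of_pos ht, smul_smul, inv_mul_cancel₀ ht.ne']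
  constructor
  · have := key (WithLp.toLp 2 ((x.1 : Euc j), 0)) (hpos.mono fun t ht => ?_)
    · simpa [WithLp.prod_inner_apply, real_inner_comm] using this
    · have e : pt x + t • (WithLp.toLp 2 ((x.1 : Euc j), 0) : Amb j k) =
          WithLp.toLp 2 ((1 + t) • (x.1 : Euc j), (x.2 : Euc k)) := by
        rw [pt, ← WithLp.toLp_smul, ← WithLp.toLp_add]
        simp [add_smul]
      have hm : (WithLp.toLp 2 ((1 + t) • (x.1 : Euc j), (x.2 : Euc k)) : Amb j k) ∈ offAxes j k :=
        ⟨smul_ne_zero ht.ne' (sph_ne_zero _), sph_ne_zero _⟩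
      rw [e, radialExt_of_mem _ hm]
      simp only [WithLp.toLp_fst, WithLp.toLp_snd, hrad _ _ ht, radial_coe]
  · have := key (WithLp.toLp 2 (0, (x.2 : Euc k))) (hpos.mono fun t ht => ?_)
    · simpa [WithLp.prod_inner_apply, real_inner_comm] using this
    · have e : pt x + t • (WithLp.toLp 2 (0, (x.2 : Euc k)) : Amb j k) =
          WithLp.toLp 2 ((x.1 : Euc j), (1 + t) • (x.2 : Euc k)) := by
        rw [pt, ← WithLp.toLp_smul, ← WithLp.toLp_add]
        simp [add_smul]
      have hm : (WithLp.toLp 2 ((x.1 : Euc j), (1 + t) • (x.2 : Euc k)) : Amb j k) ∈ offAxes j k :=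
        ⟨sph_ne_zero _, smul_ne_zero ht.ne' (sph_ne_zero _)⟩
      rw [e, radialExt_of_mem _ hm]
      simp only [WithLp.toLp_fst, WithLp.toLp_snd, hrad _ _ ht, radial_coe]

theorem grad_congr_op {f g h : Prd j k → ℝ} (hh : ∀ z ∈ offAxes j k, radialExt h z = radialExt f z + radialExt g z)
    (hf : IsC1 f) (hg : IsC1 g) (x : Prd j k) : grad h x = grad f x + grad g x := by
  have hev : radialExt h =ᶠ[nhds (pt x)] radialExt f + radialExt g :=
    Filter.eventually_of_mem ((isOpen_offAxes j k).mem_nhds (pt_mem_offAxes x)) hh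
  rw [grad, hev.fderiv_eq, fderiv_add (hf.differentiableAt x) (hg.differentiableAt x), map_add]
  rfl

theorem grad_add {f g : Prd j k → ℝ} (hf : IsC1 f) (hg : IsC1 g) (x : Prd j k) :
    grad (f + g) x = grad f x + grad g x :=
  grad_congr_op (fun z hz => by simp [radialExt_of_mem _ hz]) hf hg x

theorem grad_mul {f g : Prd j k → ℝ} (hf : IsC1 f) (hg : IsC1 g) (x : Prd j k) :
    grad (f * g) x = f x • grad g x + g x • grad f x := by
  have hev : radialExt (f * g) =ᶠ[nhds (pt x)] radialExt f * radialExt g :=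
    Filter.eventually_of_mem ((isOpen_offAxes j k).mem_nhds (pt_mem_offAxes x))
      fun z hz => by simp [radialExt_of_mem _ hz]
  rw [grad, hev.fderiv_eq, fderiv_mul (hf.differentiableAt x) (hg.differentiableAt x), map_add]
  simp [radialExt_pt, grad]

theorem grad_smul {f : Prd j k → ℝ} (c : ℝ) (hf : IsC1 f) (x : Prd j k) :
    grad (c • f) x = c • grad f x := by
  have hev : radialExt (c • f) =ᶠ[nhds (pt x)] c • radialExt f :=
    Filter.eventually_of_mem ((isOpen_offAxes j k).mem_nhds (pt_mem_offAxes x))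
      fun z hz => by simp [radialExt_of_mem _ hz]
  rw [grad, hev.fderiv_eq, fderiv_const_smul (hf.differentiableAt x)]
  simp [grad]

/-- The radial extension of the restriction of Φ is Φ ∘ `retr`, and the differential of `retr` fixes
tangent vectors. -/
theorem inner_grad_comp_pt {Φ : Amb j k → ℝ} {x : Prd j k} (hΦ : DifferentiableAt ℝ Φ (pt x))
    {v : Amb j k} (hv : v ∈ tangent x) :
    inner ℝ (grad (fun x => Φ (pt x)) x) v = fderiv ℝ Φ (pt x) v := by
  have hev : radialExt (fun x => Φ (pt x)) =ᶠ[nhds (pt x)] Φ ∘ retr :=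
    Filter.eventually_of_mem ((isOpen_offAxes j k).mem_nhds (pt_mem_offAxes x))
      fun z hz => by rw [radialExt_of_mem _ hz, pt_radial hz]; rfl
  rw [inner_grad, hev.fderiv_eq]
  exact fderiv_comp_of_fixed (retr_pt x) hΦ (differentiableAt_retr x)
    (fderiv_retr_apply x hv)

end Calculus

/-! ### Green's formula on the product of spheres -/

section Green

variable {j k : ℕ}

instance : IsFiniteMeasure (prdMeasure j k) :=
  inferInstanceAs (IsFiniteMeasure ((sphMeasure j).prod (sphMeasure k)))

instance : (prdMeasure j k).IsOpenPosMeasure :=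
  inferInstanceAs ((sphMeasure j).prod (sphMeasure k)).IsOpenPosMeasure

/-- The product of two polynomials in the two groups of variables, as a function on `M`. -/
def prodPoly (P : MvPolynomial (Fin (j + 1)) ℝ) (Q : MvPolynomial (Fin (k + 1)) ℝ)
    (x : Prd j k) : ℝ := polyEval P (x.1 : Euc j) * polyEval Q (x.2 : Euc k)

/-- The product of two polynomials in the two groups of variables, on the ambient space. -/
def ambPoly (P : MvPolynomial (Fin (j + 1)) ℝ) (Q : MvPolynomial (Fin (k + 1)) ℝ)
    (z : Amb j k) : ℝ := polyEval P (ambFst j k z) * polyEval Q (ambSnd j k z)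

theorem prodPoly_eq (P : MvPolynomial (Fin (j + 1)) ℝ) (Q : MvPolynomial (Fin (k + 1)) ℝ) :
    prodPoly P Q = fun x => ambPoly P Q (pt x) := rfl

theorem contDiff_ambPoly (P : MvPolynomial (Fin (j + 1)) ℝ) (Q : MvPolynomial (Fin (k + 1)) ℝ)
    {n : WithTop ℕ∞} : ContDiff ℝ n (ambPoly P Q) :=
  ((contDiff_polyEval P).comp (ambFst j k).contDiff).mul
    ((contDiff_polyEval Q).comp (ambSnd j k).contDiff)

theorem prodPoly_isC2Holder {α : ℝ≥0} (hα : α < 1) (P : MvPolynomial (Fin (j + 1)) ℝ)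
    (Q : MvPolynomial (Fin (k + 1)) ℝ) : IsC2Holder α (prodPoly P Q) :=
  isC2Holder_of_contDiff hα (contDiff_ambPoly P Q)

theorem prodPoly_isC1 (P : MvPolynomial (Fin (j + 1)) ℝ) (Q : MvPolynomial (Fin (k + 1)) ℝ) :
    IsC1 (prodPoly P Q) :=
  (prodPoly_isC2Holder zero_lt_one P Q).isC1

theorem hasDerivAt_comp_curve {V : Type*} [NormedAddCommGroup V] [NormedSpace ℝ V]
    {φ : V → ℝ} {γ : ℝ → V} {τ : ℝ} {v : V} (hφ : DifferentiableAt ℝ φ (γ τ))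
    (hγ : HasDerivAt γ v τ) : HasDerivAt (fun t => φ (γ t)) (fderiv ℝ φ (γ τ) v) τ :=
  hφ.hasFDerivAt.comp_hasDerivAt τ hγ

theorem fderiv_mul_comp_apply {V E F : Type*} [NormedAddCommGroup V] [NormedSpace ℝ V]
    [NormedAddCommGroup E] [NormedSpace ℝ E] [NormedAddCommGroup F] [NormedSpace ℝ F]
    (π : V →L[ℝ] E) (ρ : V →L[ℝ] F) {z : V} {φ : E → ℝ} {ψ : F → ℝ} {φ' : E →L[ℝ] ℝ}
    {ψ' : F →L[ℝ] ℝ} (hφ : HasFDerivAt φ φ' (π z)) (hψ : HasFDerivAt ψ ψ' (ρ z)) (v : V) :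
    fderiv ℝ (fun z => φ (π z) * ψ (ρ z)) z v = φ (π z) * ψ' (ρ v) + ψ (ρ z) * φ' (π v) := by
  have h : HasFDerivAt (fun z => φ (π z) * ψ (ρ z)) _ z :=
    (hφ.comp z π.hasFDerivAt).mul (hψ.comp z ρ.hasFDerivAt)
  rw [h.fderiv]
  simp

theorem hasDerivAt_toLp {V W : Type*} [NormedAddCommGroup V] [NormedSpace ℝ V]
    [NormedAddCommGroup W] [NormedSpace ℝ W] {γ : ℝ → V} {δ : ℝ → W} {τ : ℝ} {v : V} {w : W}
    (hγ : HasDerivAt γ v τ) (hδ : HasDerivAt δ w τ) :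
    HasDerivAt (fun t => (WithLp.toLp 2 (γ t, δ t) : WithLp 2 (V × W))) (WithLp.toLp 2 (v, w)) τ :=
  (WithLp.prodContinuousLinearEquiv 2 ℝ V W).symm.hasFDerivAt.comp_hasDerivAt τ (hγ.prodMk hδ)

theorem IsC1.hasDerivAt_curve {F : Prd j k → ℝ} (hF : IsC1 F) {γ : ℝ → Prd j k} {τ : ℝ}
    {v : Amb j k} (hγ : HasDerivAt (fun t => pt (γ t)) v τ) :
    HasDerivAt (fun t => F (γ t)) (inner ℝ (grad F (γ τ)) v) τ := by
  have h := hasDerivAt_comp_curve (hF.differentiableAt (γ τ)) hγ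
  rw [← inner_grad] at h
  simpa only [radialExt_pt] using h

/-- The rotation fields form a tight frame of the tangent space at p. Both cross terms of the
expansion contain ⟨p, v⟩, so only v has to be tangent; the factor 2 counts each coordinate plane in
both orders. -/
theorem sum_inner_planeSkew {d : ℕ} (p : Sph d) {v w : Euc d} (hv : inner ℝ (p : Euc d) v = 0) :
    ∑ a, ∑ b, inner ℝ v (planeSkew (stdVec a) (stdVec b) (p : Euc d)) *
      inner ℝ w (planeSkew (stdVec a) (stdVec b) (p : Euc d)) = 2 * inner ℝ v w := by
  have hp : ∑ a, (p : Euc d).ofLp a * (p : Euc d).ofLp a = 1 := by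
    have := EuclideanSpace.norm_sq_eq (p : Euc d)
    simp only [norm_eq_of_mem_sphere, Real.norm_eq_abs, pow_two] at this
    simpa using this.symm
  have hv' : ∑ a, (p : Euc d).ofLp a * v.ofLp a = 0 := by
    simpa [PiLp.inner_apply, mul_comm] using hv
  have hvw : inner ℝ v w = ∑ a, v.ofLp a * w.ofLp a := by
    simp [PiLp.inner_apply, mul_comm]
  have hin : ∀ (u : Euc d) (a b : Fin (d + 1)),
      inner ℝ u (planeSkew (stdVec a) (stdVec b) (p : Euc d)) =
        (p : Euc d).ofLp a * u.ofLp b - (p : Euc d).ofLp b * u.ofLp a := fun u a b => by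
    simp [planeSkew_stdVec, inner_sub_right, inner_smul_right, EuclideanSpace.inner_single_right]
  have hpt : ∀ a b : Fin (d + 1), inner ℝ v (planeSkew (stdVec a) (stdVec b) (p : Euc d)) *
      inner ℝ w (planeSkew (stdVec a) (stdVec b) (p : Euc d)) =
      ((p : Euc d).ofLp a * (p : Euc d).ofLp a) * (v.ofLp b * w.ofLp b)
      - ((p : Euc d).ofLp a * w.ofLp a) * ((p : Euc d).ofLp b * v.ofLp b)
      - ((p : Euc d).ofLp a * v.ofLp a) * ((p : Euc d).ofLp b * w.ofLp b)
      + (v.ofLp a * w.ofLp a) * ((p : Euc d).ofLp b * (p : Euc d).ofLp b) := fun a b => by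
    rw [hin, hin]; ring
  simp only [hpt, Finset.sum_add_distrib, Finset.sum_sub_distrib, ← Finset.sum_mul_sum, hp, hv',
    hvw]
  ring

/-- An infinitesimal rotation of the first factor. -/
def rotFst (a b : Fin (j + 1)) (x : Prd j k) : Amb j k :=
  WithLp.toLp 2 (planeSkew (stdVec a) (stdVec b) (x.1 : Euc j), 0)

theorem rotFst_mem_tangent (a b : Fin (j + 1)) (x : Prd j k) : rotFst a b x ∈ tangent x :=
  ⟨inner_planeSkew_self _ _ _, inner_zero_right _⟩

theorem continuous_rotFst (a b : Fin (j + 1)) :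
    Continuous (rotFst a b : Prd j k → Amb j k) :=
  (toAmb j k).continuous.comp (by fun_prop)

theorem inner_rotFst (a b : Fin (j + 1)) (x : Prd j k) (v : Amb j k) :
    inner ℝ v (rotFst a b x) =
      inner ℝ v.fst (planeSkew (stdVec a) (stdVec b) (x.1 : Euc j)) := by
  simp [rotFst, WithLp.prod_inner_apply]

theorem hasDerivAt_pt_rotFst {a b : Fin (j + 1)} (h : a ≠ b) (τ : ℝ) (x : Prd j k) :
    HasDerivAt (fun τ => pt ((sphereMap (coordRot h τ) x.1, x.2) : Prd j k))
      (rotFst a b (sphereMap (coordRot h τ) x.1, x.2)) τ :=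
  hasDerivAt_toLp (hasDerivAt_coordRot h τ (x.1 : Euc j)) (hasDerivAt_const τ (x.2 : Euc k))

/-- Rotations of one factor preserve the product measure: their generators are divergence free. -/
theorem integral_inner_grad_rotFst {F : Prd j k → ℝ} (hF : IsC1 F) (a b : Fin (j + 1)) :
    ∫ x, inner ℝ (grad F x) (rotFst a b x) ∂prdMeasure j k = 0 := by
  by_cases h : a = b
  · subst h
    simp only [inner_rotFst, planeSkew_apply, sub_self, inner_zero_right, integral_zero]
  refine integral_eq_zero_of_flow (prdMeasure j k) (F := F)
    (φ := fun τ x => (sphereMap (coordRot h τ) x.1, x.2))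
    (fun τ => (measurePreserving_sphereMap _).prod (MeasurePreserving.id _))
    (fun x => Prod.ext (Subtype.ext (coordRot_zero h _)) rfl) hF.continuous
    (hF.continuous_grad.inner (continuous_rotFst a b)) fun τ x => ?_
  exact hF.hasDerivAt_curve (hasDerivAt_pt_rotFst h τ x)

/-- The pointwise inner product of the first components of the gradients. -/
def dirFst (f g : Prd j k → ℝ) (x : Prd j k) : ℝ := inner ℝ (grad f x).fst (grad g x).fst

theorem continuous_dirFst {f g : Prd j k → ℝ} (hf : IsC1 f) (hg : IsC1 g) :
    Continuous (dirFst f g) :=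
  ((ambFst j k).continuous.comp hf.continuous_grad).inner
    ((ambFst j k).continuous.comp hg.continuous_grad)

theorem sum_rotFst {f : Prd j k → ℝ} (hf : IsC1 f) (g : Prd j k → ℝ) (x : Prd j k) :
    ∑ a, ∑ b, inner ℝ (grad f x) (rotFst a b x) * inner ℝ (grad g x) (rotFst a b x) =
      2 * dirFst f g x := by
  simp only [inner_rotFst]
  exact sum_inner_planeSkew x.1 (grad_mem_tangent hf x).1

/-- An infinitesimal rotation of the second factor. -/
def rotSnd (a b : Fin (k + 1)) (x : Prd j k) : Amb j k :=
  WithLp.toLp 2 (0, planeSkew (stdVec a) (stdVec b) (x.2 : Euc k))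

theorem rotSnd_mem_tangent (a b : Fin (k + 1)) (x : Prd j k) : rotSnd a b x ∈ tangent x :=
  ⟨inner_zero_right _, inner_planeSkew_self _ _ _⟩

theorem continuous_rotSnd (a b : Fin (k + 1)) :
    Continuous (rotSnd a b : Prd j k → Amb j k) :=
  (toAmb j k).continuous.comp (by fun_prop)

theorem inner_rotSnd (a b : Fin (k + 1)) (x : Prd j k) (v : Amb j k) :
    inner ℝ v (rotSnd a b x) =
      inner ℝ v.snd (planeSkew (stdVec a) (stdVec b) (x.2 : Euc k)) := by
  simp [rotSnd, WithLp.prod_inner_apply]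

theorem hasDerivAt_pt_rotSnd {a b : Fin (k + 1)} (h : a ≠ b) (τ : ℝ) (x : Prd j k) :
    HasDerivAt (fun τ => pt ((x.1, sphereMap (coordRot h τ) x.2) : Prd j k))
      (rotSnd a b (x.1, sphereMap (coordRot h τ) x.2)) τ :=
  hasDerivAt_toLp (hasDerivAt_const τ (x.1 : Euc j)) (hasDerivAt_coordRot h τ (x.2 : Euc k))

theorem integral_inner_grad_rotSnd {F : Prd j k → ℝ} (hF : IsC1 F) (a b : Fin (k + 1)) :
    ∫ x, inner ℝ (grad F x) (rotSnd a b x) ∂prdMeasure j k = 0 := by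
  by_cases h : a = b
  · subst h
    simp only [inner_rotSnd, planeSkew_apply, sub_self, inner_zero_right, integral_zero]
  refine integral_eq_zero_of_flow (prdMeasure j k) (F := F)
    (φ := fun τ x => (x.1, sphereMap (coordRot h τ) x.2))
    (fun τ => (MeasurePreserving.id _).prod (measurePreserving_sphereMap _))
    (fun x => Prod.ext rfl (Subtype.ext (coordRot_zero h _))) hF.continuous
    (hF.continuous_grad.inner (continuous_rotSnd a b)) fun τ x => ?_
  exact hF.hasDerivAt_curve (hasDerivAt_pt_rotSnd h τ x)

/-- The pointwise inner product of the second components of the gradients. -/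
def dirSnd (f g : Prd j k → ℝ) (x : Prd j k) : ℝ := inner ℝ (grad f x).snd (grad g x).snd

theorem continuous_dirSnd {f g : Prd j k → ℝ} (hf : IsC1 f) (hg : IsC1 g) :
    Continuous (dirSnd f g) :=
  ((ambSnd j k).continuous.comp hf.continuous_grad).inner
    ((ambSnd j k).continuous.comp hg.continuous_grad)

theorem sum_rotSnd {f : Prd j k → ℝ} (hf : IsC1 f) (g : Prd j k → ℝ) (x : Prd j k) :
    ∑ a, ∑ b, inner ℝ (grad f x) (rotSnd a b x) * inner ℝ (grad g x) (rotSnd a b x) =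
      2 * dirSnd f g x := by
  simp only [inner_rotSnd]
  exact sum_inner_planeSkew x.2 (grad_mem_tangent hf x).2

theorem fderiv_ambPoly (P : MvPolynomial (Fin (j + 1)) ℝ) (Q : MvPolynomial (Fin (k + 1)) ℝ)
    (z v : Amb j k) : fderiv ℝ (ambPoly P Q) z v =
      polyEval P z.fst * (∑ i, polyEval (MvPolynomial.pderiv i Q) z.snd * v.snd.ofLp i)
      + polyEval Q z.snd * (∑ i, polyEval (MvPolynomial.pderiv i P) z.fst * v.fst.ofLp i) := by
  rw [← sum_smul_proj_apply, ← sum_smul_proj_apply]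
  exact fderiv_mul_comp_apply (ambFst j k) (ambSnd j k) (hasFDerivAt_polyEval P z.fst)
    (hasFDerivAt_polyEval Q z.snd) v

theorem inner_grad_prodPoly_rotFst (P : MvPolynomial (Fin (j + 1)) ℝ)
    (Q : MvPolynomial (Fin (k + 1)) ℝ) (a b : Fin (j + 1)) (x : Prd j k) :
    inner ℝ (grad (prodPoly P Q) x) (rotFst a b x) = prodPoly (rotDer a b P) Q x := by
  rw [prodPoly_eq, inner_grad_comp_pt ((contDiff_ambPoly P Q (n := 1)).differentiable one_ne_zero _)
    (rotFst_mem_tangent a b x), fderiv_ambPoly]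
  have := sum_polyEval_pderiv_planeSkew a b P (x.1 : Euc j)
  simp only [sum_smul_proj_apply] at this
  simp [rotFst, prodPoly, this, pt]
  ring

/-- Green's formula from the frame of rotation fields: each field X contributes ∫ Xf · Xg = -∫ f ·
XXg, and `sum_rotFst` adds these up to twice the Dirichlet form. All second derivatives fall on the
polynomial, so f need only be C¹. -/
theorem integral_dirFst_prodPoly {f : Prd j k → ℝ} (hf : IsC1 f)
    (P : MvPolynomial (Fin (j + 1)) ℝ) (Q : MvPolynomial (Fin (k + 1)) ℝ) :
    2 * ∫ x, dirFst f (prodPoly P Q) x ∂prdMeasure j k =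
      -∫ x, f x * prodPoly (rotLap P) Q x ∂prdMeasure j k := by
  have hpart : ∀ a b : Fin (j + 1),
      ∫ x, inner ℝ (grad f x) (rotFst a b x) * prodPoly (rotDer a b P) Q x ∂prdMeasure j k =
      -∫ x, f x * prodPoly (rotDer a b (rotDer a b P)) Q x ∂prdMeasure j k := fun a b => by
    have hg := prodPoly_isC1 (rotDer a b P) Q
    have h := integral_inner_grad_rotFst (hf.mul hg) a b
    simp only [grad_mul hf hg, inner_add_left, inner_smul_left, RCLike.conj_to_real,
      inner_grad_prodPoly_rotFst] at h
    rw [integral_add] at h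
    · simp only [mul_comm (inner ℝ _ _)]
      linarith
    · exact integrable_of_continuous _ (hf.continuous.mul (prodPoly_isC1 _ _).continuous)
    · exact integrable_of_continuous _ (hg.continuous.mul
        (hf.continuous_grad.inner (continuous_rotFst a b)))
  rw [← integral_const_mul]
  simp only [← sum_rotFst hf, inner_grad_prodPoly_rotFst]
  have hlap : ∀ x : Prd j k, f x * prodPoly (rotLap P) Q x =
      ∑ a, ∑ b, f x * prodPoly (rotDer a b (rotDer a b P)) Q x := fun x => by
    simp [prodPoly, rotLap, polyEval, Finset.mul_sum, Finset.sum_mul]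
  simp only [hlap]
  have hc1 : ∀ a b : Fin (j + 1), Integrable (fun x : Prd j k =>
      inner ℝ (grad f x) (rotFst a b x) * prodPoly (rotDer a b P) Q x) (prdMeasure j k) := fun a b =>
    integrable_of_continuous _ ((hf.continuous_grad.inner (continuous_rotFst a b)).mul
      (prodPoly_isC1 _ _).continuous)
  have hc2 : ∀ a b : Fin (j + 1), Integrable (fun x : Prd j k =>
      f x * prodPoly (rotDer a b (rotDer a b P)) Q x) (prdMeasure j k) := fun a b =>
    integrable_of_continuous _ (hf.continuous.mul (prodPoly_isC1 _ _).continuous)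
  rw [integral_finsetSum _ fun a _ => integrable_finsetSum _ fun b _ => hc1 a b,
    integral_finsetSum _ fun a _ => integrable_finsetSum _ fun b _ => hc2 a b,
    ← Finset.sum_neg_distrib]
  refine Finset.sum_congr rfl fun a _ => ?_
  rw [integral_finsetSum _ fun b _ => hc1 a b, integral_finsetSum _ fun b _ => hc2 a b,
    ← Finset.sum_neg_distrib]
  exact Finset.sum_congr rfl fun b _ => hpart a b

theorem inner_grad_prodPoly_rotSnd (P : MvPolynomial (Fin (j + 1)) ℝ)
    (Q : MvPolynomial (Fin (k + 1)) ℝ) (a b : Fin (k + 1)) (x : Prd j k) :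
    inner ℝ (grad (prodPoly P Q) x) (rotSnd a b x) = prodPoly P (rotDer a b Q) x := by
  rw [prodPoly_eq, inner_grad_comp_pt ((contDiff_ambPoly P Q (n := 1)).differentiable one_ne_zero _)
    (rotSnd_mem_tangent a b x), fderiv_ambPoly]
  have := sum_polyEval_pderiv_planeSkew a b Q (x.2 : Euc k)
  simp only [sum_smul_proj_apply] at this
  simp [rotSnd, prodPoly, this, pt]

theorem integral_dirSnd_prodPoly {f : Prd j k → ℝ} (hf : IsC1 f)
    (P : MvPolynomial (Fin (j + 1)) ℝ) (Q : MvPolynomial (Fin (k + 1)) ℝ) :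
    2 * ∫ x, dirSnd f (prodPoly P Q) x ∂prdMeasure j k =
      -∫ x, f x * prodPoly P (rotLap Q) x ∂prdMeasure j k := by
  have hpart : ∀ a b : Fin (k + 1),
      ∫ x, inner ℝ (grad f x) (rotSnd a b x) * prodPoly P (rotDer a b Q) x ∂prdMeasure j k =
      -∫ x, f x * prodPoly P (rotDer a b (rotDer a b Q)) x ∂prdMeasure j k := fun a b => by
    have hg := prodPoly_isC1 P (rotDer a b Q)
    have h := integral_inner_grad_rotSnd (hf.mul hg) a b
    simp only [grad_mul hf hg, inner_add_left, inner_smul_left, RCLike.conj_to_real,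
      inner_grad_prodPoly_rotSnd] at h
    rw [integral_add] at h
    · simp only [mul_comm (inner ℝ _ _)]
      linarith
    · exact integrable_of_continuous _ (hf.continuous.mul (prodPoly_isC1 _ _).continuous)
    · exact integrable_of_continuous _ (hg.continuous.mul
        (hf.continuous_grad.inner (continuous_rotSnd a b)))
  rw [← integral_const_mul]
  simp only [← sum_rotSnd hf, inner_grad_prodPoly_rotSnd]
  have hlap : ∀ x : Prd j k, f x * prodPoly P (rotLap Q) x =
      ∑ a, ∑ b, f x * prodPoly P (rotDer a b (rotDer a b Q)) x := fun x => by
    simp [prodPoly, rotLap, polyEval, Finset.mul_sum]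
  simp only [hlap]
  have hc1 : ∀ a b : Fin (k + 1), Integrable (fun x : Prd j k =>
      inner ℝ (grad f x) (rotSnd a b x) * prodPoly P (rotDer a b Q) x) (prdMeasure j k) := fun a b =>
    integrable_of_continuous _ ((hf.continuous_grad.inner (continuous_rotSnd a b)).mul
      (prodPoly_isC1 _ _).continuous)
  have hc2 : ∀ a b : Fin (k + 1), Integrable (fun x : Prd j k =>
      f x * prodPoly P (rotDer a b (rotDer a b Q)) x) (prdMeasure j k) := fun a b =>
    integrable_of_continuous _ (hf.continuous.mul (prodPoly_isC1 _ _).continuous)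
  rw [integral_finsetSum _ fun a _ => integrable_finsetSum _ fun b _ => hc1 a b,
    integral_finsetSum _ fun a _ => integrable_finsetSum _ fun b _ => hc2 a b,
    ← Finset.sum_neg_distrib]
  refine Finset.sum_congr rfl fun a _ => ?_
  rw [integral_finsetSum _ fun b _ => hc1 a b, integral_finsetSum _ fun b _ => hc2 a b,
    ← Finset.sum_neg_distrib]
  exact Finset.sum_congr rfl fun b _ => hpart a b

/-- Spherical harmonics on the product of spheres. -/
def prodHarm (i : HarmIdx j × HarmIdx k) : Prd j k → ℝ := prodPoly (harmPoly i.1) (harmPoly i.2)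

theorem prodHarm_isC1 (i : HarmIdx j × HarmIdx k) : IsC1 (prodHarm i) := prodPoly_isC1 _ _

/-- The weak eigenvalue equation, tested against arbitrary C¹ functions. The factor 2 of Green's
formula cancels the one in `rotLap`. -/
theorem integral_dirFst_prodHarm {f : Prd j k → ℝ} (hf : IsC1 f) (i : HarmIdx j × HarmIdx k) :
    ∫ x, dirFst f (prodHarm i) x ∂prdMeasure j k =
      sphEig j i.1.1 * ∫ x, f x * prodHarm i x ∂prdMeasure j k := by
  have h := integral_dirFst_prodPoly hf (harmPoly i.1) (harmPoly i.2)
  simp only [prodPoly, rotLap_harmPoly] at h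
  have e : ∀ x : Prd j k, f x * (-(2 * sphEig j i.1.1) * polyEval (harmPoly i.1) (x.1 : Euc j) *
      polyEval (harmPoly i.2) (x.2 : Euc k)) = -(2 * sphEig j i.1.1) * (f x * prodHarm i x) :=
    fun x => by simp only [prodHarm, prodPoly]; ring
  simp only [e, integral_const_mul] at h
  have h' : 2 * ∫ x, dirFst f (prodHarm i) x ∂prdMeasure j k = _ := h
  linarith

theorem integral_dirSnd_prodHarm {f : Prd j k → ℝ} (hf : IsC1 f) (i : HarmIdx j × HarmIdx k) :
    ∫ x, dirSnd f (prodHarm i) x ∂prdMeasure j k =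
      sphEig k i.2.1 * ∫ x, f x * prodHarm i x ∂prdMeasure j k := by
  have h := integral_dirSnd_prodPoly hf (harmPoly i.1) (harmPoly i.2)
  simp only [prodPoly, rotLap_harmPoly] at h
  have e : ∀ x : Prd j k, f x * (polyEval (harmPoly i.1) (x.1 : Euc j) * (-(2 * sphEig k i.2.1) *
      polyEval (harmPoly i.2) (x.2 : Euc k))) = -(2 * sphEig k i.2.1) * (f x * prodHarm i x) :=
    fun x => by simp only [prodHarm, prodPoly]; ring
  simp only [e, integral_const_mul] at h
  have h' : 2 * ∫ x, dirSnd f (prodHarm i) x ∂prdMeasure j k = _ := h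
  linarith

theorem integral_prodHarm_mul (hj : 1 ≤ j) (hk : 1 ≤ k) (i i' : HarmIdx j × HarmIdx k) :
    ∫ x, prodHarm i x * prodHarm i' x ∂prdMeasure j k = if i = i' then 1 else 0 := by
  have e : ∀ x : Prd j k, prodHarm i x * prodHarm i' x =
      (polyEval (harmPoly i.1) (x.1 : Euc j) * polyEval (harmPoly i'.1) (x.1 : Euc j)) *
      (polyEval (harmPoly i.2) (x.2 : Euc k) * polyEval (harmPoly i'.2) (x.2 : Euc k)) :=
    fun x => by simp only [prodHarm, prodPoly]; ring
  simp only [e]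
  refine (integral_prod_mul (μ := sphMeasure j) (ν := sphMeasure k)
    (fun p : Sph j => polyEval (harmPoly i.1) (p : Euc j) * polyEval (harmPoly i'.1) (p : Euc j))
    (fun q : Sph k => polyEval (harmPoly i.2) (q : Euc k) *
      polyEval (harmPoly i'.2) (q : Euc k))).trans ?_
  rw [integral_harmPoly hj, integral_harmPoly hk]
  by_cases h1 : i.1 = i'.1 <;> by_cases h2 : i.2 = i'.2 <;> simp [h1, h2, Prod.ext_iff]

end Green

/-! ### Density of the spherical harmonics -/

section Density

variable {j k : ℕ}

theorem mul_mem_span_prodHarm {φ : Sph j → ℝ} {ψ : Sph k → ℝ}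
    (hφ : φ ∈ Submodule.span ℝ (range fun (i : HarmIdx j) (x : Sph j) =>
      polyEval (harmPoly i) (x : Euc j)))
    (hψ : ψ ∈ Submodule.span ℝ (range fun (i : HarmIdx k) (x : Sph k) =>
      polyEval (harmPoly i) (x : Euc k))) :
    (fun x : Prd j k => φ x.1 * ψ x.2) ∈
      Submodule.span ℝ (range (prodHarm : HarmIdx j × HarmIdx k → Prd j k → ℝ)) := by
  induction hφ using Submodule.span_induction with
  | mem φ hφ =>
    obtain ⟨i, rfl⟩ := hφ
    induction hψ using Submodule.span_induction with
    | mem ψ hψ =>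
      obtain ⟨i', rfl⟩ := hψ
      exact Submodule.subset_span ⟨(i, i'), rfl⟩
    | zero =>
      convert! Submodule.zero_mem _ using 1
      ext; simp
    | add ψ ψ' _ _ h h' => simpa [mul_add] using! Submodule.add_mem _ h h'
    | smul c ψ _ h => simpa [mul_left_comm] using! Submodule.smul_mem _ c h
  | zero =>
    convert! Submodule.zero_mem _ using 1
    ext; simp
  | add φ φ' _ _ h h' => simpa [add_mul] using! Submodule.add_mem _ h h'
  | smul c φ _ h => simpa [mul_assoc] using! Submodule.smul_mem _ c h

theorem prodPoly_mem_span (P : MvPolynomial (Fin (j + 1)) ℝ) (Q : MvPolynomial (Fin (k + 1)) ℝ) :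
    prodPoly P Q ∈ Submodule.span ℝ (range (prodHarm : HarmIdx j × HarmIdx k → Prd j k → ℝ)) :=
  mul_mem_span_prodHarm (polyEval_mem_span P) (polyEval_mem_span Q)

/-- The coordinate functions of `M`. -/
def coordFun (j k : ℕ) : Fin (j + 1) ⊕ Fin (k + 1) → C(Prd j k, ℝ)
  | .inl a => ⟨fun x => (x.1 : Euc j).ofLp a, by fun_prop⟩
  | .inr b => ⟨fun x => (x.2 : Euc k).ofLp b, by fun_prop⟩

/-- A monomial in the coordinates of M is a polynomial in p times a polynomial in q, and each factor
is a combination of harmonics. -/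
theorem adjoin_coordFun_le (g : C(Prd j k, ℝ)) (hg : g ∈ Algebra.adjoin ℝ (range (coordFun j k))) :
    ⇑g ∈ Submodule.span ℝ (range (prodHarm : HarmIdx j × HarmIdx k → Prd j k → ℝ)) := by
  have hmon : ∀ g ∈ Submonoid.closure (range (coordFun j k)), ∃ P Q, ⇑g = prodPoly P Q := by
    intro g hg
    induction hg using Submonoid.closure_induction with
    | mem g hg =>
      obtain ⟨a | b, rfl⟩ := hg
      · exact ⟨.X a, 1, by ext x; simp [coordFun, prodPoly, polyEval]⟩
      · exact ⟨1, .X b, by ext x; simp [coordFun, prodPoly, polyEval]⟩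
    | one => exact ⟨1, 1, by ext x; simp [prodPoly, polyEval]⟩
    | mul g h _ _ hg hh =>
      obtain ⟨P, Q, hPQ⟩ := hg
      obtain ⟨P', Q', hPQ'⟩ := hh
      exact ⟨P * P', Q * Q', by ext x; simp [hPQ, hPQ', prodPoly, polyEval]; ring⟩
  rw [← Subalgebra.mem_toSubmodule, Algebra.adjoin_eq_span] at hg
  induction hg using Submodule.span_induction with
  | mem g hg =>
    obtain ⟨P, Q, h⟩ := hmon g hg
    rw [h]
    exact prodPoly_mem_span P Q
  | zero => exact Submodule.zero_mem _
  | add g g' _ _ h h' => exact Submodule.add_mem _ h h'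
  | smul c g _ h => exact Submodule.smul_mem _ c h

/-- The spherical harmonics span a dense space of continuous functions. -/
theorem exists_span_prodHarm_approx {f : Prd j k → ℝ} (hf : Continuous f) {ε : ℝ} (hε : 0 < ε) :
    ∃ g ∈ Submodule.span ℝ (range (prodHarm : HarmIdx j × HarmIdx k → Prd j k → ℝ)),
      ∀ x, |f x - g x| < ε := by
  have hsep : (Algebra.adjoin ℝ (range (coordFun j k))).SeparatesPoints := by
    intro x y hxy
    by_contra! hcon
    have h : ∀ s, coordFun j k s x = coordFun j k s y := fun s =>
      hcon _ ⟨_, Algebra.subset_adjoin ⟨s, rfl⟩, rfl⟩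
    refine hxy (Prod.ext (Subtype.ext ?_) (Subtype.ext ?_))
    · ext a; exact h (.inl a)
    · ext b; exact h (.inr b)
  obtain ⟨g, hg⟩ := ContinuousMap.exists_mem_subalgebra_near_continuous_of_separatesPoints _ hsep
    f hf ε hε
  refine ⟨g.1, adjoin_coordFun_le g.1 g.2, fun x => ?_⟩
  rw [abs_sub_comm]
  exact hg x

end Density

/-! ### Quadratic forms that are diagonal in a dense orthonormal family -/

section Diagonal

variable {V ι : Type*} [AddCommGroup V] [Module ℝ V] [DecidableEq ι] {ip B : LinearMap.BilinForm ℝ V}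
  {e : ι → V} {ev : ι → ℝ}

/-- The orthogonal projection of `f` to the span of finitely many members of an orthonormal
family. -/
def partialSum (ip : LinearMap.BilinForm ℝ V) (e : ι → V) (s : Finset ι) (f : V) : V :=
  ∑ i ∈ s, ip f (e i) • e i

theorem ip_partialSum (he : ∀ i i', ip (e i) (e i') = if i = i' then 1 else 0) (s : Finset ι)
    (f : V) {i : ι} (hi : i ∈ s) : ip (partialSum ip e s f) (e i) = ip f (e i) := by
  simp [partialSum, he, hi]

/-- Best approximation: among combinations with given support the orthogonal projection is nearest,
by Pythagoras. The form `ip` is only assumed positive semidefinite. -/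
theorem ip_sub_partialSum_self_le (hsymm : ∀ f g, ip f g = ip g f) (hip : ∀ f, 0 ≤ ip f f)
    (he : ∀ i i', ip (e i) (e i') = if i = i' then 1 else 0) (f : V) {g : V}
    (hg : g ∈ Submodule.span ℝ (range e)) : ∃ s : Finset ι,
      ip (f - partialSum ip e s f) (f - partialSum ip e s f) ≤ ip (f - g) (f - g) := by
  obtain ⟨c, rfl⟩ := Finsupp.mem_span_range_iff_exists_finsupp.1 hg
  refine ⟨c.support, ?_⟩
  set P := partialSum ip e c.support f
  set g := c.sum fun i a => a • e i
  have horth : ∀ i ∈ c.support, ip (f - P) (e i) = 0 := fun i hi => by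
    rw [map_sub, LinearMap.sub_apply, ip_partialSum he _ _ hi, sub_self]
  have h1 : ip (f - P) (P - g) = 0 := by
    have hP : ip (f - P) P = 0 := by
      conv_lhs => arg 2; rw [show P = ∑ i ∈ c.support, ip f (e i) • e i from rfl]
      rw [map_sum]
      exact Finset.sum_eq_zero fun i hi => by rw [map_smul, horth i hi, smul_zero]
    have hg : ip (f - P) g = 0 := by
      simp only [g, Finsupp.sum, map_sum, map_smul]
      exact Finset.sum_eq_zero fun i hi => by rw [horth i hi, smul_zero]
    rw [map_sub, hP, hg, sub_zero]
  have h2 : ip (f - g) (f - g) = ip (f - P) (f - P) + ip (P - g) (P - g) := by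
    have : f - g = (f - P) + (P - g) := by abel
    rw [this]
    simp only [map_add, LinearMap.add_apply, h1, hsymm (P - g) (f - P)]
    ring
  rw [h2]
  linarith [hip (P - g)]

theorem ip_self_eq_zero (hsymm : ∀ f g, ip f g = ip g f) (hip : ∀ f, 0 ≤ ip f f)
    (he : ∀ i i', ip (e i) (e i') = if i = i' then 1 else 0)
    (hdense : ∀ f, ∀ ε > 0, ∃ g ∈ Submodule.span ℝ (range e), ip (f - g) (f - g) < ε)
    {f : V} (hf : ∀ i, ip f (e i) = 0) : ip f f = 0 := by
  by_contra hne
  obtain ⟨g, hg, hlt⟩ := hdense f _ (lt_of_le_of_ne (hip f) (Ne.symm hne))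
  obtain ⟨s, hs⟩ := ip_sub_partialSum_self_le hsymm hip he f hg
  have : partialSum ip e s f = 0 := Finset.sum_eq_zero fun i _ => by rw [hf, zero_smul]
  rw [this, sub_zero] at hs
  linarith

/-- Split f into a finite partial sum P and a remainder R with `ip R R` small. Diagonality gives
B(R, P) = 0 and B(P, P) ≥ 0, and the lower bound makes B(R, R) ≥ -C·ip(R, R) negligible.
Semiboundedness suffices: B need not be continuous for `ip`, and no spectral theorem is involved. -/
theorem form_nonneg_of_coeff (hsymm : ∀ f g, ip f g = ip g f) (hip : ∀ f, 0 ≤ ip f f)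
    (he : ∀ i i', ip (e i) (e i') = if i = i' then 1 else 0)
    (hdense : ∀ f, ∀ ε > 0, ∃ g ∈ Submodule.span ℝ (range e), ip (f - g) (f - g) < ε)
    (hBsymm : ∀ f g, B f g = B g f) (hB : ∀ f i, B f (e i) = ev i * ip f (e i))
    {C : ℝ} (hC : ∀ f, -(C * ip f f) ≤ B f f)
    {f : V} (hf : ∀ i, ip f (e i) ≠ 0 → 0 ≤ ev i) : 0 ≤ B f f := by
  by_contra! hneg
  -- The tolerance makes the loss in B(R, R) smaller than |B(f, f)|; |C| + 1 keeps the denominator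
  -- positive whatever the sign of C.
  obtain ⟨g, hg, hlt⟩ := hdense f (-B f f / (|C| + 1))
    (div_pos (neg_pos.2 hneg) (by positivity))
  obtain ⟨s, hs⟩ := ip_sub_partialSum_self_le hsymm hip he f hg
  set P := partialSum ip e s f with hPdef
  set R := f - P with hR
  have hRe : ∀ i ∈ s, ip R (e i) = 0 := fun i hi => by
    rw [hR, map_sub, LinearMap.sub_apply, ip_partialSum he _ _ hi, sub_self]
  have hRP : B R P = 0 := by
    rw [hPdef, partialSum, map_sum]
    exact Finset.sum_eq_zero fun i hi => by rw [map_smul, hB, hRe i hi, mul_zero, smul_zero]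
  have hPP : 0 ≤ B P P := by
    have : B P P = ∑ i ∈ s, ip f (e i) • B P (e i) := by
      conv_lhs => rw [hPdef, partialSum, map_sum]
      simp only [map_smul]
      rfl
    rw [this]
    refine Finset.sum_nonneg fun i hi => ?_
    rw [hB, ip_partialSum he _ _ hi, smul_eq_mul]
    by_cases h0 : ip f (e i) = 0
    · simp [h0]
    · have := hf i h0
      nlinarith [mul_self_nonneg (ip f (e i))]
  have hff : B f f = B R R + B P P := by
    have : f = R + P := by rw [hR]; abel
    conv_lhs => rw [this]
    simp only [map_add, LinearMap.add_apply, hRP, hBsymm P R]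
    ring
  have h1 := hC R
  have h2 : C * ip R R ≤ (|C| + 1) * ip R R :=
    mul_le_mul_of_nonneg_right (by linarith [le_abs_self C]) (hip R)
  have h3 : (|C| + 1) * ip R R < -B f f := by
    have h4 : ip R R < -B f f / (|C| + 1) := lt_of_le_of_lt hs hlt
    rw [lt_div_iff₀ (by positivity)] at h4
    linarith
  linarith

theorem form_combination (he : ∀ i i', ip (e i) (e i') = if i = i' then 1 else 0)
    (hB : ∀ f i, B f (e i) = ev i * ip f (e i)) (s : Finset ι) (c : ι → ℝ) :
    B (∑ i ∈ s, c i • e i) (∑ i ∈ s, c i • e i) = ∑ i ∈ s, ev i * c i ^ 2 := by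
  rw [map_sum]
  refine Finset.sum_congr rfl fun i hi => ?_
  rw [map_smul, hB]
  have : ip (∑ i ∈ s, c i • e i) (e i) = c i := by simp [he, hi]
  rw [this, smul_eq_mul]
  ring

end Diagonal

/-! ### The area of normal graphs -/

section Gram

variable {j k : ℕ}

/-- The map `(p, q) ↦ (sin w p, cos w q)`. -/
def graphMap (w : Prd j k → ℝ) (x : Prd j k) : Amb j k :=
  WithLp.toLp 2 (Real.sin (w x) • (x.1 : Euc j), Real.cos (w x) • (x.2 : Euc k))

/-- By the addition formulas, moving along the normal geodesic only shifts the angle θ = arcsin r.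
All the tori are thus level sets of one angle function. -/
theorem normalGraph_eq {r : ℝ} (hr : r ∈ Ioo (0 : ℝ) 1) (u : Prd j k → ℝ) :
    normalGraph j k r u = graphMap fun x => Real.arcsin r + u x := by
  ext1 x
  rw [normalGraph, clifford, normal, graphMap, Real.sin_add, Real.cos_add,
    Real.sin_arcsin (by linarith [hr.1]) hr.2.le, Real.cos_arcsin]
  refine WithLp.ofLp_injective 2 (Prod.ext ?_ ?_)
  · change Real.cos (u x) • (r • (x.1 : Euc j)) + Real.sin (u x) • (√(1 - r ^ 2) • (x.1 : Euc j)) =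
      (r * Real.cos (u x) + √(1 - r ^ 2) * Real.sin (u x)) • (x.1 : Euc j)
    module
  · change Real.cos (u x) • (√(1 - r ^ 2) • (x.2 : Euc k)) + Real.sin (u x) • (-(r • (x.2 : Euc k))) =
      (√(1 - r ^ 2) * Real.cos (u x) - r * Real.sin (u x)) • (x.2 : Euc k)
    module

theorem fderiv_toLp_apply {V E F : Type*} [NormedAddCommGroup V] [NormedSpace ℝ V]
    [NormedAddCommGroup E] [NormedSpace ℝ E] [NormedAddCommGroup F] [NormedSpace ℝ F]
    {f : V → E} {g : V → F} {f' : V →L[ℝ] E} {g' : V →L[ℝ] F} {z : V}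
    (hf : HasFDerivAt f f' z) (hg : HasFDerivAt g g' z) (v : V) :
    fderiv ℝ (fun z => (WithLp.toLp 2 (f z, g z) : WithLp 2 (E × F))) z v =
      WithLp.toLp 2 (f' v, g' v) := by
  have h := (WithLp.prodContinuousLinearEquiv 2 ℝ E F).symm.hasFDerivAt.comp z (hf.prodMk hg)
  have h' : HasFDerivAt (fun z => (WithLp.toLp 2 (f z, g z) : WithLp 2 (E × F))) _ z := h
  rw [h'.fderiv]
  rfl

theorem fderiv_graph_generic {V E F : Type*} [NormedAddCommGroup V] [NormedSpace ℝ V]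
    [NormedAddCommGroup E] [NormedSpace ℝ E] [NormedAddCommGroup F] [NormedSpace ℝ F]
    (π : V →L[ℝ] E) (π' : V →L[ℝ] F) {ρ : V → V} {w : V → ℝ} {z v : V} (hρz : ρ z = z)
    (hρ : DifferentiableAt ℝ ρ z) (hw : DifferentiableAt ℝ w z) (hv : fderiv ℝ ρ z v = v) :
    fderiv ℝ (fun z => (WithLp.toLp 2 (Real.sin (w z) • π (ρ z), Real.cos (w z) • π' (ρ z)) :
      WithLp 2 (E × F))) z v =
    WithLp.toLp 2 (Real.sin (w z) • π v + (Real.cos (w z) * fderiv ℝ w z v) • π z,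
      Real.cos (w z) • π' v - (Real.sin (w z) * fderiv ℝ w z v) • π' z) := by
  have h1 := hw.hasFDerivAt.sin.smul (π.hasFDerivAt.comp z hρ.hasFDerivAt)
  have h2 := hw.hasFDerivAt.cos.smul (π'.hasFDerivAt.comp z hρ.hasFDerivAt)
  refine (fderiv_toLp_apply h1 h2 v).trans ?_
  congr 2
  · simp [hρz, hv]
  · simp [hρz, hv, sub_eq_add_neg]

theorem diffAt_graphMap {w : Prd j k → ℝ} (hw : IsC1 w) (x : Prd j k) (v : tangent x) :
    diffAt (graphMap w) x v = WithLp.toLp 2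
      (Real.sin (w x) • (v : Amb j k).fst +
        (Real.cos (w x) * inner ℝ (grad w x) (v : Amb j k)) • (x.1 : Euc j),
      Real.cos (w x) • (v : Amb j k).snd -
        (Real.sin (w x) * inner ℝ (grad w x) (v : Amb j k)) • (x.2 : Euc k)) := by
  have hev : radialExt (graphMap w) =ᶠ[nhds (pt x)] fun z : Amb j k =>
      (WithLp.toLp 2 (Real.sin (radialExt w z) • ambFst j k (retr z),
        Real.cos (radialExt w z) • ambSnd j k (retr z)) : Amb j k) :=
    Filter.eventually_of_mem ((isOpen_offAxes j k).mem_nhds (pt_mem_offAxes x)) fun z hz => by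
      rw [radialExt_of_mem _ hz]
      simp only [radialExt_of_mem _ hz]
      rfl
  have h := fderiv_graph_generic (ambFst j k) (ambSnd j k) (retr_pt x) (differentiableAt_retr x)
    (hw.differentiableAt x) (fderiv_retr_apply x v.2)
  rw [← hev.fderiv_eq, radialExt_pt, ← inner_grad] at h
  exact h

theorem inner_adjoint_tangent (x : Prd j k) (T : tangent x →L[ℝ] Amb j k) (v : Amb j k)
    (v' : tangent x) :
    inner ℝ (ContinuousLinearMap.adjoint (𝕜 := ℝ) (E := tangent x) (F := Amb j k) T v) v' =
      inner ℝ v (T v') := by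
  have := ContinuousLinearMap.adjoint_inner_left (𝕜 := ℝ) (E := tangent x) (F := Amb j k) T v' v
  exact this

theorem inner_gram (y : Prd j k → Amb j k) (x : Prd j k) (v v' : tangent x) :
    inner ℝ (gram y x v) v' = inner ℝ (diffAt y x v) (diffAt y x v') :=
  inner_adjoint_tangent x (diffAt y x) (diffAt y x v) v'

theorem inner_toLp_toLp {E F : Type*} [NormedAddCommGroup E] [InnerProductSpace ℝ E]
    [NormedAddCommGroup F] [InnerProductSpace ℝ F] (a a' : E) (b b' : F) :
    inner ℝ (WithLp.toLp 2 (a, b)) (WithLp.toLp 2 (a', b') : WithLp 2 (E × F)) =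
      inner ℝ a a' + inner ℝ b b' := WithLp.prod_inner_apply _ _

theorem inner_toLp_left (a : Euc j) (b : Euc k) (z : Amb j k) :
    inner ℝ (WithLp.toLp 2 (a, b) : Amb j k) z = inner ℝ a z.fst + inner ℝ b z.snd :=
  WithLp.prod_inner_apply _ _

theorem inner_toLp_right (a : Euc j) (b : Euc k) (z : Amb j k) :
    inner ℝ z (WithLp.toLp 2 (a, b) : Amb j k) = inner ℝ z.fst a + inner ℝ z.snd b :=
  WithLp.prod_inner_apply _ _

/-- The tangent space of `M` is the product of the tangent spaces of the two spheres. -/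
def tangentEquiv (x : Prd j k) : tangent x ≃ₗ[ℝ]
    (Submodule.span ℝ {(x.1 : Euc j)})ᗮ × (Submodule.span ℝ {(x.2 : Euc k)})ᗮ where
  toFun v := (⟨(v : Amb j k).fst, Submodule.mem_orthogonal_singleton_iff_inner_right.2 v.2.1⟩,
    ⟨(v : Amb j k).snd, Submodule.mem_orthogonal_singleton_iff_inner_right.2 v.2.2⟩)
  invFun p := ⟨WithLp.toLp 2 ((p.1 : Euc j), (p.2 : Euc k)),
    Submodule.mem_orthogonal_singleton_iff_inner_right.1 p.1.2,
    Submodule.mem_orthogonal_singleton_iff_inner_right.1 p.2.2⟩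
  map_add' _ _ := rfl
  map_smul' _ _ := rfl
  left_inv _ := rfl
  right_inv _ := rfl

theorem finrank_orth_sph {d : ℕ} (p : Sph d) :
    Module.finrank ℝ (Submodule.span ℝ {(p : Euc d)})ᗮ = d := by
  have : Fact (Module.finrank ℝ (Euc d) = d + 1) := ⟨by simp⟩
  exact Submodule.finrank_orthogonal_span_singleton (sph_ne_zero p)

/-- The endomorphism of the tangent space that multiplies the two factors by `a` and `b`. -/
def scaleTangent (x : Prd j k) (a b : ℝ) : tangent x →ₗ[ℝ] tangent x :=
  (tangentEquiv x).symm.toLinearMap ∘ₗ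
    (LinearMap.prodMap (a • LinearMap.id) (b • LinearMap.id)) ∘ₗ (tangentEquiv x).toLinearMap

theorem det_scaleTangent (x : Prd j k) (a b : ℝ) :
    LinearMap.det (scaleTangent x a b) = a ^ j * b ^ k := by
  have := LinearMap.det_conj (LinearMap.prodMap (a • LinearMap.id) (b • LinearMap.id) :
    _ →ₗ[ℝ] (Submodule.span ℝ {(x.1 : Euc j)})ᗮ × (Submodule.span ℝ {(x.2 : Euc k)})ᗮ)
    (tangentEquiv x).symm
  rw [LinearEquiv.symm_symm] at this
  rw [scaleTangent, this, LinearMap.det_prodMap, LinearMap.det_smul, LinearMap.det_smul,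
    finrank_orth_sph, finrank_orth_sph]
  simp

theorem coe_scaleTangent (x : Prd j k) (a b : ℝ) (v : tangent x) :
    (scaleTangent x a b v : Amb j k) =
      WithLp.toLp 2 (a • (v : Amb j k).fst, b • (v : Amb j k).snd) := rfl

/-- Tangent vectors are orthogonal to (p, 0) and (0, q), so the Gram form is sin²w on the first
factor plus cos²w on the second plus dw ⊗ dw. It is therefore a diagonal map composed with a
rank-one perturbation of the identity, whose determinant is 1 + φ(a'). -/
theorem det_gram_graphMap {w : Prd j k → ℝ} (hw : IsC1 w) (x : Prd j k)
    (hs : Real.sin (w x) ≠ 0) (hc : Real.cos (w x) ≠ 0) :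
    (gram (graphMap w) x).det = (Real.sin (w x) ^ 2) ^ j * (Real.cos (w x) ^ 2) ^ k *
      (1 + (dirFst w w x / Real.sin (w x) ^ 2 + dirSnd w w x / Real.cos (w x) ^ 2)) := by
  set s := Real.sin (w x)
  set c := Real.cos (w x)
  have hs2 : s ^ 2 ≠ 0 := pow_ne_zero 2 hs
  have hc2 : c ^ 2 ≠ 0 := pow_ne_zero 2 hc
  let a : tangent x := ⟨grad w x, grad_mem_tangent hw x⟩
  let φ : Module.Dual ℝ (tangent x) := (innerₛₗ ℝ a : tangent x →ₗ[ℝ] ℝ)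
  -- Dividing the gradient by the diagonal factors makes the diagonal map send a' back to the
  -- gradient.
  let a' : tangent x := scaleTangent x (s ^ 2)⁻¹ (c ^ 2)⁻¹ a
  have hp : inner ℝ (x.1 : Euc j) (x.1 : Euc j) = (1 : ℝ) := by
    rw [real_inner_self_eq_norm_sq, norm_eq_of_mem_sphere, one_pow]
  have hq : inner ℝ (x.2 : Euc k) (x.2 : Euc k) = (1 : ℝ) := by
    rw [real_inner_self_eq_norm_sq, norm_eq_of_mem_sphere, one_pow]
  have hsc : s ^ 2 + c ^ 2 = 1 := Real.sin_sq_add_cos_sq _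
  have hG : (gram (graphMap w) x : tangent x →ₗ[ℝ] tangent x) =
      scaleTangent x (s ^ 2) (c ^ 2) ∘ₗ LinearMap.transvection φ a' := by
    ext1 v
    refine ext_inner_right ℝ fun v' => ?_
    refine (inner_gram (graphMap w) x v v').trans ?_
    have hv1 := v.2.1
    have hv2 := v.2.2
    have hv1' := v'.2.1
    have hv2' := v'.2.2
    have hv1s := hv1
    have hv2s := hv2
    rw [real_inner_comm] at hv1s hv2s
    have e1 : scaleTangent x (s ^ 2) (c ^ 2) a' = a := by
      ext1
      apply (WithLp.prodContinuousLinearEquiv 2 ℝ (Euc j) (Euc k)).injective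
      ext1
      · simp [a', coe_scaleTangent, smul_smul, hs2]
      · simp [a', coe_scaleTangent, smul_smul, hc2]
    have e2 : φ v = inner ℝ (grad w x) (v : Amb j k) := rfl
    have hR : inner ℝ (scaleTangent x (s ^ 2) (c ^ 2) v + φ v • a) v' =
        s ^ 2 * inner ℝ (v : Amb j k).fst (v' : Amb j k).fst +
        c ^ 2 * inner ℝ (v : Amb j k).snd (v' : Amb j k).snd +
        inner ℝ (grad w x) (v : Amb j k) * inner ℝ (grad w x) (v' : Amb j k) := by
      rw [e2, Submodule.coe_inner, Submodule.coe_add, Submodule.coe_smul, coe_scaleTangent,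
        inner_add_left (E := Amb j k), real_inner_smul_left, inner_toLp_left, real_inner_smul_left,
        real_inner_smul_left]
    rw [diffAt_graphMap hw, diffAt_graphMap hw, LinearMap.comp_apply, LinearMap.transvection.apply,
      map_add, map_smul, e1, hR, inner_toLp_toLp]
    simp only [inner_add_left, inner_add_right, inner_sub_left, inner_sub_right, inner_smul_left,
      inner_smul_right, RCLike.conj_to_real, hp, hq, hv1', hv2', hv1s, hv2s]
    linear_combination (inner ℝ (grad w x) (v : Amb j k) * inner ℝ (grad w x) (v' : Amb j k)) * hsc
  rw [ContinuousLinearMap.det, hG, LinearMap.det_comp, det_scaleTangent, LinearMap.transvection.det]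
  congr 2
  have : φ a' = inner ℝ (grad w x) (a' : Amb j k) := rfl
  rw [this, coe_scaleTangent, inner_toLp_right]
  simp only [inner_smul_right, dirFst, dirSnd, a]
  ring

end Gram

/-! ### The region enclosed by a graph -/

section Region

variable {j k : ℕ}

theorem continuousOn_radialExt {w : Prd j k → ℝ} (hw : Continuous w) :
    ContinuousOn (radialExt w) (offAxes j k) := by
  rw [continuousOn_iff_continuous_domRestrict]
  have e : (offAxes j k).domRestrict (radialExt w) = fun z : offAxes j k =>
      w (radial z.1.fst z.2.1, radial z.1.snd z.2.2) := by
    ext z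
    exact radialExt_of_mem w z.2
  rw [e]
  have h1 : Continuous fun z : offAxes j k => z.1.fst :=
    (ambFst j k).continuous.comp continuous_subtype_val
  have h2 : Continuous fun z : offAxes j k => z.1.snd :=
    (ambSnd j k).continuous.comp continuous_subtype_val
  refine hw.comp (Continuous.prodMk ?_ ?_)
  · exact ((h1.norm.inv₀ fun z => norm_ne_zero_iff.2 z.2.1).smul h1).subtype_mk _
  · exact ((h2.norm.inv₀ fun z => norm_ne_zero_iff.2 z.2.2).smul h2).subtype_mk _

/-- The point `(sin φ p, cos φ q)`. -/
def arc (x : Prd j k) (φ : ℝ) : Amb j k :=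
  WithLp.toLp 2 (Real.sin φ • (x.1 : Euc j), Real.cos φ • (x.2 : Euc k))

theorem continuous_arc (x : Prd j k) : Continuous (arc x) :=
  (toAmb j k).continuous.comp
    ((Real.continuous_sin.smul continuous_const).prodMk (Real.continuous_cos.smul continuous_const))

theorem norm_smul_sph {d : ℕ} (p : Sph d) (t : ℝ) : ‖t • (p : Euc d)‖ = |t| := by
  rw [norm_smul, norm_eq_of_mem_sphere, mul_one, Real.norm_eq_abs]

theorem norm_sq_amb (z : Amb j k) : ‖z‖ ^ 2 = ‖z.fst‖ ^ 2 + ‖z.snd‖ ^ 2 :=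
  WithLp.prod_norm_sq_eq_of_L2 z

theorem mem_sphere_amb {z : Amb j k} :
    z ∈ Metric.sphere (0 : Amb j k) 1 ↔ ‖z.fst‖ ^ 2 + ‖z.snd‖ ^ 2 = 1 := by
  rw [mem_sphere_zero_iff_norm, ← norm_sq_amb, pow_eq_one_iff_of_nonneg (norm_nonneg z) two_ne_zero]

theorem arc_mem_sphere (x : Prd j k) (φ : ℝ) : arc x φ ∈ Metric.sphere (0 : Amb j k) 1 := by
  rw [mem_sphere_amb]
  change ‖Real.sin φ • (x.1 : Euc j)‖ ^ 2 + ‖Real.cos φ • (x.2 : Euc k)‖ ^ 2 = 1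
  rw [norm_smul_sph, norm_smul_sph, sq_abs, sq_abs, Real.sin_sq_add_cos_sq]

theorem norm_fst_arc (x : Prd j k) {φ : ℝ} (hφ : φ ∈ Icc 0 (Real.pi / 2)) :
    ‖(arc x φ).fst‖ = Real.sin φ :=
  (norm_smul_sph x.1 _).trans (abs_of_nonneg (Real.sin_nonneg_of_nonneg_of_le_pi hφ.1
    (by linarith [hφ.2, Real.pi_pos])))

theorem arc_mem_offAxes (x : Prd j k) {φ : ℝ} (hφ : φ ∈ Ioo 0 (Real.pi / 2)) :
    arc x φ ∈ offAxes j k :=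
  ⟨smul_ne_zero (Real.sin_pos_of_pos_of_lt_pi hφ.1 (by linarith [hφ.2, Real.pi_pos])).ne'
    (sph_ne_zero _), smul_ne_zero (Real.cos_pos_of_mem_Ioo ⟨by linarith [hφ.1, Real.pi_pos], hφ.2⟩).ne'
    (sph_ne_zero _)⟩

theorem radial_smul {d : ℕ} (p : Sph d) {t : ℝ} (ht : 0 < t) (h : t • (p : Euc d) ≠ 0) :
    radial (t • (p : Euc d)) h = p := by
  ext1
  change ‖t • (p : Euc d)‖⁻¹ • t • (p : Euc d) = p
  rw [norm_smul_sph, abs_of_pos ht, inv_smul_smul₀ ht.ne']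

theorem radialExt_toLp_smul {F : Type*} [Zero F] (w : Prd j k → F) (x : Prd j k) {s t : ℝ}
    (hs : 0 < s) (ht : 0 < t) :
    radialExt w (WithLp.toLp 2 (s • (x.1 : Euc j), t • (x.2 : Euc k))) = w x := by
  have hz : (WithLp.toLp 2 (s • (x.1 : Euc j), t • (x.2 : Euc k)) : Amb j k) ∈ offAxes j k :=
    ⟨smul_ne_zero hs.ne' (sph_ne_zero _), smul_ne_zero ht.ne' (sph_ne_zero _)⟩
  rw [radialExt_of_mem w hz]
  congr 1
  exact Prod.ext (radial_smul x.1 hs hz.1) (radial_smul x.2 ht hz.2)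

theorem radialExt_arc {F : Type*} [Zero F] (w : Prd j k → F) (x : Prd j k) {φ : ℝ}
    (hφ : φ ∈ Ioo 0 (Real.pi / 2)) : radialExt w (arc x φ) = w x :=
  radialExt_toLp_smul w x (Real.sin_pos_of_pos_of_lt_pi hφ.1 (by linarith [hφ.2, Real.pi_pos]))
    (Real.cos_pos_of_mem_Ioo ⟨by linarith [hφ.1, Real.pi_pos], hφ.2⟩)

theorem exists_eq_arc {z : Amb j k} (hz : z ∈ Metric.sphere (0 : Amb j k) 1)
    (h : z ∈ offAxes j k) : ∃ x φ, φ ∈ Ioo 0 (Real.pi / 2) ∧ z = arc x φ := by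
  have h0 : 0 < ‖z.fst‖ := norm_pos_iff.2 h.1
  have h0' : 0 < ‖z.snd‖ := norm_pos_iff.2 h.2
  rw [mem_sphere_amb] at hz
  have h1 : ‖z.fst‖ < 1 := by nlinarith
  have hs : Real.sin (Real.arcsin ‖z.fst‖) = ‖z.fst‖ := Real.sin_arcsin (by linarith) h1.le
  have hc : Real.cos (Real.arcsin ‖z.fst‖) = ‖z.snd‖ := by
    rw [Real.cos_arcsin, ← hz, add_sub_cancel_left, Real.sqrt_sq h0'.le]
  refine ⟨(radial z.fst h.1, radial z.snd h.2), Real.arcsin ‖z.fst‖,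
    ⟨Real.arcsin_pos.2 h0, Real.arcsin_lt_pi_div_two.2 h1⟩, ?_⟩
  rw [arc, hs, hc]
  refine WithLp.ofLp_injective 2 (Prod.ext ?_ ?_)
  · exact (smul_inv_smul₀ h0.ne' _).symm
  · exact (smul_inv_smul₀ h0'.ne' _).symm

theorem sin_lt_sin_iff {a b : ℝ} (ha : a ∈ Icc 0 (Real.pi / 2)) (hb : b ∈ Icc 0 (Real.pi / 2)) :
    Real.sin a < Real.sin b ↔ a < b :=
  Real.strictMonoOn_sin.lt_iff_lt ⟨by linarith [ha.1, Real.pi_pos], ha.2⟩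
    ⟨by linarith [hb.1, Real.pi_pos], hb.2⟩

instance (d : ℕ) : Nonempty (Sph d) := (NormedSpace.sphere_nonempty.2 zero_le_one).to_subtype

/-- The points below and above the graph form two disjoint open sets covering its complement in the
sphere, so no component crosses. Conversely, each point below the graph is joined to the focal
sphere by an arc of constant (p, q). The description of U is confined to `offAxes`, which has full
measure. -/
theorem region_graphMap {w : Prd j k → ℝ} (hw : Continuous w)
    (hw' : ∀ x, w x ∈ Ioo 0 (Real.pi / 2)) :
    ∃ U : Set (Amb j k), IsOpen U ∧ region (graphMap w) = Metric.sphere 0 1 ∩ U ∧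
      ∀ z ∈ offAxes j k, z ∈ U ↔ ‖z.fst‖ < Real.sin (radialExt w z) := by
  have hwI : ∀ x, w x ∈ Icc 0 (Real.pi / 2) := fun x => Ioo_subset_Icc_self (hw' x)
  have hgr : ∀ x, graphMap w x = arc x (w x) := fun x => rfl
  obtain ⟨x₀, -, hx₀⟩ := isCompact_univ.exists_isMinOn univ_nonempty hw.continuousOn
  obtain ⟨x₁, -, hx₁⟩ := isCompact_univ.exists_isMaxOn univ_nonempty hw.continuousOn
  have hm : ∀ x, Real.sin (w x₀) ≤ Real.sin (w x) := fun x =>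
    not_lt.1 fun h => not_lt.2 (hx₀ (mem_univ x)) ((sin_lt_sin_iff (hwI x) (hwI x₀)).1 h)
  have hM : ∀ x, Real.sin (w x) ≤ Real.sin (w x₁) := fun x =>
    not_lt.1 fun h => not_lt.2 (hx₁ (mem_univ x)) ((sin_lt_sin_iff (hwI x₁) (hwI x)).1 h)
  have hm0 : 0 < Real.sin (w x₀) := by
    simpa using (sin_lt_sin_iff ⟨le_rfl, by positivity⟩ (hwI x₀)).2 (hw' x₀).1
  have hM1 : Real.sin (w x₁) < 1 := by
    simpa using (sin_lt_sin_iff (hwI x₁) ⟨by positivity, le_rfl⟩).2 (hw' x₁).2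
  have hfst : Continuous fun z : Amb j k => ‖z.fst‖ := (ambFst j k).continuous.norm
  have hD : ContinuousOn (fun z : Amb j k => ‖z.fst‖ - Real.sin (radialExt w z)) (offAxes j k) :=
    hfst.continuousOn.sub (Real.continuous_sin.comp_continuousOn (continuousOn_radialExt hw))
  have hext : ∀ z ∈ offAxes j k, ∃ x, radialExt w z = w x := fun z hz =>
    ⟨_, radialExt_of_mem w hz⟩
  -- On the axes `radialExt w` is only a default value; comparison with the minimum and the maximum
  -- of sin w takes care of neighbourhoods of the two focal spheres.
  set U : Set (Amb j k) := {z | ‖z.fst‖ < Real.sin (w x₀)} ∪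
    (offAxes j k ∩ (fun z : Amb j k => ‖z.fst‖ - Real.sin (radialExt w z)) ⁻¹' Iio 0)
  set V : Set (Amb j k) := {z | Real.sin (w x₁) < ‖z.fst‖} ∪
    (offAxes j k ∩ (fun z : Amb j k => ‖z.fst‖ - Real.sin (radialExt w z)) ⁻¹' Ioi 0)
  have hU : IsOpen U := (isOpen_lt hfst continuous_const).union
    (hD.isOpen_inter_preimage (isOpen_offAxes j k) isOpen_Iio)
  have hV : IsOpen V := (isOpen_lt continuous_const hfst).union
    (hD.isOpen_inter_preimage (isOpen_offAxes j k) isOpen_Ioi)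
  have hUoff : ∀ z ∈ offAxes j k, z ∈ U ↔ ‖z.fst‖ < Real.sin (radialExt w z) := by
    intro z hz
    constructor
    · rintro (h | ⟨-, h⟩)
      · obtain ⟨x, hx⟩ := hext z hz
        rw [hx]
        exact lt_of_lt_of_le h (hm x)
      · exact sub_neg.1 h
    · exact fun h => Or.inr ⟨hz, sub_neg.2 h⟩
  have hUV : Disjoint U V := by
    rw [Set.disjoint_left]
    intro z hzU hzV
    by_cases hz : z ∈ offAxes j k
    · have h1 := (hUoff z hz).1 hzU
      obtain ⟨x, hx⟩ := hext z hz
      rw [hx] at h1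
      rcases hzV with h | ⟨-, h⟩
      · exact absurd (lt_trans (lt_of_le_of_lt (hM x) h) h1) (lt_irrefl _)
      · have h2 : 0 < ‖z.fst‖ - Real.sin (radialExt w z) := h
        rw [hx] at h2
        exact lt_asymm (sub_pos.1 h2) h1
    · rcases hzU with h | ⟨h, -⟩
      · rcases hzV with h' | ⟨h', -⟩
        · exact absurd (lt_trans (lt_of_le_of_lt (hM x₀) h') h) (lt_irrefl _)
        · exact hz h'
      · exact hz h
  have hcover : Metric.sphere (0 : Amb j k) 1 \ range (graphMap w) ⊆ U ∪ V := by
    rintro z ⟨hz, hzr⟩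
    by_cases ho : z ∈ offAxes j k
    · rcases lt_trichotomy ‖z.fst‖ (Real.sin (radialExt w z)) with h | h | h
      · exact Or.inl (Or.inr ⟨ho, sub_neg.2 h⟩)
      · obtain ⟨x, φ, hφ, rfl⟩ := exists_eq_arc hz ho
        rw [radialExt_arc w x hφ, norm_fst_arc x (Ioo_subset_Icc_self hφ)] at h
        have : φ = w x := Real.strictMonoOn_sin.injOn ⟨by linarith [hφ.1, Real.pi_pos], hφ.2.le⟩
          ⟨by linarith [(hw' x).1, Real.pi_pos], (hw' x).2.le⟩ h
        exact absurd ⟨x, by rw [hgr, this]⟩ hzr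
      · exact Or.inr (Or.inr ⟨ho, sub_pos.2 h⟩)
    · have ho' : z.fst = 0 ∨ z.snd = 0 := by
        by_contra hcon
        exact ho ⟨fun h => hcon (Or.inl h), fun h => hcon (Or.inr h)⟩
      rw [mem_sphere_amb] at hz
      rcases ho' with h | h
      · left; left
        change ‖z.fst‖ < _
        rw [h, norm_zero]
        exact hm0
      · right; left
        change _ < ‖z.fst‖
        rw [h, norm_zero] at hz
        nlinarith [norm_nonneg z.fst]
  have haxis : ∀ q : Sph k, (WithLp.toLp 2 ((0 : Euc j), (q : Euc k)) : Amb j k) ∈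
      (Metric.sphere (0 : Amb j k) 1 \ range (graphMap w)) ∩ U := by
    intro q
    refine ⟨⟨?_, ?_⟩, Or.inl ?_⟩
    · rw [mem_sphere_amb]
      change ‖(0 : Euc j)‖ ^ 2 + ‖(q : Euc k)‖ ^ 2 = 1
      rw [norm_eq_of_mem_sphere]; simp
    · rintro ⟨x, hx⟩
      exact (arc_mem_offAxes x (hw' x)).1 (congrArg WithLp.fst hx)
    · change ‖(0 : Euc j)‖ < _
      rwa [norm_zero]
  refine ⟨U, hU, ?_, hUoff⟩
  refine Subset.antisymm (iUnion_subset fun q => subset_inter ?_ ?_) ?_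
  · exact (connectedComponentIn_subset _ _).trans sdiff_subset
  · exact isPreconnected_connectedComponentIn.subset_left_of_subset_union hU hV hUV
      ((connectedComponentIn_subset _ _).trans hcover)
      ⟨_, mem_connectedComponentIn (haxis q).1, (haxis q).2⟩
  · rintro z ⟨hz, hzU⟩
    by_cases h0 : z.fst = 0
    · have hz' := mem_sphere_amb.1 hz
      have hq : ‖z.snd‖ = 1 := by
        rw [h0, norm_zero] at hz'
        nlinarith [norm_nonneg z.snd]
      let q : Sph k := ⟨z.snd, mem_sphere_zero_iff_norm.2 hq⟩
      have hzq : z = WithLp.toLp 2 ((0 : Euc j), (q : Euc k)) :=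
        WithLp.ofLp_injective 2 (Prod.ext h0 rfl)
      refine mem_iUnion.2 ⟨q, ?_⟩
      rw [hzq]
      exact mem_connectedComponentIn (haxis q).1
    · have ho : z ∈ offAxes j k := by
        rcases hzU with h | h
        · refine ⟨h0, fun hs => ?_⟩
          have hz' := mem_sphere_amb.1 hz
          rw [hs, norm_zero] at hz'
          have h1 : ‖z.fst‖ < Real.sin (w x₀) := h
          nlinarith [norm_nonneg z.fst, hm x₁]
        · exact h.1
      rw [hUoff z ho] at hzU
      obtain ⟨x, φ, hφ, rfl⟩ := exists_eq_arc hz ho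
      rw [radialExt_arc w x hφ, norm_fst_arc x (Ioo_subset_Icc_self hφ),
        sin_lt_sin_iff (Ioo_subset_Icc_self hφ) (hwI x)] at hzU
      refine mem_iUnion.2 ⟨x.2, ?_⟩
      -- The arc misses the graph: a common point of parameter ψ would give w x = ψ ≤ φ < w x.
      have hpre : IsPreconnected (arc x '' Icc 0 φ) :=
        isPreconnected_Icc.image _ (continuous_arc x).continuousOn
      refine hpre.subset_connectedComponentIn (F := Metric.sphere (0 : Amb j k) 1 \ range (graphMap w))
        (x := WithLp.toLp 2 ((0 : Euc j), (x.2 : Euc k)))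
        ⟨0, left_mem_Icc.2 hφ.1.le, by simp [arc]⟩ ?_ ⟨φ, right_mem_Icc.2 hφ.1.le, rfl⟩
      rintro _ ⟨ψ, hψ, rfl⟩
      refine ⟨arc_mem_sphere x ψ, ?_⟩
      rintro ⟨x', hx'⟩
      rw [hgr] at hx'
      have hψI : ψ ∈ Icc 0 (Real.pi / 2) := ⟨hψ.1, hψ.2.trans hφ.2.le⟩
      have hn : Real.sin (w x') = Real.sin ψ := by
        rw [← norm_fst_arc x' (hwI x'), hx', norm_fst_arc x hψI]
      have hψ' : w x' = ψ := Real.strictMonoOn_sin.injOn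
        ⟨by linarith [(hw' x').1, Real.pi_pos], (hw' x').2.le⟩
        ⟨by linarith [hψ.1, Real.pi_pos], hψI.2⟩ hn
      have hψ0 : ψ ∈ Ioo 0 (Real.pi / 2) := hψ' ▸ hw' x'
      have := radialExt_arc w x' (hw' x')
      rw [hx', radialExt_arc w x hψ0] at this
      linarith [hψ.2]

end Region

/-! ### Polar coordinates -/

section Polar

theorem measurable_smul_sph (d : ℕ) : Measurable fun y : Sph d × ℝ => y.2 • (y.1 : Euc d) :=
  (continuous_snd.smul (continuous_subtype_val.comp continuous_fst)).measurable

theorem lintegral_polar {d : ℕ} {f : Euc d → ℝ≥0∞} (hf : Measurable f) :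
    ∫⁻ a, f a = ∫⁻ p : Sph d, (∫⁻ t in Ioi (0 : ℝ), ENNReal.ofReal (t ^ d) * f (t • (p : Euc d)))
      ∂(volume : Measure (Euc d)).toSphere := by
  have hmp := (volume : Measure (Euc d)).measurePreserving_homeomorphUnitSphereProd
  have hdim : Module.finrank ℝ (Euc d) - 1 = d := by simp
  rw [hdim] at hmp
  let g : Sph d × Ioi (0 : ℝ) → ℝ≥0∞ := fun y => f (y.2.1 • (y.1 : Euc d))
  have hg : Measurable g := hf.comp ((measurable_smul_sph d).comp
    (measurable_fst.prodMk (measurable_subtype_coe.comp measurable_snd)))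
  have h1 := hmp.lintegral_comp hg
  have h2 : ∀ x : ({0}ᶜ : Set (Euc d)), g (homeomorphUnitSphereProd (Euc d) x) = f x := by
    intro x
    have hx : ‖(x : Euc d)‖ ≠ 0 := norm_ne_zero_iff.2 x.2
    simp [g, smul_smul, hx]
  simp_rw [h2] at h1
  rw [lintegral_subtype_comap (measurableSet_singleton _).compl, lintegral_prod _ hg.aemeasurable,
    restrict_compl_singleton] at h1
  rw [h1]
  refine lintegral_congr fun p => ?_
  have hgp : Measurable fun t : Ioi (0 : ℝ) => g (p, t) := hg.comp (measurable_const.prodMk measurable_id)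
  rw [Measure.volumeIoiPow, lintegral_withDensity_eq_lintegral_mul _ (by fun_prop) hgp]
  exact lintegral_subtype_comap (μ := volume) measurableSet_Ioi
    (fun t : ℝ => ENNReal.ofReal (t ^ d) * f (t • (p : Euc d)))

/-- Polar coordinates in each factor, with Tonelli's theorem collecting the two radii in one
integral over a quadrant. For nonnegative functions only measurability has to be checked. -/
theorem lintegral_biPolar {j k : ℕ} {f : Euc j × Euc k → ℝ≥0∞} (hf : Measurable f) :
    ∫⁻ a, f a ∂((volume : Measure (Euc j)).prod (volume : Measure (Euc k))) =
      ∫⁻ x : Prd j k, (∫⁻ y in Ioi (0 : ℝ) ×ˢ Ioi (0 : ℝ),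
        ENNReal.ofReal (y.1 ^ j) * (ENNReal.ofReal (y.2 ^ k) *
          f (y.1 • (x.1 : Euc j), y.2 • (x.2 : Euc k)))) ∂prdMeasure j k := by
  have hm : Measurable fun z : ((Sph j × ℝ) × (Sph k × ℝ)) => ENNReal.ofReal (z.1.2 ^ j) *
      (ENNReal.ofReal (z.2.2 ^ k) * f (z.1.2 • (z.1.1 : Euc j), z.2.2 • (z.2.1 : Euc k))) := by
    have h1 : Measurable fun z : ((Sph j × ℝ) × (Sph k × ℝ)) => z.1.2 • (z.1.1 : Euc j) :=
      (measurable_smul_sph j).comp measurable_fst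
    have h2 : Measurable fun z : ((Sph j × ℝ) × (Sph k × ℝ)) => z.2.2 • (z.2.1 : Euc k) :=
      (measurable_smul_sph k).comp measurable_snd
    have h3 := hf.comp (h1.prodMk h2)
    exact Measurable.mul (by fun_prop) (Measurable.mul (by fun_prop) h3)
  have hin : ∀ a : Euc j, ∫⁻ b, f (a, b) = ∫⁻ q : Sph k, (∫⁻ t in Ioi (0 : ℝ),
      ENNReal.ofReal (t ^ k) * f (a, t • (q : Euc k))) ∂(volume : Measure (Euc k)).toSphere :=
    fun a => lintegral_polar (hf.comp (measurable_const.prodMk measurable_id))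
  rw [lintegral_prod _ hf.aemeasurable, lintegral_polar hf.lintegral_prod_right', prdMeasure,
    lintegral_prod]
  · refine lintegral_congr fun p => ?_
    have hmp : Measurable fun z : ℝ × (Sph k × ℝ) => ENNReal.ofReal (z.1 ^ j) *
        (ENNReal.ofReal (z.2.2 ^ k) * f (z.1 • (p : Euc j), z.2.2 • (z.2.1 : Euc k))) :=
      hm.comp ((measurable_const.prodMk measurable_fst).prodMk measurable_snd)
    have hmp1 : Measurable fun z : ℝ × (Sph k × ℝ) =>
        ENNReal.ofReal (z.2.2 ^ k) * f (z.1 • (p : Euc j), z.2.2 • (z.2.1 : Euc k)) := by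
      have h1 : Measurable fun z : ℝ × (Sph k × ℝ) => z.1 • (p : Euc j) :=
        (measurable_smul_sph j).comp ((measurable_const (a := p)).prodMk measurable_fst)
      have h2 : Measurable fun z : ℝ × (Sph k × ℝ) => z.2.2 • (z.2.1 : Euc k) :=
        (measurable_smul_sph k).comp measurable_snd
      exact Measurable.mul (by fun_prop) (hf.comp (h1.prodMk h2))
    have e : ∀ s : ℝ, ENNReal.ofReal (s ^ j) * ∫⁻ b, f (s • (p : Euc j), b) =
        ∫⁻ q : Sph k, (∫⁻ t in Ioi (0 : ℝ), ENNReal.ofReal (s ^ j) * (ENNReal.ofReal (t ^ k) *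
          f (s • (p : Euc j), t • (q : Euc k)))) ∂(volume : Measure (Euc k)).toSphere := by
      intro s
      have hs : Measurable fun z : Sph k × ℝ =>
        ENNReal.ofReal (z.2 ^ k) * f (s • (p : Euc j), z.2 • (z.1 : Euc k)) :=
        hmp1.comp (measurable_const.prodMk measurable_id)
      rw [hin, ← lintegral_const_mul _ hs.lintegral_prod_right']
      refine lintegral_congr fun q => ?_
      exact (lintegral_const_mul _ (hs.comp (measurable_const.prodMk measurable_id))).symm
    simp_rw [e]
    rw [lintegral_lintegral_swap]
    · refine lintegral_congr fun q => ?_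
      rw [Measure.volume_eq_prod ℝ ℝ, ← Measure.prod_restrict, lintegral_prod]
      exact (hmp.comp (measurable_fst.prodMk (measurable_const.prodMk measurable_snd))).aemeasurable
    · have : Measurable fun z : (ℝ × Sph k) × ℝ => ENNReal.ofReal (z.1.1 ^ j) *
        (ENNReal.ofReal (z.2 ^ k) * f (z.1.1 • (p : Euc j), z.2 • (z.1.2 : Euc k))) :=
        hmp.comp ((measurable_fst.comp measurable_fst).prodMk
          ((measurable_snd.comp measurable_fst).prodMk measurable_snd))
      exact this.lintegral_prod_right'.aemeasurable
  · have : Measurable fun z : (Sph j × Sph k) × (ℝ × ℝ) => ENNReal.ofReal (z.2.1 ^ j) *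
        (ENNReal.ofReal (z.2.2 ^ k) * f (z.2.1 • (z.1.1 : Euc j), z.2.2 • (z.1.2 : Euc k))) :=
      hm.comp (((measurable_fst.comp measurable_fst).prodMk (measurable_fst.comp measurable_snd)).prodMk
        ((measurable_snd.comp measurable_fst).prodMk (measurable_snd.comp measurable_snd)))
    exact this.lintegral_prod_right'.aemeasurable

/-- The integral over a circular sector. -/
theorem lintegral_sector (j k : ℕ) {w : ℝ} (hw : w ∈ Ioo 0 (Real.pi / 2)) {P : ℝ × ℝ → Prop}
    [DecidablePred P] (hP : ∀ y : ℝ × ℝ, 0 < y.1 → 0 < y.2 →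
      (P y ↔ y.1 ^ 2 + y.2 ^ 2 < 1 ∧ y.1 < √(y.1 ^ 2 + y.2 ^ 2) * Real.sin w)) :
    ∫⁻ y in Ioi (0 : ℝ) ×ˢ Ioi (0 : ℝ), ENNReal.ofReal (y.1 ^ j) * (ENNReal.ofReal (y.2 ^ k) *
        if P y then 1 else 0) =
      (∫⁻ ρ in Ioo (0 : ℝ) 1, ENNReal.ofReal (ρ ^ (j + k + 1))) *
        ∫⁻ θ in Ioo (Real.pi / 2 - w) (Real.pi / 2),
          ENNReal.ofReal (Real.cos θ ^ j * Real.sin θ ^ k) := by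
  rw [← lintegral_indicator (measurableSet_Ioi.prod measurableSet_Ioi),
    ← lintegral_comp_polarCoord_symm, ← lintegral_indicator measurableSet_Ioo,
    ← lintegral_indicator measurableSet_Ioo, ← lintegral_prod_mul, ← Measure.volume_eq_prod,
    ← lintegral_indicator polarCoord.open_target.measurableSet]
  · refine lintegral_congr fun y => ?_
    by_cases hy : y ∈ polarCoord.target
    · have hρ : 0 < y.1 := hy.1
      have hθ : y.2 ∈ Ioo (-Real.pi) Real.pi := hy.2
      have hsq : (y.1 * Real.cos y.2) ^ 2 + (y.1 * Real.sin y.2) ^ 2 = y.1 ^ 2 := by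
        linear_combination y.1 ^ 2 * Real.sin_sq_add_cos_sq y.2
      rw [indicator_of_mem hy, polarCoord_symm_apply]
      by_cases h1 : y.2 ∈ Ioo 0 (Real.pi / 2)
      · have hc : 0 < Real.cos y.2 := Real.cos_pos_of_mem_Ioo ⟨by linarith [h1.1, h1.2], h1.2⟩
        have hs : 0 < Real.sin y.2 := Real.sin_pos_of_pos_of_lt_pi h1.1 hθ.2
        have hmem : (y.1 * Real.cos y.2, y.1 * Real.sin y.2) ∈ Ioi (0 : ℝ) ×ˢ Ioi (0 : ℝ) :=
          ⟨mul_pos hρ hc, mul_pos hρ hs⟩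
        have hPy := hP _ hmem.1 hmem.2
        simp only [hsq, Real.sqrt_sq hρ.le, mul_lt_mul_iff_right₀ hρ] at hPy
        -- The polar angle in the quadrant is measured from the axis of the first radius, so the
        -- torus angle is its complement; this explains the interval (π/2 - w, π/2).
        have hlt : Real.cos y.2 < Real.sin w ↔ Real.pi / 2 - w < y.2 := by
          rw [← Real.cos_pi_div_two_sub]
          exact Real.strictAntiOn_cos.lt_iff_gt ⟨h1.1.le, by linarith [h1.2, Real.pi_pos]⟩
            ⟨by linarith [hw.2], by linarith [hw.1, Real.pi_pos]⟩
        have hlt1 : y.1 ^ 2 < 1 ↔ y.1 < 1 := by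
          rw [sq_lt_one_iff₀ hρ.le]
        rw [hlt, hlt1] at hPy
        rw [indicator_of_mem hmem]
        by_cases h2 : y.1 < 1
        · by_cases h3 : Real.pi / 2 - w < y.2
          · rw [if_pos (hPy.2 ⟨h2, h3⟩), indicator_of_mem (s := Ioo (0 : ℝ) 1) ⟨hρ, h2⟩,
              indicator_of_mem (s := Ioo (Real.pi / 2 - w) _) ⟨h3, h1.2⟩,
              mul_one, smul_eq_mul, ← ENNReal.ofReal_mul (by positivity),
              ← ENNReal.ofReal_mul (by positivity), ← ENNReal.ofReal_mul (by positivity)]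
            congr 1
            ring
          · rw [if_neg fun h => h3 (hPy.1 h).2, indicator_of_notMem (s := Ioo (Real.pi / 2 - w) _)
              fun h => h3 h.1]
            simp
        · rw [if_neg fun h => h2 (hPy.1 h).1, indicator_of_notMem (s := Ioo (0 : ℝ) 1) fun h => h2 h.2]
          simp
      · rw [indicator_of_notMem (s := Ioo (Real.pi / 2 - w) _) fun h => h1 ⟨by linarith [h.1, hw.2], h.2⟩,
          indicator_of_notMem]
        · simp
        · rintro ⟨hc, hs⟩
          have hc' : 0 < Real.cos y.2 := (pos_iff_pos_of_mul_pos hc).1 hρ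
          have hs' : 0 < Real.sin y.2 := (pos_iff_pos_of_mul_pos hs).1 hρ
          apply h1
          have h0 : 0 < y.2 := by
            by_contra hcon
            linarith [Real.sin_nonpos_of_nonpos_of_neg_pi_le (not_lt.1 hcon) hθ.1.le]
          refine ⟨h0, ?_⟩
          by_contra hcon
          linarith [Real.cos_nonpos_of_pi_div_two_le_of_le (not_lt.1 hcon)
            (by linarith [hθ.2, Real.pi_pos])]
    · rw [indicator_of_notMem hy]
      by_cases h : y.1 ∈ Ioo (0 : ℝ) 1
      · rw [indicator_of_notMem (s := Ioo (Real.pi / 2 - w) _), mul_zero]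
        intro h'
        exact hy ⟨h.1, by linarith [h'.1, hw.2, Real.pi_pos], by linarith [h'.2, Real.pi_pos]⟩
      · rw [indicator_of_notMem h, zero_mul]
  · exact ((by fun_prop : Measurable fun ρ : ℝ => ENNReal.ofReal (ρ ^ (j + k + 1))).indicator
      measurableSet_Ioo).aemeasurable
  · exact ((by fun_prop : Measurable fun θ : ℝ => ENNReal.ofReal (Real.cos θ ^ j * Real.sin θ ^ k)).indicator
      measurableSet_Ioo).aemeasurable

end Polar

/-! ### The enclosed volume -/

section Volume

variable {j k : ℕ}

open scoped Pointwise

/-- The complement is the union of two proper linear subspaces. -/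
theorem volume_compl_offAxes (j k : ℕ) : (volume : Measure (Amb j k)) (offAxes j k)ᶜ = 0 := by
  have h : (offAxes j k)ᶜ ⊆ ((LinearMap.ker (ambFst j k).toLinearMap : Submodule ℝ (Amb j k)) : Set (Amb j k)) ∪
      ((LinearMap.ker (ambSnd j k).toLinearMap : Submodule ℝ (Amb j k)) : Set (Amb j k)) := by
    intro z hz
    by_contra hcon
    exact hz ⟨fun h => hcon (Or.inl h), fun h => hcon (Or.inr h)⟩
  obtain ⟨x⟩ : Nonempty (Prd j k) := inferInstance
  refine measure_mono_null h (measure_union_null ?_ ?_) <;> apply Measure.addHaar_submodule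
  · intro htop
    have := Submodule.eq_top_iff'.1 htop (pt x)
    exact sph_ne_zero x.1 this
  · intro htop
    have := Submodule.eq_top_iff'.1 htop (pt x)
    exact sph_ne_zero x.2 this

/-- The cone over the region enclosed by a graph. -/
def solidCone (w : Prd j k → ℝ) : Set (Amb j k) :=
  {z | z ∈ offAxes j k ∧ ‖z‖ < 1 ∧ ‖z.fst‖ < ‖z‖ * Real.sin (radialExt w z)}

theorem measurableSet_solidCone {w : Prd j k → ℝ} (hw : Continuous w) :
    MeasurableSet (solidCone w) := by
  have hfst : Continuous fun z : Amb j k => ‖z.fst‖ := (ambFst j k).continuous.norm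
  have hn : Continuous fun z : Amb j k => ‖z‖ := continuous_norm
  have h1 : ContinuousOn (fun z : Amb j k => ‖z.fst‖ - ‖z‖ * Real.sin (radialExt w z)) (offAxes j k) :=
    hfst.continuousOn.sub
      (hn.continuousOn.mul (Real.continuous_sin.comp_continuousOn (continuousOn_radialExt hw)))
  have h2 := (h1.isOpen_inter_preimage (isOpen_offAxes j k) (isOpen_Iio (a := 0))).inter
    (isOpen_lt hn (continuous_const (y := (1 : ℝ))))
  convert h2.measurableSet using 1
  ext z
  constructor
  · exact fun h => ⟨⟨h.1, sub_neg.2 h.2.2⟩, h.2.1⟩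
  · exact fun h => ⟨h.1.1, h.2, sub_neg.1 h.1.2⟩

/-- The radial extension is invariant under positive scaling, so the inequality on the sphere
becomes homogeneous on the cone. -/
theorem cone_inter_offAxes {w : Prd j k → ℝ} {U : Set (Amb j k)}
    (hU : ∀ z ∈ offAxes j k, z ∈ U ↔ ‖z.fst‖ < Real.sin (radialExt w z)) :
    (Ioo (0 : ℝ) 1 • ((fun z : Metric.sphere (0 : Amb j k) 1 => (z : Amb j k)) ''
      ((fun z : Metric.sphere (0 : Amb j k) 1 => (z : Amb j k)) ⁻¹' U))) ∩ offAxes j k =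
      solidCone w := by
  have key : ∀ (t : ℝ) (y : Amb j k), 0 < t → y ∈ offAxes j k → ‖y‖ = 1 →
      (y ∈ U ↔ ‖(t • y).fst‖ < ‖t • y‖ * Real.sin (radialExt w (t • y))) := by
    intro t y ht hy hy1
    obtain ⟨x, φ, hφ, rfl⟩ := exists_eq_arc (mem_sphere_zero_iff_norm.2 hy1) hy
    have hs : 0 < Real.sin φ := Real.sin_pos_of_pos_of_lt_pi hφ.1 (by linarith [hφ.2, Real.pi_pos])
    have hc : 0 < Real.cos φ := Real.cos_pos_of_mem_Ioo ⟨by linarith [hφ.1, Real.pi_pos], hφ.2⟩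
    have e : t • arc x φ = WithLp.toLp 2 ((t * Real.sin φ) • (x.1 : Euc j),
        (t * Real.cos φ) • (x.2 : Euc k)) := by
      refine WithLp.ofLp_injective 2 (Prod.ext ?_ ?_)
      · exact smul_smul _ _ _
      · exact smul_smul _ _ _
    have e1 : ‖(t • arc x φ).fst‖ = t * ‖(arc x φ).fst‖ := by
      rw [show (t • arc x φ).fst = t • (arc x φ).fst from rfl, norm_smul, Real.norm_eq_abs,
        abs_of_pos ht]
    rw [hU _ hy, radialExt_arc w x hφ, e1, norm_smul, hy1, mul_one, Real.norm_eq_abs, abs_of_pos ht,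
      e, radialExt_toLp_smul w x (mul_pos ht hs) (mul_pos ht hc), mul_lt_mul_iff_right₀ ht]
  ext z
  constructor
  · rintro ⟨⟨t, ht, _, ⟨y, hy, rfl⟩, rfl⟩, hz⟩
    have hy1 : ‖(y : Amb j k)‖ = 1 := norm_eq_of_mem_sphere y
    have hyo : (y : Amb j k) ∈ offAxes j k :=
      ⟨(smul_ne_zero_iff.1 hz.1).2, (smul_ne_zero_iff.1 hz.2).2⟩
    refine ⟨hz, ?_, (key t y ht.1 hyo hy1).1 hy⟩
    change ‖t • (y : Amb j k)‖ < 1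
    rw [norm_smul, hy1, mul_one, Real.norm_eq_abs, abs_of_pos ht.1]
    exact ht.2
  · rintro ⟨hz, h1, h2⟩
    have hz0 : z ≠ 0 := by
      rintro rfl
      exact hz.1 rfl
    have hn : 0 < ‖z‖ := norm_pos_iff.2 hz0
    have hy1 : ‖‖z‖⁻¹ • z‖ = 1 := by
      rw [norm_smul, norm_inv, norm_norm, inv_mul_cancel₀ hn.ne']
    have hyo : ‖z‖⁻¹ • z ∈ offAxes j k :=
      ⟨smul_ne_zero (inv_ne_zero hn.ne') hz.1, smul_ne_zero (inv_ne_zero hn.ne') hz.2⟩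
    have hsm : ‖z‖ • (‖z‖⁻¹ • z) = z := smul_inv_smul₀ hn.ne' z
    refine ⟨⟨‖z‖, ⟨hn, h1⟩, ‖z‖⁻¹ • z, ⟨⟨‖z‖⁻¹ • z, mem_sphere_zero_iff_norm.2 hy1⟩, ?_, rfl⟩, hsm⟩, hz⟩
    refine (key ‖z‖ _ hn hyo hy1).2 ?_
    rw [hsm]
    exact h2

/-- The primitive of `sin^j cos^k` that vanishes at `0`. -/
def capVol (j k : ℕ) (w : ℝ) : ℝ :=
  ∫ θ in (Real.pi / 2 - w)..(Real.pi / 2), Real.cos θ ^ j * Real.sin θ ^ k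

theorem hasDerivAt_capVol (j k : ℕ) (w : ℝ) :
    HasDerivAt (capVol j k) (Real.sin w ^ j * Real.cos w ^ k) w := by
  have hcont : Continuous fun θ : ℝ => Real.cos θ ^ j * Real.sin θ ^ k := by fun_prop
  have h := intervalIntegral.integral_hasDerivAt_left (hcont.intervalIntegrable (Real.pi / 2 - w)
    (Real.pi / 2)) hcont.stronglyMeasurable.stronglyMeasurableAtFilter hcont.continuousAt
  have := h.comp w ((hasDerivAt_id w).const_sub (Real.pi / 2))
  simp only [Real.cos_pi_div_two_sub, Real.sin_pi_div_two_sub, mul_neg, mul_one, neg_neg] at this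
  exact this

theorem contDiff_capVol (j k : ℕ) : ContDiff ℝ 2 (capVol j k) := by
  have hd : deriv (capVol j k) = fun w => Real.sin w ^ j * Real.cos w ^ k :=
    funext fun w => (hasDerivAt_capVol j k w).deriv
  rw [show (2 : WithTop ℕ∞) = 1 + 1 by norm_num, contDiff_succ_iff_deriv]
  refine ⟨fun w => (hasDerivAt_capVol j k w).differentiableAt, by simp, ?_⟩
  rw [hd]
  exact (Real.contDiff_sin.pow j).mul (Real.contDiff_cos.pow k)

theorem lintegral_sector_angle {w : ℝ} (hw : w ∈ Ioo 0 (Real.pi / 2)) :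
    ∫⁻ θ in Ioo (Real.pi / 2 - w) (Real.pi / 2), ENNReal.ofReal (Real.cos θ ^ j * Real.sin θ ^ k) =
      ENNReal.ofReal (capVol j k w) := by
  have hcont : Continuous fun θ : ℝ => Real.cos θ ^ j * Real.sin θ ^ k := by fun_prop
  rw [capVol, intervalIntegral.integral_of_le (by linarith [hw.1]), integral_Ioc_eq_integral_Ioo,
    ofReal_integral_eq_lintegral_ofReal]
  · exact (hcont.integrableOn_Icc).mono_set Ioo_subset_Icc_self
  · filter_upwards [ae_restrict_mem measurableSet_Ioo] with θ hθ
    have h1 : 0 ≤ Real.cos θ := Real.cos_nonneg_of_mem_Icc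
      ⟨by linarith [hθ.1, hw.2, Real.pi_pos], hθ.2.le⟩
    have h2 : 0 ≤ Real.sin θ := Real.sin_nonneg_of_nonneg_of_le_pi
      (by linarith [hθ.1, hw.2]) (by linarith [hθ.2, Real.pi_pos])
    positivity

theorem capVol_nonneg {w : ℝ} (hw : w ∈ Ioo 0 (Real.pi / 2)) : 0 ≤ capVol j k w := by
  rw [capVol]
  refine intervalIntegral.integral_nonneg (by linarith [hw.1]) fun θ hθ => ?_
  have h1 : 0 ≤ Real.cos θ := Real.cos_nonneg_of_mem_Icc
    ⟨by linarith [hθ.1, hw.2, Real.pi_pos], hθ.2⟩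
  have h2 : 0 ≤ Real.sin θ := Real.sin_nonneg_of_nonneg_of_le_pi
    (by linarith [hθ.1, hw.2]) (by linarith [hθ.2, Real.pi_pos])
  positivity

theorem lintegral_pow_Ioo (n : ℕ) :
    ∫⁻ ρ in Ioo (0 : ℝ) 1, ENNReal.ofReal (ρ ^ n) = ENNReal.ofReal ((n + 1 : ℝ)⁻¹) := by
  have hcont : Continuous fun ρ : ℝ => ρ ^ n := by fun_prop
  rw [← ofReal_integral_eq_lintegral_ofReal, ← integral_Ioc_eq_integral_Ioo,
    ← intervalIntegral.integral_of_le zero_le_one, integral_pow]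
  · simp
  · exact (hcont.integrableOn_Icc).mono_set Ioo_subset_Icc_self
  · filter_upwards [ae_restrict_mem measurableSet_Ioo] with ρ hρ
    exact pow_nonneg hρ.1.le _

/-- For fixed (p, q) the two radii range over a circular sector, where the integral factors into
∫ρ^(j+k+1) and the angular integral `capVol`. -/
theorem volume_solidCone {w : Prd j k → ℝ} (hw : Continuous w)
    (hw' : ∀ x, w x ∈ Ioo 0 (Real.pi / 2)) :
    (volume : Measure (Amb j k)) (solidCone w) = ENNReal.ofReal (((j + k + 1 : ℕ) + 1 : ℝ)⁻¹) *
      ∫⁻ x, ENNReal.ofReal (capVol j k (w x)) ∂prdMeasure j k := by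
  classical
  have hmeas := measurableSet_solidCone hw
  have hpre := (WithLp.volume_preserving_toLp (Euc j) (Euc k)).measure_preimage
    hmeas.nullMeasurableSet
  have hm : MeasurableSet ((WithLp.toLp 2 : Euc j × Euc k → Amb j k) ⁻¹' solidCone w) :=
    (WithLp.volume_preserving_toLp (Euc j) (Euc k)).measurable hmeas
  rw [← hpre, ← lintegral_indicator_one hm, Measure.volume_eq_prod,
    lintegral_biPolar (measurable_one.indicator hm), ← lintegral_const_mul]
  · refine lintegral_congr fun x => ?_
    rw [← lintegral_sector_angle (hw' x), ← lintegral_pow_Ioo,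
      ← lintegral_sector (P := fun y => (WithLp.toLp 2 (y.1 • (x.1 : Euc j), y.2 • (x.2 : Euc k)) :
        Amb j k) ∈ solidCone w) j k (hw' x)]
    · refine lintegral_congr fun y => ?_
      simp only [indicator_apply, mem_preimage, Pi.one_apply]
    · intro y h1 h2
      have hn : ‖(WithLp.toLp 2 (y.1 • (x.1 : Euc j), y.2 • (x.2 : Euc k)) : Amb j k)‖ =
          √(y.1 ^ 2 + y.2 ^ 2) := by
        rw [← Real.sqrt_sq (norm_nonneg _), norm_sq_amb]
        change √(‖y.1 • (x.1 : Euc j)‖ ^ 2 + ‖y.2 • (x.2 : Euc k)‖ ^ 2) = _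
        rw [norm_smul_sph, norm_smul_sph, sq_abs, sq_abs]
      have hf : ‖(WithLp.toLp 2 (y.1 • (x.1 : Euc j), y.2 • (x.2 : Euc k)) : Amb j k).fst‖ = y.1 :=
        (norm_smul_sph _ _).trans (abs_of_pos h1)
      have hlt : √(y.1 ^ 2 + y.2 ^ 2) < 1 ↔ y.1 ^ 2 + y.2 ^ 2 < 1 := by
        rw [Real.sqrt_lt' one_pos, one_pow]
      change _ ∧ _ ∧ _ ↔ _
      rw [hn, hf, radialExt_toLp_smul w x h1 h2, hlt]
      exact and_iff_right ⟨smul_ne_zero h1.ne' (sph_ne_zero _), smul_ne_zero h2.ne' (sph_ne_zero _)⟩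
  · exact ENNReal.measurable_ofReal.comp ((contDiff_capVol j k).continuous.comp hw).measurable

/-- The dimension j + k + 2 in the definition of the spherical measure cancels the radial integral
1/(j + k + 2). -/
theorem enclosedVolume_graphMap {w : Prd j k → ℝ} (hw : Continuous w)
    (hw' : ∀ x, w x ∈ Ioo 0 (Real.pi / 2)) :
    enclosedVolume (graphMap w) = ∫ x, capVol j k (w x) ∂prdMeasure j k := by
  obtain ⟨U, hU, hreg, hUoff⟩ := region_graphMap hw hw'
  have hs : (fun z : Metric.sphere (0 : Amb j k) 1 => (z : Amb j k)) ⁻¹' region (graphMap w) =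
      (fun z : Metric.sphere (0 : Amb j k) 1 => (z : Amb j k)) ⁻¹' U := by
    rw [hreg]
    ext z
    exact ⟨fun h => h.2, fun h => ⟨z.2, h⟩⟩
  have hdim : Module.finrank ℝ (Amb j k) = j + k + 1 + 1 := by
    rw [← (toAmb j k).toLinearEquiv.finrank_eq]
    simp; ring
  have hcont : Continuous fun x => capVol j k (w x) := (contDiff_capVol j k).continuous.comp hw
  rw [enclosedVolume, hs, Measure.toSphere_apply' _ (hU.preimage continuous_subtype_val).measurableSet,
    ← measure_inter_conull (volume_compl_offAxes j k)]
  refine (congrArg (fun s => ((Module.finrank ℝ (Amb j k) : ℝ≥0∞) * volume s).toReal)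
    (cone_inter_offAxes hUoff)).trans ?_
  rw [volume_solidCone hw hw', hdim, ← mul_assoc, ← ENNReal.ofReal_natCast,
    ← ENNReal.ofReal_mul (by positivity), Nat.cast_succ, mul_inv_cancel₀ (by positivity),
    ENNReal.ofReal_one, one_mul, ← ofReal_integral_eq_lintegral_ofReal
      (integrable_of_continuous _ hcont) (Filter.Eventually.of_forall fun x => capVol_nonneg (hw' x)),
    ENNReal.toReal_ofReal (integral_nonneg fun x => capVol_nonneg (hw' x))]

end Volume

/-! ### The density of the Lagrangian -/

section Density

/-- The function `sin^j cos^k`. -/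
def torusArea (j k : ℕ) (w : ℝ) : ℝ := Real.sin w ^ j * Real.cos w ^ k

/-- The logarithmic derivative of `sin^j cos^k`. -/
def logSlope (j k : ℕ) (w : ℝ) : ℝ :=
  j * (Real.cos w / Real.sin w) - k * (Real.sin w / Real.cos w)

theorem hasDerivAt_torusArea (j k : ℕ) {w : ℝ} (hs : Real.sin w ≠ 0) (hc : Real.cos w ≠ 0) :
    HasDerivAt (torusArea j k) (torusArea j k w * logSlope j k w) w := by
  have h := ((Real.hasDerivAt_sin w).pow j).mul ((Real.hasDerivAt_cos w).pow k)
  refine h.congr_deriv ?_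
  rw [torusArea, logSlope]
  -- Exponent 0 is separated because the power rule involves truncated j - 1 and k - 1.
  rcases j with _ | j <;> rcases k with _ | k <;> simp <;> field_simp <;> ring

theorem hasDerivAt_logSlope (j k : ℕ) {w : ℝ} (hs : Real.sin w ≠ 0) (hc : Real.cos w ≠ 0) :
    HasDerivAt (logSlope j k) (-(j / Real.sin w ^ 2 + k / Real.cos w ^ 2)) w := by
  have h := (((Real.hasDerivAt_cos w).div (Real.hasDerivAt_sin w) hs).const_mul (j : ℝ)).sub
    (((Real.hasDerivAt_sin w).div (Real.hasDerivAt_cos w) hc).const_mul (k : ℝ))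
  refine h.congr_deriv ?_
  have h1 := Real.sin_sq_add_cos_sq w
  field_simp
  linear_combination (-(j * Real.cos w ^ 2) - k * Real.sin w ^ 2) * h1

/-- The squared ratio of the area densities of a graph and of the parallel torus through its
point. -/
def stretch (p : ℝ × ℝ × ℝ) : ℝ := 1 + (p.2.1 / Real.sin p.1 ^ 2 + p.2.2 / Real.cos p.1 ^ 2)

/-- The differential of `stretch`. -/
def stretchDiff (p q : ℝ × ℝ × ℝ) : ℝ :=
  q.2.1 / Real.sin p.1 ^ 2 + q.2.2 / Real.cos p.1 ^ 2 +
    q.1 * (2 * p.2.2 * Real.sin p.1 / Real.cos p.1 ^ 3 - 2 * p.2.1 * Real.cos p.1 / Real.sin p.1 ^ 3)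

/-- The density of the Lagrangian in terms of the graph function and its gradient. -/
def lagDensity (j k : ℕ) (lam : ℝ) (p : ℝ × ℝ × ℝ) : ℝ :=
  torusArea j k p.1 * √(stretch p) + lam * capVol j k p.1

/-- The differential of `lagDensity`. -/
def lagDiff (j k : ℕ) (lam : ℝ) (p q : ℝ × ℝ × ℝ) : ℝ :=
  torusArea j k p.1 * (q.1 * logSlope j k p.1 * √(stretch p) +
    stretchDiff p q / (2 * √(stretch p)) + lam * q.1)

/-- The domain of `lagDensity`. -/
def lagDomain : Set (ℝ × ℝ × ℝ) :=
  {p | (0 < Real.sin p.1 ∧ 0 < Real.cos p.1) ∧ 0 < stretch p}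

theorem contDiffOn_stretch {n : WithTop ℕ∞} :
    ContDiffOn ℝ n stretch {p : ℝ × ℝ × ℝ | 0 < Real.sin p.1 ∧ 0 < Real.cos p.1} := by
  have h1 : ContDiff ℝ n fun p : ℝ × ℝ × ℝ => Real.sin p.1 ^ 2 := (Real.contDiff_sin.comp contDiff_fst).pow 2
  have h2 : ContDiff ℝ n fun p : ℝ × ℝ × ℝ => Real.cos p.1 ^ 2 := (Real.contDiff_cos.comp contDiff_fst).pow 2
  have h3 : ContDiff ℝ n fun p : ℝ × ℝ × ℝ => p.2.1 := contDiff_fst.comp contDiff_snd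
  have h4 : ContDiff ℝ n fun p : ℝ × ℝ × ℝ => p.2.2 := contDiff_snd.comp contDiff_snd
  exact contDiffOn_const.add ((h3.contDiffOn.div h1.contDiffOn fun p hp => (pow_pos hp.1 2).ne').add
    (h4.contDiffOn.div h2.contDiffOn fun p hp => (pow_pos hp.2 2).ne'))

theorem isOpen_lagDomain : IsOpen lagDomain := by
  have h1 : Continuous fun p : ℝ × ℝ × ℝ => Real.sin p.1 := by fun_prop
  have h2 : Continuous fun p : ℝ × ℝ × ℝ => Real.cos p.1 := by fun_prop
  exact (contDiffOn_stretch (n := 0)).continuousOn.isOpen_inter_preimage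
    ((isOpen_lt continuous_const h1).inter (isOpen_lt continuous_const h2)) isOpen_Ioi

theorem contDiffOn_sqrt_stretch {n : WithTop ℕ∞} :
    ContDiffOn ℝ n (fun p => √(stretch p)) lagDomain :=
  (contDiffOn_stretch.mono fun _ hp => hp.1).sqrt fun _ hp => hp.2.ne'

theorem contDiff_torusArea (j k : ℕ) {n : WithTop ℕ∞} : ContDiff ℝ n (torusArea j k) :=
  (Real.contDiff_sin.pow j).mul (Real.contDiff_cos.pow k)

theorem contDiffOn_lagDensity (j k : ℕ) (lam : ℝ) : ContDiffOn ℝ 1 (lagDensity j k lam) lagDomain :=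
  (((contDiff_torusArea j k).comp contDiff_fst).contDiffOn.mul contDiffOn_sqrt_stretch).add
    ((((contDiff_capVol j k).of_le (by norm_num)).comp contDiff_fst).const_smul lam).contDiffOn

/-- Joint smoothness in the point and the direction allows the second differentiation under the
integral sign. -/
theorem contDiffOn_lagDiff (j k : ℕ) (lam : ℝ) :
    ContDiffOn ℝ 1 (fun z : (ℝ × ℝ × ℝ) × (ℝ × ℝ × ℝ) => lagDiff j k lam z.1 z.2)
      (Prod.fst ⁻¹' lagDomain) := by
  set S : Set ((ℝ × ℝ × ℝ) × (ℝ × ℝ × ℝ)) := Prod.fst ⁻¹' lagDomain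
  have hG : ContDiffOn ℝ 1 (fun z : (ℝ × ℝ × ℝ) × (ℝ × ℝ × ℝ) => torusArea j k z.1.1) S :=
    ((contDiff_torusArea j k).comp (contDiff_fst.comp contDiff_fst)).contDiffOn
  have hq : ContDiffOn ℝ 1 (fun z : (ℝ × ℝ × ℝ) × (ℝ × ℝ × ℝ) => z.2.1) S :=
    (contDiff_fst.comp contDiff_snd).contDiffOn
  have hq1 : ContDiffOn ℝ 1 (fun z : (ℝ × ℝ × ℝ) × (ℝ × ℝ × ℝ) => z.2.2.1) S :=
    (contDiff_fst.comp (contDiff_snd.comp contDiff_snd)).contDiffOn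
  have hq2 : ContDiffOn ℝ 1 (fun z : (ℝ × ℝ × ℝ) × (ℝ × ℝ × ℝ) => z.2.2.2) S :=
    (contDiff_snd.comp (contDiff_snd.comp contDiff_snd)).contDiffOn
  have hp1 : ContDiffOn ℝ 1 (fun z : (ℝ × ℝ × ℝ) × (ℝ × ℝ × ℝ) => z.1.2.1) S :=
    (contDiff_fst.comp (contDiff_snd.comp contDiff_fst)).contDiffOn
  have hp2 : ContDiffOn ℝ 1 (fun z : (ℝ × ℝ × ℝ) × (ℝ × ℝ × ℝ) => z.1.2.2) S :=
    (contDiff_snd.comp (contDiff_snd.comp contDiff_fst)).contDiffOn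
  have hs : ContDiffOn ℝ 1 (fun z : (ℝ × ℝ × ℝ) × (ℝ × ℝ × ℝ) => Real.sin z.1.1) S :=
    (Real.contDiff_sin.comp (contDiff_fst.comp contDiff_fst)).contDiffOn
  have hc : ContDiffOn ℝ 1 (fun z : (ℝ × ℝ × ℝ) × (ℝ × ℝ × ℝ) => Real.cos z.1.1) S :=
    (Real.contDiff_cos.comp (contDiff_fst.comp contDiff_fst)).contDiffOn
  have hs0 : ∀ z ∈ S, Real.sin z.1.1 ≠ 0 := fun z hz => hz.1.1.ne'
  have hc0 : ∀ z ∈ S, Real.cos z.1.1 ≠ 0 := fun z hz => hz.1.2.ne'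
  have hE : ContDiffOn ℝ 1 (fun z : (ℝ × ℝ × ℝ) × (ℝ × ℝ × ℝ) => √(stretch z.1)) S :=
    contDiffOn_sqrt_stretch.comp contDiff_fst.contDiffOn fun z hz => hz
  have hE0 : ∀ z ∈ S, 2 * √(stretch z.1) ≠ 0 := fun z hz =>
    mul_ne_zero two_ne_zero (Real.sqrt_pos.2 hz.2).ne'
  have hl : ContDiffOn ℝ 1 (fun z : (ℝ × ℝ × ℝ) × (ℝ × ℝ × ℝ) => logSlope j k z.1.1) S :=
    (contDiffOn_const.mul (hc.div hs hs0)).sub (contDiffOn_const.mul (hs.div hc hc0))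
  have hD : ContDiffOn ℝ 1 (fun z : (ℝ × ℝ × ℝ) × (ℝ × ℝ × ℝ) => stretchDiff z.1 z.2) S :=
    ((hq1.div (hs.pow 2) fun z hz => pow_ne_zero 2 (hs0 z hz)).add
      (hq2.div (hc.pow 2) fun z hz => pow_ne_zero 2 (hc0 z hz))).add
    (hq.mul ((((contDiffOn_const.mul hp2).mul hs).div (hc.pow 3) fun z hz => pow_ne_zero 3 (hc0 z hz)).sub
      (((contDiffOn_const.mul hp1).mul hc).div (hs.pow 3) fun z hz => pow_ne_zero 3 (hs0 z hz))))
  exact hG.mul ((((hq.mul hl).mul hE).add (hD.div (contDiffOn_const.mul hE) hE0)).add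
    (contDiffOn_const.mul hq))

theorem hasDerivAt_lagDensity (j k : ℕ) (lam : ℝ) {w n m : ℝ → ℝ} {w' n' m' t : ℝ}
    (hw : HasDerivAt w w' t) (hn : HasDerivAt n n' t) (hm : HasDerivAt m m' t)
    (hp : (w t, n t, m t) ∈ lagDomain) :
    HasDerivAt (fun t => lagDensity j k lam (w t, n t, m t))
      (lagDiff j k lam (w t, n t, m t) (w', n', m')) t := by
  have hs : Real.sin (w t) ≠ 0 := hp.1.1.ne'
  have hc : Real.cos (w t) ≠ 0 := hp.1.2.ne'
  have hE := hp.2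
  have h1 : HasDerivAt (fun t => stretch (w t, n t, m t))
      (stretchDiff (w t, n t, m t) (w', n', m')) t := by
    have h := ((hn.div (hw.sin.pow 2) (pow_ne_zero 2 hs)).add
      (hm.div (hw.cos.pow 2) (pow_ne_zero 2 hc))).const_add 1
    refine h.congr_deriv ?_
    simp only [stretchDiff]
    field_simp
    simp
    ring
  have h2 := (((hasDerivAt_torusArea j k hs hc).comp t hw).mul (h1.sqrt hE.ne')).add
    (((hasDerivAt_capVol j k (w t)).comp t hw).const_mul lam)
  refine h2.congr_deriv ?_
  simp only [lagDiff, Function.comp_apply, torusArea]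
  ring

/-- Continuity of h is enough, so remainder terms with a factor s need not be differentiated. -/
theorem hasDerivAt_mul_self_zero {h : ℝ → ℝ} (hh : ContinuousAt h 0) :
    HasDerivAt (fun s => s * h s) (h 0) 0 := by
  rw [hasDerivAt_iff_tendsto_slope]
  refine (hh.tendsto.mono_left nhdsWithin_le_nhds).congr' ?_
  filter_upwards [self_mem_nhdsWithin] with s hs
  have hs' : s ≠ 0 := hs
  simp [slope_def_field, hs']

/-- On the line s ↦ s f the squared gradients are of order s². Hence the differential is G·g·(ℓ + λ)
at θ + s f, plus s·h(s) with h continuous; the first part contributes the terms in f g, and h(0)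
contributes the Dirichlet terms. -/
theorem hasDerivAt_lagDiff (j k : ℕ) (lam : ℝ) {θ : ℝ} (hs : 0 < Real.sin θ) (hc : 0 < Real.cos θ)
    (f g a b c d : ℝ) :
    HasDerivAt (fun s => lagDiff j k lam (θ + s * f, s ^ 2 * a, s ^ 2 * b) (g, 2 * s * c, 2 * s * d))
      (torusArea j k θ * ((logSlope j k θ * (logSlope j k θ + lam) -
        (j / Real.sin θ ^ 2 + k / Real.cos θ ^ 2)) * (f * g) +
        (c / Real.sin θ ^ 2 + d / Real.cos θ ^ 2))) 0 := by
  set E : ℝ → ℝ := fun s => a / Real.sin (θ + s * f) ^ 2 + b / Real.cos (θ + s * f) ^ 2 with hE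
  set R : ℝ → ℝ := fun s => √(1 + s ^ 2 * E s) with hR
  set T : ℝ → ℝ := fun s => c / Real.sin (θ + s * f) ^ 2 + d / Real.cos (θ + s * f) ^ 2 +
    s * g * (b * Real.sin (θ + s * f) / Real.cos (θ + s * f) ^ 3 -
      a * Real.cos (θ + s * f) / Real.sin (θ + s * f) ^ 3) with hT
  set h : ℝ → ℝ := fun s => torusArea j k (θ + s * f) *
    (g * logSlope j k (θ + s * f) * (s * E s / (R s + 1)) + T s / R s) with hh
  have hsin : ContinuousAt (fun s : ℝ => Real.sin (θ + s * f)) 0 := by fun_prop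
  have hcos : ContinuousAt (fun s : ℝ => Real.cos (θ + s * f)) 0 := by fun_prop
  have hs0 : Real.sin (θ + 0 * f) ≠ 0 := by simpa using hs.ne'
  have hc0 : Real.cos (θ + 0 * f) ≠ 0 := by simpa using hc.ne'
  have hEc : ContinuousAt E 0 := (continuousAt_const.div (hsin.pow 2) (pow_ne_zero 2 hs0)).add
    (continuousAt_const.div (hcos.pow 2) (pow_ne_zero 2 hc0))
  have hid : ContinuousAt (fun s : ℝ => s) 0 := continuousAt_id
  have hRc : ContinuousAt R 0 := (continuousAt_const.add ((hid.pow 2).mul hEc)).sqrt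
  have hR0 : R 0 = 1 := by simp [R]
  have hTc : ContinuousAt T 0 :=
    ((continuousAt_const.div (hsin.pow 2) (pow_ne_zero 2 hs0)).add
      (continuousAt_const.div (hcos.pow 2) (pow_ne_zero 2 hc0))).add
    ((hid.mul continuousAt_const).mul
      (((continuousAt_const.mul hsin).div (hcos.pow 3) (pow_ne_zero 3 hc0)).sub
        ((continuousAt_const.mul hcos).div (hsin.pow 3) (pow_ne_zero 3 hs0))))
  have hlc : ContinuousAt (fun s : ℝ => logSlope j k (θ + s * f)) 0 :=
    (continuousAt_const.mul (hcos.div hsin hs0)).sub (continuousAt_const.mul (hsin.div hcos hc0))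
  have hGc : ContinuousAt (fun s : ℝ => torusArea j k (θ + s * f)) 0 := (hsin.pow j).mul (hcos.pow k)
  have hhc : ContinuousAt h 0 := hGc.mul (((continuousAt_const.mul hlc).mul
    ((hid.mul hEc).div (hRc.add continuousAt_const) (by rw [Pi.add_apply, hR0]; norm_num))).add
    (hTc.div hRc (by rw [hR0]; norm_num)))
  have hw : HasDerivAt (fun s : ℝ => θ + s * f) f 0 := by
    simpa using ((hasDerivAt_id (0 : ℝ)).mul_const f).const_add θ
  have h1 := ((hasDerivAt_torusArea j k hs0 hc0).comp (0 : ℝ) hw).mul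
    ((((hasDerivAt_logSlope j k hs0 hc0).comp (0 : ℝ) hw).add_const lam).const_mul g)
  have h2 := h1.add (hasDerivAt_mul_self_zero hhc)
  have hpos : ∀ᶠ s in nhds (0 : ℝ), 0 < 1 + s ^ 2 * E s :=
    (continuousAt_const.add ((hid.pow 2).mul hEc)).tendsto.eventually_const_lt (by simp)
  have hps : ∀ᶠ s in nhds (0 : ℝ), 0 < Real.sin (θ + s * f) := hsin.tendsto.eventually_const_lt (by simpa using hs)
  have hpc : ∀ᶠ s in nhds (0 : ℝ), 0 < Real.cos (θ + s * f) := hcos.tendsto.eventually_const_lt (by simpa using hc)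
  refine (h2.congr_of_eventuallyEq ?_).congr_deriv ?_
  · filter_upwards [hpos, hps, hpc] with s h0 hs1 hc1
    have hst : stretch (θ + s * f, s ^ 2 * a, s ^ 2 * b) = 1 + s ^ 2 * E s := by
      simp only [stretch, hE]; ring
    have hsd : stretchDiff (θ + s * f, s ^ 2 * a, s ^ 2 * b) (g, 2 * s * c, 2 * s * d) =
        2 * s * T s := by
      simp only [stretchDiff, hT]; ring
    have hRp : 0 < R s := Real.sqrt_pos.2 h0
    have hRsq : R s ^ 2 = 1 + s ^ 2 * E s := Real.sq_sqrt h0.le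
    have hR1 : R s + 1 ≠ 0 := by positivity
    -- The form R - 1 = s²E/(R + 1) of the square root exhibits the factor s.
    have hRe : R s = 1 + s * (s * E s / (R s + 1)) := by
      field_simp
      linear_combination hRsq
    simp only [lagDiff, hst, hsd, Pi.add_apply, Pi.mul_apply, Function.comp_apply, hh]
    rw [show √(1 + s ^ 2 * E s) = R s from rfl]
    have e1 : 2 * s * T s / (2 * R s) = s * (T s / R s) := by
      field_simp
    rw [e1]
    linear_combination (torusArea j k (θ + s * f) * g * logSlope j k (θ + s * f)) * hRe
  · simp only [hh, hR0, hT, hE, Function.comp_apply, zero_mul, add_zero, zero_div, mul_zero, zero_add,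
      div_one]
    ring

end Density

/-! ### The first and second variation -/

section Variation

variable {j k : ℕ}

theorem hasDerivAt_integral_of_contDiffOn' {X : Type*} [TopologicalSpace X] [CompactSpace X]
    [MeasurableSpace X] [BorelSpace X] (μ : Measure X) [IsFiniteMeasure μ]
    {E : Type*} [NormedAddCommGroup E] [NormedSpace ℝ E]
    {K : ℝ × E → ℝ} {O : Set (ℝ × E)} (hO : IsOpen O) (hK : ContDiffOn ℝ 1 K O)
    {c : X → E} (hc : Continuous c) {t₀ : ℝ} (h : ∀ x, (t₀, c x) ∈ O) {D : X → ℝ}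
    (hD : ∀ x, HasDerivAt (fun t => K (t, c x)) (D x) t₀) :
    HasDerivAt (fun t => ∫ x, K (t, c x) ∂μ) (∫ x, D x ∂μ) t₀ := by
  refine (hasDerivAt_integral_of_contDiffOn μ hO hK hc h).congr_deriv ?_
  refine integral_congr_ae (Filter.Eventually.of_forall fun x => ?_)
  have hd : HasFDerivAt K (fderiv ℝ K (t₀, c x)) (t₀, c x) :=
    ((hK.differentiableOn one_ne_zero).differentiableAt (hO.mem_nhds (h x))).hasFDerivAt
  exact (hd.comp_hasDerivAt t₀ ((hasDerivAt_id t₀).prodMk (hasDerivAt_const t₀ (c x)))).unique (hD x)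

theorem isC1_const (c : ℝ) : IsC1 (fun _ : Prd j k => c) :=
  ContDiffOn.congr (f := fun _ => c) contDiffOn_const fun _ hz => radialExt_of_mem _ hz

theorem grad_const (c : ℝ) (x : Prd j k) : grad (fun _ : Prd j k => c) x = 0 := by
  have hev : radialExt (fun _ : Prd j k => c) =ᶠ[nhds (pt x)] fun _ => c :=
    Filter.eventually_of_mem ((isOpen_offAxes j k).mem_nhds (pt_mem_offAxes x))
      fun z hz => radialExt_of_mem _ hz
  rw [grad, hev.fderiv_eq, fderiv_const_apply, map_zero]

theorem IsC1.const_add {u : Prd j k → ℝ} (hu : IsC1 u) (c : ℝ) : IsC1 fun x => c + u x :=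
  (isC1_const c).add hu

theorem grad_const_add {u : Prd j k → ℝ} (hu : IsC1 u) (c : ℝ) (x : Prd j k) :
    grad (fun x => c + u x) x = grad u x :=
  (grad_add (isC1_const c) hu x).trans (by rw [grad_const, zero_add])

theorem dirFst_combination {f g : Prd j k → ℝ} (hf : IsC1 f) (hg : IsC1 g) (s t : ℝ) (x : Prd j k) :
    dirFst (s • f + t • g) (s • f + t • g) x =
      s ^ 2 * dirFst f f x + 2 * s * t * dirFst f g x + t ^ 2 * dirFst g g x := by
  have e : (grad (s • f + t • g) x).fst = s • (grad f x).fst + t • (grad g x).fst := by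
    rw [grad_add (hf.smul s) (hg.smul t), grad_smul s hf, grad_smul t hg]; rfl
  simp only [dirFst, e, inner_add_left, inner_add_right, real_inner_smul_left, real_inner_smul_right]
  rw [real_inner_comm (grad f x).fst (grad g x).fst]
  ring

theorem dirSnd_combination {f g : Prd j k → ℝ} (hf : IsC1 f) (hg : IsC1 g) (s t : ℝ) (x : Prd j k) :
    dirSnd (s • f + t • g) (s • f + t • g) x =
      s ^ 2 * dirSnd f f x + 2 * s * t * dirSnd f g x + t ^ 2 * dirSnd g g x := by
  have e : (grad (s • f + t • g) x).snd = s • (grad f x).snd + t • (grad g x).snd := by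
    rw [grad_add (hf.smul s) (hg.smul t), grad_smul s hf, grad_smul t hg]; rfl
  simp only [dirSnd, e, inner_add_left, inner_add_right, real_inner_smul_left, real_inner_smul_right]
  rw [real_inner_comm (grad f x).snd (grad g x).snd]
  ring

theorem sin_cos_pos {w : ℝ} (hw : w ∈ Ioo 0 (Real.pi / 2)) : 0 < Real.sin w ∧ 0 < Real.cos w :=
  ⟨Real.sin_pos_of_pos_of_lt_pi hw.1 (by linarith [hw.2, Real.pi_pos]),
    Real.cos_pos_of_mem_Ioo ⟨by linarith [hw.1, Real.pi_pos], hw.2⟩⟩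

theorem dirFst_self_nonneg (u : Prd j k → ℝ) (x : Prd j k) : 0 ≤ dirFst u u x := real_inner_self_nonneg

theorem dirSnd_self_nonneg (u : Prd j k → ℝ) (x : Prd j k) : 0 ≤ dirSnd u u x := real_inner_self_nonneg

theorem mem_lagDomain {w n m : ℝ} (hw : w ∈ Ioo 0 (Real.pi / 2)) (hn : 0 ≤ n) (hm : 0 ≤ m) :
    (w, n, m) ∈ lagDomain :=
  ⟨sin_cos_pos hw, add_pos_of_pos_of_nonneg one_pos (by dsimp only; positivity)⟩

theorem area_graphMap {w : Prd j k → ℝ} (hw : IsC1 w) (hw' : ∀ x, w x ∈ Ioo 0 (Real.pi / 2)) :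
    area (graphMap w) = ∫ x, torusArea j k (w x) * √(stretch (w x, dirFst w w x, dirSnd w w x))
      ∂prdMeasure j k := by
  refine integral_congr_ae (Filter.Eventually.of_forall fun x => ?_)
  obtain ⟨hs, hc⟩ := sin_cos_pos (hw' x)
  have e : (Real.sin (w x) ^ 2) ^ j * (Real.cos (w x) ^ 2) ^ k = torusArea j k (w x) ^ 2 := by
    rw [torusArea]; ring
  have h0 : 0 ≤ torusArea j k (w x) := by rw [torusArea]; positivity
  change √(gram (graphMap w) x).det = _
  rw [det_gram_graphMap hw x hs.ne' hc.ne', e, Real.sqrt_mul (sq_nonneg _), Real.sqrt_sq h0]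
  rfl

theorem continuous_lagDensity {w n m : Prd j k → ℝ} (lam : ℝ) (hw : Continuous w) (hn : Continuous n)
    (hm : Continuous m) (h : ∀ x, (w x, n x, m x) ∈ lagDomain) :
    Continuous fun x => lagDensity j k lam (w x, n x, m x) :=
  (contDiffOn_lagDensity j k lam).continuousOn.comp_continuous (hw.prodMk (hn.prodMk hm)) h

theorem lagrangian_eq {r : ℝ} (hr : r ∈ Ioo (0 : ℝ) 1) (lam : ℝ) {u : Prd j k → ℝ} (hu : IsC1 u)
    (hu' : ∀ x, Real.arcsin r + u x ∈ Ioo 0 (Real.pi / 2)) :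
    lagrangian j k r lam u = ∫ x, lagDensity j k lam (Real.arcsin r + u x, dirFst u u x, dirSnd u u x)
      ∂prdMeasure j k := by
  have hw := hu.const_add (Real.arcsin r)
  -- The value 0 of the multiplier isolates the area density.
  have hcont := continuous_lagDensity (j := j) (k := k) 0 hw.continuous (continuous_dirFst hu hu)
    (continuous_dirSnd hu hu)
    fun x => mem_lagDomain (hu' x) (dirFst_self_nonneg u x) (dirSnd_self_nonneg u x)
  simp only [lagDensity, zero_mul, add_zero] at hcont
  have hcap : Continuous fun x => capVol j k (Real.arcsin r + u x) :=
    (contDiff_capVol j k).continuous.comp hw.continuous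
  rw [lagrangian, normalGraph_eq hr, area_graphMap hw hu', enclosedVolume_graphMap hw.continuous hu',
    ← integral_const_mul, ← integral_add]
  · refine integral_congr_ae (Filter.Eventually.of_forall fun x => ?_)
    simp only [lagDensity, dirFst, dirSnd, grad_const_add hu]
  · refine integrable_of_continuous _ (hcont.congr fun x => ?_)
    simp only [dirFst, dirSnd, grad_const_add hu]
  · exact integrable_of_continuous _ (hcap.const_mul lam)

theorem arcsin_mem {r : ℝ} (hr : r ∈ Ioo (0 : ℝ) 1) : Real.arcsin r ∈ Ioo 0 (Real.pi / 2) :=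
  ⟨Real.arcsin_pos.2 hr.1, Real.arcsin_lt_pi_div_two.2 hr.2⟩

/-- Compactness of M makes the neighbourhood of parameters uniform in x. It is taken in (s, t)
jointly, since the second variation needs the inner derivative for every small s. -/
theorem eventually_mem_Ioo {θ a b : ℝ} {f g : Prd j k → ℝ} (hf : Continuous f)
    (hg : Continuous g) (s₀ : ℝ) (h : ∀ x, θ + s₀ * f x ∈ Ioo a b) :
    ∀ᶠ p : ℝ × ℝ in nhds (s₀, 0), ∀ x, θ + (p.1 * f x + p.2 * g x) ∈ Ioo a b := by
  have := isCompact_univ.eventually_forall_of_forall_eventually (x₀ := ((s₀, 0) : ℝ × ℝ))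
    (K := (univ : Set (Prd j k))) (P := fun p x => θ + (p.1 * f x + p.2 * g x) ∈ Ioo a b) (by
      intro x _
      have hc : Continuous fun z : (ℝ × ℝ) × Prd j k => θ + (z.1.1 * f z.2 + z.1.2 * g z.2) := by
        fun_prop
      refine hc.continuousAt.eventually (isOpen_Ioo.mem_nhds ?_)
      simpa using h x)
  filter_upwards [this] with p hp x using hp x (mem_univ x)

/-- The data of two functions that enter the second variation. -/
def pairData (f g : Prd j k → ℝ) (x : Prd j k) : (ℝ × ℝ) × (ℝ × ℝ × ℝ) × (ℝ × ℝ × ℝ) :=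
  ((f x, g x), (dirFst f f x, dirFst f g x, dirFst g g x),
    (dirSnd f f x, dirSnd f g x, dirSnd g g x))

theorem continuous_pairData {f g : Prd j k → ℝ} (hf : IsC1 f) (hg : IsC1 g) :
    Continuous (pairData f g) :=
  (hf.continuous.prodMk hg.continuous).prodMk
    (((continuous_dirFst hf hf).prodMk ((continuous_dirFst hf hg).prodMk (continuous_dirFst hg hg))).prodMk
      ((continuous_dirSnd hf hf).prodMk ((continuous_dirSnd hf hg).prodMk (continuous_dirSnd hg hg))))

theorem hasDerivAt_lagrangian {r : ℝ} (hr : r ∈ Ioo (0 : ℝ) 1) (lam : ℝ) {f g : Prd j k → ℝ}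
    (hf : IsC1 f) (hg : IsC1 g) {s : ℝ} (hs : ∀ x, Real.arcsin r + s * f x ∈ Ioo 0 (Real.pi / 2)) :
    HasDerivAt (fun t : ℝ => lagrangian j k r lam (s • f + t • g))
      (∫ x, lagDiff j k lam (Real.arcsin r + s * f x, s ^ 2 * dirFst f f x, s ^ 2 * dirSnd f f x)
        (g x, 2 * s * dirFst f g x, 2 * s * dirSnd f g x) ∂prdMeasure j k) 0 := by
  set θ := Real.arcsin r
  -- All dependence on x passes through the finitely many continuous functions in `pairData`, and Γ
  -- is polynomial in t and these data.
  let Γ : ℝ × ((ℝ × ℝ) × (ℝ × ℝ × ℝ) × (ℝ × ℝ × ℝ)) → ℝ × ℝ × ℝ := fun z =>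
    (θ + (s * z.2.1.1 + z.1 * z.2.1.2),
      s ^ 2 * z.2.2.1.1 + 2 * s * z.1 * z.2.2.1.2.1 + z.1 ^ 2 * z.2.2.1.2.2,
      s ^ 2 * z.2.2.2.1 + 2 * s * z.1 * z.2.2.2.2.1 + z.1 ^ 2 * z.2.2.2.2.2)
  have hΓ : ContDiff ℝ 1 Γ := by fun_prop
  have hmem : ∀ x, Γ (0, pairData f g x) ∈ lagDomain := by
    intro x
    have e : Γ (0, pairData f g x) = (θ + s * f x, s ^ 2 * dirFst f f x, s ^ 2 * dirSnd f f x) := by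
      simp [Γ, pairData]
    rw [e]
    exact mem_lagDomain (hs x) (mul_nonneg (sq_nonneg s) (dirFst_self_nonneg f x))
      (mul_nonneg (sq_nonneg s) (dirSnd_self_nonneg f x))
  have key := hasDerivAt_integral_of_contDiffOn' (prdMeasure j k) (isOpen_lagDomain.preimage hΓ.continuous)
    ((contDiffOn_lagDensity j k lam).comp hΓ.contDiffOn fun z hz => hz) (continuous_pairData hf hg)
    (t₀ := (0 : ℝ)) hmem (D := fun x => lagDiff j k lam
      (θ + s * f x, s ^ 2 * dirFst f f x, s ^ 2 * dirSnd f f x)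
        (g x, 2 * s * dirFst f g x, 2 * s * dirSnd f g x)) ?_
  · refine key.congr_of_eventuallyEq ?_
    have hev := (eventually_mem_Ioo hf.continuous hg.continuous s hs)
    rw [nhds_prod_eq] at hev
    filter_upwards [hev.curry.self_of_nhds] with t ht
    rw [lagrangian_eq hr lam ((hf.smul s).add (hg.smul t)) ht]
    refine integral_congr_ae (Filter.Eventually.of_forall fun x => ?_)
    simp only [dirFst_combination hf hg, dirSnd_combination hf hg, Γ, pairData, Function.comp_apply,
      Pi.add_apply, Pi.smul_apply, smul_eq_mul]
    rfl
  · intro x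
    have h1 : HasDerivAt (fun t : ℝ => θ + (s * f x + t * g x)) (g x) 0 := by
      simpa using (((hasDerivAt_id (0 : ℝ)).mul_const (g x)).const_add (s * f x)).const_add θ
    have hquad : ∀ a b c : ℝ, HasDerivAt (fun t : ℝ => s ^ 2 * a + 2 * s * t * b + t ^ 2 * c)
        (2 * s * b) 0 := by
      intro a b c
      have h2 := ((((hasDerivAt_id (0 : ℝ)).const_mul (2 * s)).mul_const b).const_add (s ^ 2 * a)).add
        (((hasDerivAt_id (0 : ℝ)).pow 2).mul_const c)
      refine h2.congr_deriv ?_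
      simp
    have h := hasDerivAt_lagDensity j k lam h1 (hquad (dirFst f f x) (dirFst f g x) (dirFst g g x))
      (hquad (dirSnd f f x) (dirSnd f g x) (dirSnd g g x)) (hmem x)
    refine h.congr_deriv ?_
    simp

/-- The first variation. -/
theorem hasDerivAt_lagrangian_line {r : ℝ} (hr : r ∈ Ioo (0 : ℝ) 1) (lam : ℝ) {f : Prd j k → ℝ}
    (hf : IsC1 f) :
    HasDerivAt (fun t : ℝ => lagrangian j k r lam (t • f))
      (torusArea j k (Real.arcsin r) * (logSlope j k (Real.arcsin r) + lam) *
        ∫ x, f x ∂prdMeasure j k) 0 := by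
  have h := hasDerivAt_lagrangian hr lam hf hf (s := 0) fun x => by simpa using arcsin_mem hr
  simp only [zero_smul, zero_add] at h
  refine h.congr_deriv ?_
  rw [← integral_const_mul]
  refine integral_congr_ae (Filter.Eventually.of_forall fun x => ?_)
  simp [lagDiff, stretch, stretchDiff]
  ring

/-- The volume is the difference of the Lagrangians with multipliers 1 and 0. -/
theorem hasDerivAt_enclosedVolume_line {r : ℝ} (hr : r ∈ Ioo (0 : ℝ) 1) {f : Prd j k → ℝ}
    (hf : IsC1 f) :
    HasDerivAt (fun t : ℝ => enclosedVolume (normalGraph j k r (t • f)))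
      (torusArea j k (Real.arcsin r) * ∫ x, f x ∂prdMeasure j k) 0 := by
  have h := (hasDerivAt_lagrangian_line hr 1 hf).sub (hasDerivAt_lagrangian_line hr 0 hf)
  have e : (fun t : ℝ => enclosedVolume (normalGraph j k r (t • f))) =
      (fun t : ℝ => lagrangian j k r 1 (t • f)) - fun t : ℝ => lagrangian j k r 0 (t • f) := by
    ext t
    simp [lagrangian]
  rw [e]
  exact h.congr_deriv (by ring)

/-- The second variation. -/
theorem secondVariation_eq {r : ℝ} (hr : r ∈ Ioo (0 : ℝ) 1) {f g : Prd j k → ℝ}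
    (hf : IsC1 f) (hg : IsC1 g) :
    secondVariation j k r (-logSlope j k (Real.arcsin r)) f g =
      ∫ x, torusArea j k (Real.arcsin r) * ((dirFst f g x - j * (f x * g x)) / r ^ 2 +
        (dirSnd f g x - k * (f x * g x)) / (1 - r ^ 2)) ∂prdMeasure j k := by
  set θ := Real.arcsin r with hθ
  set lam := -logSlope j k θ with hlam
  have hsin : Real.sin θ = r := Real.sin_arcsin (by linarith [hr.1]) hr.2.le
  have hcos : Real.cos θ ^ 2 = 1 - r ^ 2 := by rw [← hsin, Real.cos_sq']
  obtain ⟨hsp, hcp⟩ := sin_cos_pos (arcsin_mem hr)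
  let Γ : ℝ × ((ℝ × ℝ) × (ℝ × ℝ × ℝ) × (ℝ × ℝ × ℝ)) → (ℝ × ℝ × ℝ) × (ℝ × ℝ × ℝ) := fun z =>
    ((θ + z.1 * z.2.1.1, z.1 ^ 2 * z.2.2.1.1, z.1 ^ 2 * z.2.2.2.1),
      (z.2.1.2, 2 * z.1 * z.2.2.1.2.1, 2 * z.1 * z.2.2.2.2.1))
  have hΓ : ContDiff ℝ 1 Γ := by fun_prop
  have hmem : ∀ x, Γ (0, pairData f g x) ∈ Prod.fst ⁻¹' lagDomain := by
    intro x
    have e : (Γ (0, pairData f g x)).1 = (θ, 0, 0) := by simp [Γ]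
    rw [mem_preimage, e]
    exact mem_lagDomain (arcsin_mem hr) le_rfl le_rfl
  have key := hasDerivAt_integral_of_contDiffOn' (prdMeasure j k)
    ((isOpen_lagDomain.preimage continuous_fst).preimage hΓ.continuous)
    ((contDiffOn_lagDiff j k lam).comp hΓ.contDiffOn fun z hz => hz) (continuous_pairData hf hg)
    (t₀ := (0 : ℝ)) hmem fun x => hasDerivAt_lagDiff j k lam hsp hcp (f x) (g x) (dirFst f f x)
      (dirSnd f f x) (dirFst f g x) (dirSnd f g x)
  have hev : (fun s : ℝ => deriv (fun t : ℝ => lagrangian j k r lam (s • f + t • g)) 0) =ᶠ[nhds 0]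
      fun s => ∫ x, lagDiff j k lam (θ + s * f x, s ^ 2 * dirFst f f x, s ^ 2 * dirSnd f f x)
        (g x, 2 * s * dirFst f g x, 2 * s * dirSnd f g x) ∂prdMeasure j k := by
    have h := eventually_mem_Ioo (θ := θ) (a := 0) (b := Real.pi / 2) hf.continuous hg.continuous 0
      fun x => by simpa only [zero_mul, add_zero] using arcsin_mem hr
    rw [nhds_prod_eq] at h
    filter_upwards [h.curry] with s hs
    refine (hasDerivAt_lagrangian hr lam hf hg fun x => ?_).deriv
    simpa only [zero_mul, add_zero] using hs.self_of_nhds x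
  rw [secondVariation, hev.deriv_eq]
  refine key.deriv.trans (integral_congr_ae (Filter.Eventually.of_forall fun x => ?_))
  -- For this multiplier ℓ(ℓ + λ) vanishes, and only -j/r² - k/(1 - r²) remains in front of f g.
  simp only [hlam, ← hθ, hsin, hcos]
  ring

/-- The first variation is G(ℓ + c)∫f with G > 0; the constant function 1 forces ℓ + c = 0. -/
theorem isLagrangeMultiplier_iff {α : ℝ≥0} (hα : α < 1) {r : ℝ} (hr : r ∈ Ioo (0 : ℝ) 1) (c : ℝ) :
    IsLagrangeMultiplier j k α r c ↔ c = -logSlope j k (Real.arcsin r) := by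
  obtain ⟨hsp, hcp⟩ := sin_cos_pos (arcsin_mem hr)
  constructor
  · intro h
    have h1 : IsC2Holder α (fun _ : Prd j k => (1 : ℝ)) := isC2Holder_of_contDiff hα contDiff_const
    have h2 := (hasDerivAt_lagrangian_line hr c h1.isC1).unique (h _ h1)
    have hvol : 0 < ∫ _ : Prd j k, (1 : ℝ) ∂prdMeasure j k := by
      rw [integral_const, smul_eq_mul, mul_one]
      exact ENNReal.toReal_pos (NeZero.ne _) (measure_ne_top _ _)
    have hG : 0 < torusArea j k (Real.arcsin r) := by rw [torusArea]; positivity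
    rcases mul_eq_zero.1 h2 with h3 | h3
    · rcases mul_eq_zero.1 h3 with h4 | h4
      · exact absurd h4 hG.ne'
      · linarith
    · exact absurd h3 hvol.ne'
  · rintro rfl f hf
    exact (hasDerivAt_lagrangian_line hr _ hf.isC1).congr_deriv (by ring)

theorem tangentToConstraint_iff {r : ℝ} (hr : r ∈ Ioo (0 : ℝ) 1) {f : Prd j k → ℝ} (hf : IsC1 f) :
    TangentToConstraint j k r f ↔ ∫ x, f x ∂prdMeasure j k = 0 := by
  obtain ⟨hsp, hcp⟩ := sin_cos_pos (arcsin_mem hr)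
  have hG : 0 < torusArea j k (Real.arcsin r) := by rw [torusArea]; positivity
  have h := hasDerivAt_enclosedVolume_line (j := j) (k := k) hr hf
  constructor
  · intro h'
    exact (mul_eq_zero.1 (h.unique h')).resolve_left hG.ne'
  · intro h'
    exact h.congr_deriv (by rw [h', mul_zero])

end Variation

/-! ### The index of a diagonal form -/

section DiagonalIndex

theorem eq_zero_of_form_nonneg {F : Type*} [AddCommGroup F] [Module ℝ F] {W : Submodule ℝ F} {b : F → ℝ}
    (hneg : ∀ f ∈ W, f ≠ 0 → b f < 0) {f : F} (hf : f ∈ W) (h : 0 ≤ b f) : f = 0 := by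
  by_contra h0
  linarith [hneg f hf h0]

variable {F ι : Type} [AddCommGroup F] [Module ℝ F] [DecidableEq ι] {V : Submodule ℝ F}
  {ip B : LinearMap.BilinForm ℝ V} {e : ι → V} {ev : ι → ℝ}

theorem linearIndependent_of_orthonormal (he : ∀ i i', ip (e i) (e i') = if i = i' then 1 else 0) :
    LinearIndependent ℝ e := by
  rw [linearIndependent_iff']
  intro s c hc i hi
  have h := congrArg (fun v => ip v (e i)) hc
  simpa [he, hi] using h

/-- The maximal dimension of a negative definite subspace is the number of negative modes. -/
theorem iSup_rank_eq_card (hsymm : ∀ f g, ip f g = ip g f) (hip : ∀ f, 0 ≤ ip f f)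
    (he : ∀ i i', ip (e i) (e i') = if i = i' then 1 else 0)
    (hdense : ∀ f, ∀ ε > 0, ∃ g ∈ Submodule.span ℝ (range e), ip (f - g) (f - g) < ε)
    (hBsymm : ∀ f g, B f g = B g f) (hB : ∀ f i, B f (e i) = ev i * ip f (e i))
    {C : ℝ} (hC : ∀ f, -(C * ip f f) ≤ B f f) {P : F → Prop} {b : F → ℝ} {G : ℝ} (hG : 0 < G)
    (hPV : ∀ f, P f → f ∈ V) (hb : ∀ f : V, b f = G * B f f) {N Z : Finset ι}
    (hN : ∀ i, i ∈ N ↔ ev i < 0) (hZ : ∀ f : V, P f → ∀ i ∈ Z, ip f (e i) = 0)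
    (hPe : ∀ c : ι → ℝ, P (∑ i ∈ N \ Z, c i • e i : V)) :
    (⨆ (W : Submodule ℝ F) (_ : ∀ f ∈ W, P f) (_ : ∀ f ∈ W, f ≠ 0 → b f < 0),
      Cardinal.toENat (Module.rank ℝ W)) = ((N \ Z).card : ℕ∞) := by
  apply le_antisymm
  · refine iSup_le fun W => iSup_le fun hW => iSup_le fun hneg => ?_
    have hWV : W ≤ V := fun f hf => hPV f (hW f hf)
    -- Upper bound: W is mapped to its coefficients on the admissible negative modes. An element of
    -- the kernel has no negative mode at all, since those in Z are excluded by P; the form is then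
    -- nonnegative on it, so it is 0.
    let T : W →ₗ[ℝ] ((N \ Z : Finset ι) → ℝ) :=
      LinearMap.pi fun i => (ip.flip (e i)) ∘ₗ Submodule.inclusion hWV
    have hT : Function.Injective T := by
      rw [← LinearMap.ker_eq_bot, LinearMap.ker_eq_bot']
      intro f hf
      have hcoef : ∀ i ∈ N \ Z, ip (Submodule.inclusion hWV f) (e i) = 0 := fun i hi =>
        congrFun hf ⟨i, hi⟩
      have hnn : 0 ≤ B (Submodule.inclusion hWV f) (Submodule.inclusion hWV f) := by
        refine form_nonneg_of_coeff hsymm hip he hdense hBsymm hB hC fun i hi => ?_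
        by_contra! hlt
        by_cases hiZ : i ∈ Z
        · exact hi (hZ _ (hW f f.2) i hiZ)
        · exact hi (hcoef i (Finset.mem_sdiff.2 ⟨(hN i).2 hlt, hiZ⟩))
      have hbn : 0 ≤ b f := by
        rw [show (f : F) = (Submodule.inclusion hWV f : V) from rfl, hb]
        exact mul_nonneg hG.le hnn
      exact Subtype.ext (eq_zero_of_form_nonneg hneg f.2 hbn)
    have hrank := LinearMap.rank_le_of_injective T hT
    rw [rank_fun', Fintype.card_coe] at hrank
    simpa using Cardinal.toENat.monotone' hrank
  -- Lower bound: the span of the admissible negative modes is itself a competitor.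
  · let E : (N \ Z : Finset ι) → F := fun i => (e i : F)
    have hE : LinearIndependent ℝ E :=
      ((linearIndependent_of_orthonormal he).comp ((↑) : (N \ Z : Finset ι) → ι)
        Subtype.val_injective).map' V.subtype V.ker_subtype
    have hmem : ∀ f ∈ Submodule.span ℝ (range E), ∃ c : ι → ℝ, f = (∑ i ∈ N \ Z, c i • e i : V) := by
      intro f hf
      obtain ⟨c, rfl⟩ := (Submodule.mem_span_range_iff_exists_fun ℝ).1 hf
      refine ⟨fun i => if h : i ∈ N \ Z then c ⟨i, h⟩ else 0, ?_⟩
      rw [← Finset.sum_coe_sort (N \ Z)]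
      simp only [Submodule.coe_sum, Submodule.coe_smul, E]
      exact Finset.sum_congr rfl fun i _ => by rw [dif_pos i.2]
    refine le_iSup_of_le (Submodule.span ℝ (range E)) (le_iSup_of_le ?_ (le_iSup_of_le ?_ ?_))
    · intro f hf
      obtain ⟨c, rfl⟩ := hmem f hf
      exact hPe c
    · intro f hf hf0
      obtain ⟨c, rfl⟩ := hmem f hf
      rw [hb, form_combination he hB]
      have hex : ∃ i ∈ N \ Z, c i ≠ 0 := by
        by_contra! hcon
        apply hf0
        rw [Finset.sum_eq_zero fun i hi => by rw [hcon i hi, zero_smul], Submodule.coe_zero]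
      obtain ⟨i, hi, hci⟩ := hex
      refine mul_neg_of_pos_of_neg hG (Finset.sum_neg' (fun i hi => ?_) ⟨i, hi, ?_⟩)
      · exact mul_nonpos_of_nonpos_of_nonneg ((hN i).1 (Finset.mem_sdiff.1 hi).1).le (sq_nonneg _)
      · exact mul_neg_of_neg_of_pos ((hN i).1 (Finset.mem_sdiff.1 hi).1) (by positivity)
    · rw [rank_span hE, Cardinal.mk_range_eq _ hE.injective, Cardinal.mk_coe_finset,
        Cardinal.toENat_nat]

end DiagonalIndex

/-! ### The second variation as a diagonal form -/

section Forms

variable (j k : ℕ)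

/-- The space of continuously differentiable functions on `M`. -/
def c1Space : Submodule ℝ (Prd j k → ℝ) where
  carrier := {f | IsC1 f}
  add_mem' hf hg := IsC1.add hf hg
  zero_mem' := isC1_const 0
  smul_mem' c _ hf := IsC1.smul c hf

variable {j k}

theorem dirFst_add_left {f f' : Prd j k → ℝ} (hf : IsC1 f) (hf' : IsC1 f') (g : Prd j k → ℝ)
    (x : Prd j k) : dirFst (f + f') g x = dirFst f g x + dirFst f' g x := by
  rw [dirFst, grad_add hf hf']
  exact inner_add_left _ _ _

theorem dirSnd_add_left {f f' : Prd j k → ℝ} (hf : IsC1 f) (hf' : IsC1 f') (g : Prd j k → ℝ)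
    (x : Prd j k) : dirSnd (f + f') g x = dirSnd f g x + dirSnd f' g x := by
  rw [dirSnd, grad_add hf hf']
  exact inner_add_left _ _ _

theorem dirFst_smul_left {f : Prd j k → ℝ} (hf : IsC1 f) (c : ℝ) (g : Prd j k → ℝ)
    (x : Prd j k) : dirFst (c • f) g x = c * dirFst f g x := by
  rw [dirFst, grad_smul c hf]
  exact real_inner_smul_left _ _ _

theorem dirSnd_smul_left {f : Prd j k → ℝ} (hf : IsC1 f) (c : ℝ) (g : Prd j k → ℝ)
    (x : Prd j k) : dirSnd (c • f) g x = c * dirSnd f g x := by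
  rw [dirSnd, grad_smul c hf]
  exact real_inner_smul_left _ _ _

theorem dirFst_comm (f g : Prd j k → ℝ) (x : Prd j k) : dirFst f g x = dirFst g f x :=
  real_inner_comm _ _

theorem dirSnd_comm (f g : Prd j k → ℝ) (x : Prd j k) : dirSnd f g x = dirSnd g f x :=
  real_inner_comm _ _

/-- A bilinear form from a symmetric function that is linear in its first argument. -/
def symmForm {V : Type*} [AddCommGroup V] [Module ℝ V] (b : V → V → ℝ) (hadd : ∀ f f' g, b (f + f') g = b f g + b f' g)
    (hsmul : ∀ (c : ℝ) f g, b (c • f) g = c * b f g) (hsymm : ∀ f g, b f g = b g f) :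
    LinearMap.BilinForm ℝ V :=
  LinearMap.mk₂ ℝ b hadd hsmul (fun f g g' => by rw [hsymm, hadd, hsymm g, hsymm g'])
    fun c f g => by rw [hsymm, hsmul, hsymm g]; rfl

theorem integral_eq_combination {X : Type*} [MeasurableSpace X] {μ : Measure X} {H u v w : X → ℝ}
    {a b c : ℝ} (hu : Integrable u μ) (hv : Integrable v μ) (hw : Integrable w μ)
    (h : ∀ x, H x = a * u x + b * v x + c * w x) :
    ∫ x, H x ∂μ = a * ∫ x, u x ∂μ + b * ∫ x, v x ∂μ + c * ∫ x, w x ∂μ := by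
  simp_rw [h]
  have h1 : Integrable (fun x => a * u x + b * v x) μ := (hu.const_mul a).add (hv.const_mul b)
  rw [integral_add h1 (hw.const_mul c), integral_add (hu.const_mul a) (hv.const_mul b),
    integral_const_mul, integral_const_mul, integral_const_mul]

theorem integral_eq_add {X : Type*} [MeasurableSpace X] {μ : Measure X} {H u v : X → ℝ}
    (hu : Integrable u μ) (hv : Integrable v μ) (h : ∀ x, H x = u x + v x) :
    ∫ x, H x ∂μ = ∫ x, u x ∂μ + ∫ x, v x ∂μ := by
  simp_rw [h]
  exact integral_add hu hv

variable (j k) in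
/-- The `L²` inner product. -/
def ipForm : LinearMap.BilinForm ℝ (c1Space j k) :=
  symmForm (fun f g => ∫ x, f.1 x * g.1 x ∂prdMeasure j k)
    (fun f f' g => integral_eq_add (integrable_of_continuous _ (f.2.continuous.mul g.2.continuous))
      (integrable_of_continuous _ (f'.2.continuous.mul g.2.continuous)) fun _ => add_mul _ _ _)
    (fun c f g => by
      rw [← integral_const_mul]
      exact integral_congr_ae (Filter.Eventually.of_forall fun x => mul_assoc _ _ _))
    fun f g => integral_congr_ae (Filter.Eventually.of_forall fun x => mul_comm _ _)

theorem ipForm_apply (f g : c1Space j k) : ipForm j k f g = ∫ x, f.1 x * g.1 x ∂prdMeasure j k := rfl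

variable (j k) in
/-- The Dirichlet form of the first factor. -/
def dirFstForm : LinearMap.BilinForm ℝ (c1Space j k) :=
  symmForm (fun f g => ∫ x, dirFst f.1 g.1 x ∂prdMeasure j k)
    (fun f f' g => by
      rw [← integral_add (integrable_of_continuous _ (continuous_dirFst f.2 g.2))
        (integrable_of_continuous _ (continuous_dirFst f'.2 g.2))]
      exact integral_congr_ae (Filter.Eventually.of_forall fun x => dirFst_add_left f.2 f'.2 _ _))
    (fun c f g => by
      rw [← integral_const_mul]
      exact integral_congr_ae (Filter.Eventually.of_forall fun x => dirFst_smul_left f.2 c _ _))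
    fun f g => integral_congr_ae (Filter.Eventually.of_forall fun x => dirFst_comm _ _ _)

variable (j k) in
/-- The Dirichlet form of the second factor. -/
def dirSndForm : LinearMap.BilinForm ℝ (c1Space j k) :=
  symmForm (fun f g => ∫ x, dirSnd f.1 g.1 x ∂prdMeasure j k)
    (fun f f' g => by
      rw [← integral_add (integrable_of_continuous _ (continuous_dirSnd f.2 g.2))
        (integrable_of_continuous _ (continuous_dirSnd f'.2 g.2))]
      exact integral_congr_ae (Filter.Eventually.of_forall fun x => dirSnd_add_left f.2 f'.2 _ _))
    (fun c f g => by
      rw [← integral_const_mul]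
      exact integral_congr_ae (Filter.Eventually.of_forall fun x => dirSnd_smul_left f.2 c _ _))
    fun f g => integral_congr_ae (Filter.Eventually.of_forall fun x => dirSnd_comm _ _ _)

variable (j k) in
/-- The second variation, up to a positive factor. -/
def jacobiForm (r : ℝ) : LinearMap.BilinForm ℝ (c1Space j k) :=
  (r ^ 2)⁻¹ • (dirFstForm j k - (j : ℝ) • ipForm j k) +
    (1 - r ^ 2)⁻¹ • (dirSndForm j k - (k : ℝ) • ipForm j k)

theorem jacobiForm_apply (r : ℝ) (f g : c1Space j k) : jacobiForm j k r f g =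
    (r ^ 2)⁻¹ * (dirFstForm j k f g - j * ipForm j k f g) +
      (1 - r ^ 2)⁻¹ * (dirSndForm j k f g - k * ipForm j k f g) := rfl

theorem secondVariation_eq_jacobiForm {r : ℝ} (hr : r ∈ Ioo (0 : ℝ) 1) (f g : c1Space j k) :
    secondVariation j k r (-logSlope j k (Real.arcsin r)) f g =
      torusArea j k (Real.arcsin r) * jacobiForm j k r f g := by
  have h1 : Integrable (fun x => f.1 x * g.1 x) (prdMeasure j k) :=
    integrable_of_continuous _ (f.2.continuous.mul g.2.continuous)
  have h2 : Integrable (fun x => dirFst f.1 g.1 x) (prdMeasure j k) :=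
    integrable_of_continuous _ (continuous_dirFst f.2 g.2)
  have h3 : Integrable (fun x => dirSnd f.1 g.1 x) (prdMeasure j k) :=
    integrable_of_continuous _ (continuous_dirSnd f.2 g.2)
  rw [secondVariation_eq hr f.2 g.2, integral_const_mul, jacobiForm_apply]
  congr 1
  refine (integral_eq_combination (a := (r ^ 2)⁻¹) (b := (1 - r ^ 2)⁻¹)
    (c := -((r ^ 2)⁻¹ * j + (1 - r ^ 2)⁻¹ * k)) h2 h3 h1 fun x => by ring).trans ?_
  rw [ipForm_apply]
  change _ = (r ^ 2)⁻¹ * ((∫ x, dirFst f.1 g.1 x ∂prdMeasure j k) - _) +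
    (1 - r ^ 2)⁻¹ * ((∫ x, dirSnd f.1 g.1 x ∂prdMeasure j k) - _)
  ring

theorem ipForm_symm (f g : c1Space j k) : ipForm j k f g = ipForm j k g f :=
  integral_congr_ae (Filter.Eventually.of_forall fun _ => mul_comm _ _)

theorem jacobiForm_symm (r : ℝ) (f g : c1Space j k) : jacobiForm j k r f g = jacobiForm j k r g f := by
  rw [jacobiForm_apply, jacobiForm_apply, ipForm_symm,
    show dirFstForm j k f g = dirFstForm j k g f from
      integral_congr_ae (Filter.Eventually.of_forall fun _ => dirFst_comm _ _ _),
    show dirSndForm j k f g = dirSndForm j k g f from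
      integral_congr_ae (Filter.Eventually.of_forall fun _ => dirSnd_comm _ _ _)]

theorem ipForm_self_nonneg (f : c1Space j k) : 0 ≤ ipForm j k f f :=
  integral_nonneg fun _ => mul_self_nonneg _

/-- The functions are continuous and the measure charges every nonempty open set. -/
theorem eq_zero_of_ipForm_self (f : c1Space j k) (h : ipForm j k f f = 0) : f = 0 := by
  have hc : Continuous fun x => f.1 x * f.1 x := f.2.continuous.mul f.2.continuous
  have h0 := (hc.ae_eq_iff_eq (prdMeasure j k) continuous_zero).1
    ((integral_eq_zero_iff_of_nonneg (fun x => mul_self_nonneg _) (integrable_of_continuous _ hc)).1 h)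
  ext x
  exact mul_self_eq_zero.1 (congrFun h0 x)

/-- Discarding the nonnegative Dirichlet terms gives the semiboundedness required by
`form_nonneg_of_coeff`. -/
theorem jacobiForm_self_ge {r : ℝ} (hr : r ∈ Ioo (0 : ℝ) 1) (f : c1Space j k) :
    -(((r ^ 2)⁻¹ * j + (1 - r ^ 2)⁻¹ * k) * ipForm j k f f) ≤ jacobiForm j k r f f := by
  have h1 : 0 ≤ dirFstForm j k f f := integral_nonneg fun x => dirFst_self_nonneg _ _
  have h2 : 0 ≤ dirSndForm j k f f := integral_nonneg fun x => dirSnd_self_nonneg _ _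
  have h3 : 0 ≤ (r ^ 2)⁻¹ := by positivity
  have h4 : 0 ≤ (1 - r ^ 2)⁻¹ := inv_nonneg.2 (by nlinarith [hr.1, hr.2])
  rw [jacobiForm_apply]
  nlinarith [mul_nonneg h3 h1, mul_nonneg h4 h2]

/-- The modes. -/
def mode (i : HarmIdx j × HarmIdx k) : c1Space j k := ⟨prodHarm i, prodHarm_isC1 i⟩

theorem ipForm_mode (hj : 1 ≤ j) (hk : 1 ≤ k) (i i' : HarmIdx j × HarmIdx k) :
    ipForm j k (mode i) (mode i') = if i = i' then 1 else 0 := integral_prodHarm_mul hj hk i i'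

variable (j k) in
/-- The eigenvalue of the Jacobi form on the products of spherical harmonics of degrees `a`, `b`. -/
def modeEig (r : ℝ) (a b : ℕ) : ℝ :=
  ((a : ℝ) - 1) * (a + j) / r ^ 2 + ((b : ℝ) - 1) * (b + k) / (1 - r ^ 2)

/-- The eigenvalue factors because a(a + j - 1) - j = (a - 1)(a + j), and likewise for b and k. -/
theorem jacobiForm_mode (r : ℝ) (f : c1Space j k) (i : HarmIdx j × HarmIdx k) :
    jacobiForm j k r f (mode i) = modeEig j k r i.1.1 i.2.1 * ipForm j k f (mode i) := by
  have h1 : dirFstForm j k f (mode i) = sphEig j i.1.1 * ipForm j k f (mode i) :=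
    integral_dirFst_prodHarm f.2 i
  have h2 : dirSndForm j k f (mode i) = sphEig k i.2.1 * ipForm j k f (mode i) :=
    integral_dirSnd_prodHarm f.2 i
  rw [jacobiForm_apply, h1, h2, modeEig, sphEig, sphEig]
  ring

theorem exists_span_mode_approx (f : c1Space j k) {ε : ℝ} (hε : 0 < ε) :
    ∃ g ∈ Submodule.span ℝ (range (mode : HarmIdx j × HarmIdx k → c1Space j k)),
      ipForm j k (f - g) (f - g) < ε := by
  set v := (prdMeasure j k).real univ
  have hv : 0 ≤ v := measureReal_nonneg
  -- A uniform error √(ε/(v + 1)) gives the squared L² error vε/(v + 1) < ε, where v is the total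
  -- mass.
  obtain ⟨g, hg, hfg⟩ := exists_span_prodHarm_approx f.2.continuous
    (Real.sqrt_pos.2 (div_pos hε (by positivity : 0 < v + 1)))
  have hg' : g ∈ (Submodule.span ℝ (range (mode : HarmIdx j × HarmIdx k → c1Space j k))).map
      (c1Space j k).subtype := by
    rw [Submodule.map_span, ← range_comp]
    exact hg
  obtain ⟨g', hg', rfl⟩ := hg'
  refine ⟨g', hg', ?_⟩
  have hb : ∀ x, (f - g').1 x * (f - g').1 x ≤ ε / (v + 1) := by
    intro x
    have h := (hfg x).le
    rw [← Real.sqrt_sq_eq_abs] at h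
    have := (Real.sqrt_le_sqrt_iff (by positivity)).1 h
    calc _ = (f.1 x - (c1Space j k).subtype g' x) ^ 2 := (sq _).symm
      _ ≤ _ := this
  have h1 : ipForm j k (f - g') (f - g') ≤ ∫ _, ε / (v + 1) ∂prdMeasure j k :=
    integral_mono (integrable_of_continuous _ ((f - g').2.continuous.mul (f - g').2.continuous))
      (integrable_const _) hb
  rw [integral_const, smul_eq_mul] at h1
  refine lt_of_le_of_lt h1 ?_
  change v * (ε / (v + 1)) < ε
  rw [mul_div_assoc', div_lt_iff₀ (by positivity)]
  nlinarith

end Forms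

/-! ### The Morse indices -/

section ModeCount

variable {j k : ℕ}

variable (j k) in
/-- The modes whose degrees belong to a given finite set. -/
def modesOf (D : Finset (ℕ × ℕ)) : Finset (HarmIdx j × HarmIdx k) :=
  D.biUnion fun p => ((Finset.univ : Finset (Fin (harmDim j p.1))).map (Function.Embedding.sigmaMk p.1)) ×ˢ
    ((Finset.univ : Finset (Fin (harmDim k p.2))).map (Function.Embedding.sigmaMk p.2))

theorem mem_modesOf {D : Finset (ℕ × ℕ)} {i : HarmIdx j × HarmIdx k} :
    i ∈ modesOf j k D ↔ (i.1.1, i.2.1) ∈ D := by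
  obtain ⟨⟨a, u⟩, ⟨b, v⟩⟩ := i
  simp only [modesOf, Finset.mem_biUnion, Finset.mem_product, Finset.mem_map, Finset.mem_univ, true_and,
    Function.Embedding.sigmaMk_apply]
  constructor
  · rintro ⟨⟨a', b'⟩, hp, ⟨u', hu⟩, ⟨v', hv⟩⟩
    obtain rfl : a' = a := congrArg Sigma.fst hu
    obtain rfl : b' = b := congrArg Sigma.fst hv
    exact hp
  · exact fun h => ⟨(a, b), h, ⟨u, rfl⟩, ⟨v, rfl⟩⟩

theorem card_modesOf (D : Finset (ℕ × ℕ)) :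
    (modesOf j k D).card = ∑ p ∈ D, harmDim j p.1 * harmDim k p.2 := by
  rw [modesOf, Finset.card_biUnion]
  · simp
  · intro p hp q hq hpq
    rw [Function.onFun, Finset.disjoint_left]
    intro i h1 h2
    simp only [Finset.mem_product, Finset.mem_map, Finset.mem_univ, true_and,
      Function.Embedding.sigmaMk_apply] at h1 h2
    obtain ⟨⟨u, hu⟩, ⟨v, hv⟩⟩ := h1
    obtain ⟨⟨u', hu'⟩, ⟨v', hv'⟩⟩ := h2
    exact hpq (Prod.ext ((congrArg Sigma.fst hu).trans (congrArg Sigma.fst hu').symm)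
      ((congrArg Sigma.fst hv).trans (congrArg Sigma.fst hv').symm))

variable (j k) in
/-- The constant mode. -/
def zeroIdx : HarmIdx j × HarmIdx k :=
  (⟨0, ⟨0, by rw [harmDim_zero]; exact one_pos⟩⟩, ⟨0, ⟨0, by rw [harmDim_zero]; exact one_pos⟩⟩)

theorem polyEval_of_isHomogeneous_zero {d : ℕ} {P : MvPolynomial (Fin (d + 1)) ℝ} (hP : P.IsHomogeneous 0)
    (x : Euc d) : polyEval P x = polyEval P 0 := by
  have h := polyEval_smul hP 0 x
  rw [zero_smul, pow_zero, one_mul] at h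
  exact h.symm

theorem exists_prodHarm_zeroIdx (hj : 1 ≤ j) (hk : 1 ≤ k) :
    ∃ c : ℝ, c ≠ 0 ∧ ∀ x, prodHarm (zeroIdx j k) x = c := by
  refine ⟨polyEval (harmPoly (zeroIdx j k).1) 0 * polyEval (harmPoly (zeroIdx j k).2) 0, ?_, fun x => ?_⟩
  · intro h0
    have h := integral_prodHarm_mul hj hk (zeroIdx j k) (zeroIdx j k)
    have hz : ∀ x, prodHarm (zeroIdx j k) x = 0 := fun x => by
      rw [prodHarm, prodPoly, polyEval_of_isHomogeneous_zero (harmPoly_isHomogeneous (zeroIdx j k).1),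
        polyEval_of_isHomogeneous_zero (harmPoly_isHomogeneous (zeroIdx j k).2), h0]
    simp [hz] at h
  · rw [prodHarm, prodPoly, polyEval_of_isHomogeneous_zero (harmPoly_isHomogeneous (zeroIdx j k).1),
      polyEval_of_isHomogeneous_zero (harmPoly_isHomogeneous (zeroIdx j k).2)]

/-- Harmonics of degree 0 are nonzero constants, so the linearized volume constraint is the
vanishing of one coefficient. -/
theorem ipForm_zeroIdx_eq_zero_iff (hj : 1 ≤ j) (hk : 1 ≤ k) (f : c1Space j k) :
    ipForm j k f (mode (zeroIdx j k)) = 0 ↔ ∫ x, f.1 x ∂prdMeasure j k = 0 := by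
  obtain ⟨c, hc, h⟩ := exists_prodHarm_zeroIdx hj hk
  have e : ipForm j k f (mode (zeroIdx j k)) = (∫ x, f.1 x ∂prdMeasure j k) * c := by
    rw [ipForm_apply, ← integral_mul_const]
    exact integral_congr_ae (Filter.Eventually.of_forall fun x => congrArg (f.1 x * ·) (h x))
  rw [e, mul_eq_zero, or_iff_left hc]

theorem isC2Holder_combination {α : ℝ≥0} (hα : α < 1) (s : Finset (HarmIdx j × HarmIdx k))
    (c : HarmIdx j × HarmIdx k → ℝ) : IsC2Holder α (∑ i ∈ s, c i • mode i : c1Space j k).1 := by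
  have hΦ : ContDiff ℝ 3 fun z : Amb j k =>
      ∑ i ∈ s, c i * ambPoly (harmPoly i.1) (harmPoly i.2) z :=
    ContDiff.sum fun i _ => contDiff_const.mul (contDiff_ambPoly _ _)
  have h := isC2Holder_of_contDiff hα hΦ
  have e : (∑ i ∈ s, c i • mode i : c1Space j k).1 = fun x =>
      ∑ i ∈ s, c i * ambPoly (harmPoly i.1) (harmPoly i.2) (pt x) := by
    ext x
    simp only [Submodule.coe_sum, Submodule.coe_smul, Finset.sum_apply, Pi.smul_apply, smul_eq_mul]
    rfl
  rw [e]
  exact h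

theorem torusArea_arcsin_pos {r : ℝ} (hr : r ∈ Ioo (0 : ℝ) 1) : 0 < torusArea j k (Real.arcsin r) := by
  obtain ⟨hsp, hcp⟩ := sin_cos_pos (arcsin_mem hr)
  rw [torusArea]; positivity

/-- The strong Morse index is the number of negative modes. -/
theorem strongMorseIndex_eq (hj : 1 ≤ j) (hk : 1 ≤ k) {α : ℝ≥0} (hα : α < 1) {r : ℝ}
    (hr : r ∈ Ioo (0 : ℝ) 1) {D : Finset (ℕ × ℕ)}
    (hD : ∀ a b, (a, b) ∈ D ↔ modeEig j k r a b < 0) :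
    strongMorseIndex j k α r (-logSlope j k (Real.arcsin r)) = ((modesOf j k D).card : ℕ∞) := by
  classical
  have h := iSup_rank_eq_card (F := Prd j k → ℝ) (P := IsC2Holder α)
    (b := fun f => secondVariation j k r (-logSlope j k (Real.arcsin r)) f f) (Z := ∅)
    ipForm_symm ipForm_self_nonneg (ipForm_mode hj hk) (fun f ε hε => exists_span_mode_approx f hε)
    (jacobiForm_symm r) (jacobiForm_mode r) (jacobiForm_self_ge hr) (torusArea_arcsin_pos hr)
    (fun f hf => hf.isC1) (fun f => secondVariation_eq_jacobiForm hr f f) (N := modesOf j k D)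
    (fun i => mem_modesOf.trans (hD _ _)) (fun f _ i hi => absurd hi (Finset.notMem_empty i))
    fun c => isC2Holder_combination hα _ c
  rw [Finset.sdiff_empty] at h
  exact h

/-- The weak Morse index is the number of negative modes, except the constant one. -/
theorem weakMorseIndex_eq (hj : 1 ≤ j) (hk : 1 ≤ k) {α : ℝ≥0} (hα : α < 1) {r : ℝ}
    (hr : r ∈ Ioo (0 : ℝ) 1) {D : Finset (ℕ × ℕ)}
    (hD : ∀ a b, (a, b) ∈ D ↔ modeEig j k r a b < 0) :
    weakMorseIndex j k α r (-logSlope j k (Real.arcsin r)) = ((modesOf j k D \ {zeroIdx j k}).card : ℕ∞) := by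
  classical
  refine iSup_rank_eq_card (F := Prd j k → ℝ)
    (P := fun f => IsC2Holder α f ∧ TangentToConstraint j k r f)
    (b := fun f => secondVariation j k r (-logSlope j k (Real.arcsin r)) f f)
    ipForm_symm ipForm_self_nonneg (ipForm_mode hj hk) (fun f ε hε => exists_span_mode_approx f hε)
    (jacobiForm_symm r) (jacobiForm_mode r) (jacobiForm_self_ge hr) (torusArea_arcsin_pos hr)
    (fun f hf => hf.1.isC1) (fun f => secondVariation_eq_jacobiForm hr f f)
    (fun i => mem_modesOf.trans (hD _ _)) (fun f hf i hi => ?_)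
    fun c => ⟨isC2Holder_combination hα _ c, ?_⟩
  · rw [Finset.mem_singleton.1 hi, ipForm_zeroIdx_eq_zero_iff hj hk]
    exact (tangentToConstraint_iff hr f.2).1 hf.2
  · refine (tangentToConstraint_iff hr (isC2Holder_combination hα _ c).isC1).2
      ((ipForm_zeroIdx_eq_zero_iff hj hk _).1 ?_)
    rw [map_sum, LinearMap.sum_apply]
    refine Finset.sum_eq_zero fun i hi => ?_
    rw [map_smul, LinearMap.smul_apply, ipForm_mode hj hk, if_neg, smul_zero]
    rintro rfl
    simp at hi

theorem modeEig_zero_neg (hj : 1 ≤ j) {r : ℝ} (hr : r ∈ Ioo (0 : ℝ) 1) : modeEig j k r 0 0 < 0 := by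
  have h1 : 0 < r ^ 2 := pow_pos hr.1 2
  have h2 : 0 < 1 - r ^ 2 := by nlinarith [hr.1, hr.2]
  have hj' : (0 : ℝ) < j := by exact_mod_cast hj
  have e : modeEig j k r 0 0 = -(j / r ^ 2 + k / (1 - r ^ 2)) := by
    simp [modeEig]; ring
  rw [e, neg_lt_zero]
  positivity

/-- The difference between the strong and the weak index: degree (0, 0) carries a single mode. -/
theorem card_modesOf_sdiff {D : Finset (ℕ × ℕ)} (hD : (0, 0) ∈ D) :
    (modesOf j k D \ {zeroIdx j k}).card + 1 = (modesOf j k D).card := by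
  have h : zeroIdx j k ∈ modesOf j k D := mem_modesOf.2 hD
  rw [Finset.sdiff_singleton_eq_erase, Finset.card_erase_add_one h]

end ModeCount

/-! ### The kernel of the second variation -/

section Kernel

open MvPolynomial

/-- Since P(tx) = tP(x), P coincides with its differential at the origin. -/
theorem exists_linear_of_isHomogeneous_one {d : ℕ} {P : MvPolynomial (Fin (d + 1)) ℝ}
    (hP : P.IsHomogeneous 1) : ∃ ℓ : Euc d →L[ℝ] ℝ, ∀ x, polyEval P x = ℓ x := by
  refine ⟨fderiv ℝ (polyEval P) 0, fun x => ?_⟩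
  have h1 : HasDerivAt (fun t : ℝ => polyEval P (t • x)) (fderiv ℝ (polyEval P) 0 x) 0 := by
    have hd : HasFDerivAt (polyEval P) (fderiv ℝ (polyEval P) 0) ((0 : ℝ) • x) := by
      rw [zero_smul]
      exact ((contDiff_polyEval P (n := 1)).differentiable one_ne_zero 0).hasFDerivAt
    have hx : HasDerivAt (fun t : ℝ => t • x) x 0 := by
      simpa using (hasDerivAt_id (0 : ℝ)).smul_const x
    exact hd.comp_hasDerivAt 0 hx
  have h2 : HasDerivAt (fun t : ℝ => polyEval P (t • x)) (polyEval P x) 0 := by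
    simp only [polyEval_smul hP, pow_one]
    simpa using (hasDerivAt_id (0 : ℝ)).mul_const (polyEval P x)
  exact h2.unique h1

theorem exists_isHomogeneous_one_of_linear {d : ℕ} (ℓ : Euc d →ₗ[ℝ] ℝ) :
    ∃ P : MvPolynomial (Fin (d + 1)) ℝ, P.IsHomogeneous 1 ∧ ∀ x, polyEval P x = ℓ x := by
  refine ⟨∑ a, C (ℓ (EuclideanSpace.single a 1)) * X a, ?_, fun x => ?_⟩
  · refine IsHomogeneous.sum _ _ _ fun a _ => ?_
    simpa using (isHomogeneous_C _ (ℓ (EuclideanSpace.single a 1))).mul (isHomogeneous_X ℝ a)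
  · have hx : x = ∑ a, x.ofLp a • EuclideanSpace.single a (1 : ℝ) := by
      ext b
      simp [Pi.single_apply]
    conv_rhs => rw [hx]
    simp [polyEval, mul_comm]

theorem polyLap_of_isHomogeneous_one {d : ℕ} {P : MvPolynomial (Fin (d + 1)) ℝ}
    (hP : P.IsHomogeneous 1) : polyLap P = 0 := by
  refine Finset.sum_eq_zero fun i _ => ?_
  have h : (pderiv i P).IsHomogeneous 0 := hP.pderiv
  obtain ⟨c, hc⟩ : ∃ c, pderiv i P = C c :=
    ⟨_, totalDegree_eq_zero_iff_eq_C.1 ((totalDegree_zero_iff_isHomogeneous _).2 h)⟩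
  rw [hc, pderiv_C]

theorem polyEval_rotLap_of_isHomogeneous_one {d : ℕ} {P : MvPolynomial (Fin (d + 1)) ℝ}
    (hP : P.IsHomogeneous 1) (x : Euc d) : polyEval (rotLap P) x = -(2 * d) * polyEval P x := by
  rw [rotLap_eq hP, polyLap_of_isHomogeneous_one hP]
  simp [polyEval]

variable {j k : ℕ}

/-- A product of linear functions lies in the kernel. -/
theorem jacobiForm_prodPoly_linear (r : ℝ) (g : c1Space j k) {P : MvPolynomial (Fin (j + 1)) ℝ}
    {Q : MvPolynomial (Fin (k + 1)) ℝ} (hP : P.IsHomogeneous 1) (hQ : Q.IsHomogeneous 1) :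
    jacobiForm j k r g ⟨prodPoly P Q, prodPoly_isC1 P Q⟩ = 0 := by
  set F : c1Space j k := ⟨prodPoly P Q, prodPoly_isC1 P Q⟩
  have h1 : dirFstForm j k g F = j * ipForm j k g F := by
    have h := integral_dirFst_prodPoly g.2 P Q
    have e : ∀ x, g.1 x * prodPoly (rotLap P) Q x = -(2 * j) * (g.1 x * F.1 x) := fun x => by
      rw [prodPoly, polyEval_rotLap_of_isHomogeneous_one hP, show F.1 x = polyEval P _ * polyEval Q _ from rfl]
      ring
    simp_rw [e] at h
    rw [integral_const_mul] at h
    change ∫ x, dirFst g.1 (prodPoly P Q) x ∂prdMeasure j k = j * ∫ x, g.1 x * F.1 x ∂prdMeasure j k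
    linarith
  have h2 : dirSndForm j k g F = k * ipForm j k g F := by
    have h := integral_dirSnd_prodPoly g.2 P Q
    have e : ∀ x, g.1 x * prodPoly P (rotLap Q) x = -(2 * k) * (g.1 x * F.1 x) := fun x => by
      rw [prodPoly, polyEval_rotLap_of_isHomogeneous_one hQ, show F.1 x = polyEval P _ * polyEval Q _ from rfl]
      ring
    simp_rw [e] at h
    rw [integral_const_mul] at h
    change ∫ x, dirSnd g.1 (prodPoly P Q) x ∂prdMeasure j k = k * ∫ x, g.1 x * F.1 x ∂prdMeasure j k
    linarith
  rw [jacobiForm_apply, h1, h2]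
  ring

theorem inner_skew_self {E : Type*} [NormedAddCommGroup E] [InnerProductSpace ℝ E] {h : E →ₗ[ℝ] E}
    (hh : ∀ v w, inner ℝ (h v) w = -inner ℝ v (h w)) (v : E) : inner ℝ (h v) v = (0 : ℝ) := by
  have := hh v v
  rw [real_inner_comm v (h v)] at this
  linarith [real_inner_comm v (h v)]

/-- The form (v, w) ↦ ⟨hv, w⟩ is alternating, so a change of frame multiplies it by the determinant
-(s² + t²) = -1. Consequently the tangent space to the orbit does not depend on r. -/
theorem inner_skew_combination {E : Type*} [NormedAddCommGroup E] [InnerProductSpace ℝ E]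
    {h : E →ₗ[ℝ] E} (hh : ∀ v w, inner ℝ (h v) w = -inner ℝ v (h w)) (v w : E) (s t : ℝ)
    (hst : s ^ 2 + t ^ 2 = 1) :
    inner ℝ (h (s • v + t • w)) (t • v - s • w) = -inner ℝ (h v) w := by
  have h1 := hh w v
  rw [real_inner_comm] at h1
  simp only [map_add, map_smul, inner_add_left, inner_sub_right, real_inner_smul_left,
    real_inner_smul_right, inner_skew_self hh]
  have h2 : inner ℝ (h w) v = -inner ℝ (h v) w := by
    rw [hh w v, real_inner_comm]
  rw [h2]
  linear_combination (-inner ℝ (h v) w) * hst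

theorem sq_add_sqrt_sq {r : ℝ} (hr : r ∈ Ioo (0 : ℝ) 1) : r ^ 2 + √(1 - r ^ 2) ^ 2 = 1 := by
  rw [Real.sq_sqrt (by nlinarith [hr.1, hr.2])]
  ring

theorem clifford_eq (r : ℝ) (x : Prd j k) : clifford j k r x =
    r • (WithLp.toLp 2 ((x.1 : Euc j), (0 : Euc k)) : Amb j k) +
      √(1 - r ^ 2) • (WithLp.toLp 2 ((0 : Euc j), (x.2 : Euc k)) : Amb j k) := by
  refine WithLp.ofLp_injective 2 (Prod.ext ?_ ?_)
  · change r • (x.1 : Euc j) = r • (x.1 : Euc j) + √(1 - r ^ 2) • (0 : Euc j)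
    rw [smul_zero, add_zero]
  · change √(1 - r ^ 2) • (x.2 : Euc k) = r • (0 : Euc k) + √(1 - r ^ 2) • (x.2 : Euc k)
    rw [smul_zero, zero_add]

theorem normal_eq (r : ℝ) (x : Prd j k) : normal j k r x =
    √(1 - r ^ 2) • (WithLp.toLp 2 ((x.1 : Euc j), (0 : Euc k)) : Amb j k) -
      r • (WithLp.toLp 2 ((0 : Euc j), (x.2 : Euc k)) : Amb j k) := by
  refine WithLp.ofLp_injective 2 (Prod.ext ?_ ?_)
  · change √(1 - r ^ 2) • (x.1 : Euc j) = √(1 - r ^ 2) • (x.1 : Euc j) - r • (0 : Euc j)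
    rw [smul_zero, sub_zero]
  · change -(r • (x.2 : Euc k)) = √(1 - r ^ 2) • (0 : Euc k) - r • (x.2 : Euc k)
    rw [smul_zero, zero_sub]

theorem inner_skew_clifford {h : Amb j k →ₗ[ℝ] Amb j k}
    (hh : ∀ v w, inner ℝ (h v) w = -inner ℝ v (h w)) {r : ℝ} (hr : r ∈ Ioo (0 : ℝ) 1) (x : Prd j k) :
    inner ℝ (h (clifford j k r x)) (normal j k r x) =
      -inner ℝ (h (WithLp.toLp 2 ((x.1 : Euc j), (0 : Euc k))))
        (WithLp.toLp 2 ((0 : Euc j), (x.2 : Euc k)) : Amb j k) := by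
  rw [clifford_eq, normal_eq]
  exact inner_skew_combination hh _ _ _ _ (sq_add_sqrt_sq hr)

/-- The skew endomorphism of a product with off-diagonal block `A`. -/
def skewBlock (A : Euc j →ₗ[ℝ] Euc k) : Amb j k →ₗ[ℝ] Amb j k :=
  (toAmb j k).toLinearMap ∘ₗ ((LinearMap.adjoint A ∘ₗ (ambSnd j k).toLinearMap).prod
    (-(A ∘ₗ (ambFst j k).toLinearMap)))

theorem skewBlock_apply (A : Euc j →ₗ[ℝ] Euc k) (z : Amb j k) :
    skewBlock A z = WithLp.toLp 2 (LinearMap.adjoint A z.snd, -A z.fst) := rfl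

theorem skewBlock_skew (A : Euc j →ₗ[ℝ] Euc k) (v w : Amb j k) :
    inner ℝ (skewBlock A v) w = -inner ℝ v (skewBlock A w) := by
  rw [skewBlock_apply, skewBlock_apply, inner_toLp_left, inner_toLp_right,
    LinearMap.adjoint_inner_left, LinearMap.adjoint_inner_right, inner_neg_left, inner_neg_right]
  ring

/-- Only the off-diagonal block of an infinitesimal rotation moves the torus in the normal
direction, and every block A occurs, completed skew-symmetrically by its adjoint. -/
theorem mem_orbitTangent_iff {r : ℝ} (hr : r ∈ Ioo (0 : ℝ) 1) {f : Prd j k → ℝ} :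
    f ∈ orbitTangent j k r ↔
      ∃ A : Euc j →ₗ[ℝ] Euc k, ∀ x, f x = inner ℝ (A (x.1 : Euc j)) (x.2 : Euc k) := by
  constructor
  · rintro ⟨h, hh, hf⟩
    refine ⟨-((ambSnd j k).toLinearMap ∘ₗ h ∘ₗ (toAmb j k).toLinearMap ∘ₗ LinearMap.inl ℝ _ _), fun x => ?_⟩
    rw [hf, inner_skew_clifford hh hr, inner_toLp_right, inner_zero_right, zero_add, ← inner_neg_left]
    rfl
  · rintro ⟨A, hA⟩
    refine ⟨skewBlock A, skewBlock_skew A, fun x => ?_⟩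
    rw [inner_skew_clifford (skewBlock_skew A) hr, skewBlock_apply, inner_toLp_toLp, inner_zero_right,
      zero_add, inner_neg_left, neg_neg, hA]
    rfl

theorem isC2Holder_bilinear {α : ℝ≥0} (hα : α < 1) (A : Euc j →ₗ[ℝ] Euc k) :
    IsC2Holder α fun x : Prd j k => inner ℝ (A (x.1 : Euc j)) (x.2 : Euc k) := by
  have hΦ : ContDiff ℝ 3 fun z : Amb j k =>
      inner ℝ (LinearMap.toContinuousLinearMap A (ambFst j k z)) (ambSnd j k z) :=
    ((LinearMap.toContinuousLinearMap A).contDiff.comp (ambFst j k).contDiff).inner ℝ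
      (ambSnd j k).contDiff
  exact isC2Holder_of_contDiff hα hΦ

/-- In coordinates of the second factor ⟨Ap, q⟩ is a sum of products of a linear form in p and a
linear form in q. -/
theorem jacobiForm_bilinear (r : ℝ) (A : Euc j →ₗ[ℝ] Euc k) {f : c1Space j k}
    (hf : ∀ x, f.1 x = inner ℝ (A (x.1 : Euc j)) (x.2 : Euc k)) (g : c1Space j k) :
    jacobiForm j k r g f = 0 := by
  choose P hP hPe using fun b : Fin (k + 1) => exists_isHomogeneous_one_of_linear
    ((EuclideanSpace.proj b : Euc k →L[ℝ] ℝ).toLinearMap ∘ₗ A)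
  have e : f = ∑ b, (⟨prodPoly (P b) (X b), prodPoly_isC1 _ _⟩ : c1Space j k) := by
    ext x
    rw [hf, Submodule.coe_sum, Finset.sum_apply, PiLp.inner_apply]
    refine Finset.sum_congr rfl fun b _ => ?_
    simp only [prodPoly, hPe]
    simp [polyEval, mul_comm]
  rw [e, map_sum]
  exact Finset.sum_eq_zero fun b _ => jacobiForm_prodPoly_linear r g (hP b) (isHomogeneous_X ℝ b)

theorem exists_bilinear_prodHarm (i : HarmIdx j × HarmIdx k) (h : (i.1.1, i.2.1) = (1, 1)) :
    ∃ A : Euc j →ₗ[ℝ] Euc k, ∀ x, prodHarm i x = inner ℝ (A (x.1 : Euc j)) (x.2 : Euc k) := by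
  have h1 := harmPoly_isHomogeneous i.1
  have h2 := harmPoly_isHomogeneous i.2
  rw [Prod.mk.injEq] at h
  rw [h.1] at h1
  rw [h.2] at h2
  obtain ⟨ℓ, hℓ⟩ := exists_linear_of_isHomogeneous_one h1
  obtain ⟨m, hm⟩ := exists_linear_of_isHomogeneous_one h2
  refine ⟨ℓ.toLinearMap.smulRight ((InnerProductSpace.toDual ℝ (Euc k)).symm m), fun x => ?_⟩
  rw [prodHarm, prodPoly, hℓ, hm]
  change _ = inner ℝ (ℓ (x.1 : Euc j) • (InnerProductSpace.toDual ℝ (Euc k)).symm m) (x.2 : Euc k)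
  rw [real_inner_smul_left, InnerProductSpace.toDual_symm_apply]

theorem modeEig_nonneg {r : ℝ} (hr : r ∈ Ioo (0 : ℝ) 1) {a b : ℕ} (ha : 1 ≤ a) (hb : 1 ≤ b) :
    0 ≤ modeEig j k r a b := by
  have h1 : 0 < r ^ 2 := pow_pos hr.1 2
  have h2 : 0 < 1 - r ^ 2 := by nlinarith [hr.1, hr.2]
  have ha' : (0 : ℝ) ≤ a - 1 := sub_nonneg.2 (by exact_mod_cast ha)
  have hb' : (0 : ℝ) ≤ b - 1 := sub_nonneg.2 (by exact_mod_cast hb)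
  rw [modeEig]
  positivity

theorem modeEig_eq_zero {r : ℝ} (hr : r ∈ Ioo (0 : ℝ) 1) {a b : ℕ} (ha : 1 ≤ a) (hb : 1 ≤ b)
    (h : modeEig j k r a b = 0) : (a, b) = (1, 1) := by
  have h1 : 0 < r ^ 2 := pow_pos hr.1 2
  have h2 : 0 < 1 - r ^ 2 := by nlinarith [hr.1, hr.2]
  have ha0 : (1 : ℝ) ≤ a := by exact_mod_cast ha
  have hb0 : (1 : ℝ) ≤ b := by exact_mod_cast hb
  have ha' : (0 : ℝ) ≤ a - 1 := sub_nonneg.2 ha0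
  have hb' : (0 : ℝ) ≤ b - 1 := sub_nonneg.2 hb0
  rw [modeEig, add_eq_zero_iff_of_nonneg (by positivity) (by positivity)] at h
  have e1 : ((a : ℝ) - 1) * (a + j) = 0 := (div_eq_zero_iff.1 h.1).resolve_right h1.ne'
  have e2 : ((b : ℝ) - 1) * (b + k) = 0 := (div_eq_zero_iff.1 h.2).resolve_right h2.ne'
  have e1' : (a : ℝ) = 1 := by
    have := (mul_eq_zero.1 e1).resolve_right (by positivity)
    linarith
  have e2' : (b : ℝ) = 1 := by
    have := (mul_eq_zero.1 e2).resolve_right (by positivity)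
    linarith
  exact Prod.ext (by exact_mod_cast e1') (by exact_mod_cast e2')

/-- The modes that depend on one of the factors only are not tangent to the orbit. -/
theorem prodHarm_ne_bilinear (hj : 1 ≤ j) (hk : 1 ≤ k) {i : HarmIdx j × HarmIdx k}
    (h : i.1.1 = 0 ∨ i.2.1 = 0) (A : Euc j →ₗ[ℝ] Euc k)
    (hA : ∀ x, prodHarm i x = inner ℝ (A (x.1 : Euc j)) (x.2 : Euc k)) : False := by
  have h1 := harmPoly_isHomogeneous i.1
  have h2 := harmPoly_isHomogeneous i.2
  have hz : ∀ x, prodHarm i x = 0 := by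
    rintro ⟨p, q⟩
    rcases h with h | h
    · rw [h] at h1
      -- The mode does not depend on p, whereas a bilinear function is odd in p; so it would vanish
      -- identically, contrary to its normalization.
      have e : prodHarm i (-p, q) = prodHarm i (p, q) := by
        simp only [prodHarm, prodPoly, polyEval_of_isHomogeneous_zero h1]
      rw [hA, hA] at e
      simp only [coe_neg_sphere, map_neg, inner_neg_left] at e
      rw [hA]
      linarith
    · rw [h] at h2
      have e : prodHarm i (p, -q) = prodHarm i (p, q) := by
        simp only [prodHarm, prodPoly, polyEval_of_isHomogeneous_zero h2]
      rw [hA, hA] at e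
      simp only [coe_neg_sphere, inner_neg_right] at e
      rw [hA]
      linarith
  have h := integral_prodHarm_mul hj hk i i
  simp [hz] at h

/-- The orbit is nondegenerate if and only if only the modes of degrees `(1, 1)` are null modes. -/
theorem isNondegenerate_iff (hj : 1 ≤ j) (hk : 1 ≤ k) {α : ℝ≥0} (hα : α < 1) {r : ℝ}
    (hr : r ∈ Ioo (0 : ℝ) 1) :
    IsNondegenerate j k α r (-logSlope j k (Real.arcsin r)) ↔
      ∀ i : HarmIdx j × HarmIdx k, modeEig j k r i.1.1 i.2.1 = 0 → (i.1.1, i.2.1) = (1, 1) := by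
  classical
  have hG : torusArea j k (Real.arcsin r) ≠ 0 := (torusArea_arcsin_pos hr).ne'
  have hker : ∀ f : c1Space j k, (∀ g : c1Space j k, jacobiForm j k r g f = 0) →
      ∀ g, IsC2Holder α g → secondVariation j k r (-logSlope j k (Real.arcsin r)) f g = 0 := by
    intro f hf g hg
    have := secondVariation_eq_jacobiForm hr f ⟨g, hg.isC1⟩
    rw [jacobiForm_symm, hf, mul_zero] at this
    exact this
  constructor
  · intro h i hi
    by_contra hne
    have h0 : i.1.1 = 0 ∨ i.2.1 = 0 := by
      by_contra! hcon
      exact hne (modeEig_eq_zero hr (Nat.one_le_iff_ne_zero.2 hcon.1) (Nat.one_le_iff_ne_zero.2 hcon.2) hi)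
    have hmem : prodHarm i ∈ orbitTangent j k r := by
      rw [← h]
      refine ⟨prodPoly_isC2Holder hα _ _, hker (mode i) fun g => ?_⟩
      rw [jacobiForm_mode, hi, zero_mul]
    obtain ⟨A, hA⟩ := (mem_orbitTangent_iff hr).1 hmem
    exact prodHarm_ne_bilinear hj hk h0 A hA
  · intro h
    refine Subset.antisymm ?_ ?_
    · rintro f ⟨hf, hfk⟩
      let F : c1Space j k := ⟨f, hf.isC1⟩
      have hcoef : ∀ i, (i.1.1, i.2.1) ≠ (1, 1) → ipForm j k F (mode i) = 0 := by
        intro i hi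
        have h1 := secondVariation_eq_jacobiForm hr F (mode i)
        rw [show secondVariation j k r (-logSlope j k (Real.arcsin r)) F (mode i) = 0 from
          hfk _ (prodPoly_isC2Holder hα _ _), jacobiForm_mode] at h1
        rcases mul_eq_zero.1 h1.symm with h2 | h2
        · exact absurd h2 hG
        · exact (mul_eq_zero.1 h2).resolve_left fun h3 => hi (h i h3)
      set S := modesOf j k {(1, 1)}
      have hS : ∀ i, i ∈ S ↔ (i.1.1, i.2.1) = (1, 1) := fun i => by
        rw [mem_modesOf, Finset.mem_singleton]
      -- The kernel element minus its part of degrees (1, 1) is orthogonal to every mode, hence 0 by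
      -- completeness.
      have hF : F = partialSum (ipForm j k) mode S F := by
        refine sub_eq_zero.1 (eq_zero_of_ipForm_self _ (ip_self_eq_zero ipForm_symm ipForm_self_nonneg
          (ipForm_mode hj hk) (fun f ε hε => exists_span_mode_approx f hε) fun i => ?_))
        rw [map_sub, LinearMap.sub_apply]
        by_cases hi : i ∈ S
        · rw [ip_partialSum (ipForm_mode hj hk) S F hi, sub_self]
        · rw [hcoef i fun h => hi ((hS i).2 h), zero_sub, neg_eq_zero, partialSum, map_sum,
            LinearMap.sum_apply]
          refine Finset.sum_eq_zero fun i' hi' => ?_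
          rw [map_smul, LinearMap.smul_apply, ipForm_mode hj hk, if_neg, smul_zero]
          rintro rfl
          exact hi hi'
      choose! A hA using fun (i : HarmIdx j × HarmIdx k) (hi : (i.1.1, i.2.1) = (1, 1)) =>
        exists_bilinear_prodHarm i hi
      refine (mem_orbitTangent_iff hr).2 ⟨∑ i ∈ S, ipForm j k F (mode i) • A i, fun x => ?_⟩
      have hfx : f x = (partialSum (ipForm j k) mode S F).1 x := congrArg (fun F => F.1 x) hF
      rw [hfx, partialSum, Submodule.coe_sum, Finset.sum_apply, LinearMap.sum_apply, sum_inner]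
      refine Finset.sum_congr rfl fun i hi => ?_
      rw [LinearMap.smul_apply, real_inner_smul_left, ← hA i ((hS i).1 hi) x]
      rfl
    · intro f hf
      obtain ⟨A, hA⟩ := (mem_orbitTangent_iff hr).1 hf
      have hf2 : IsC2Holder α f := by
        rw [funext hA]
        exact isC2Holder_bilinear hα A
      exact ⟨hf2, hker ⟨f, hf2.isC1⟩ fun g => jacobiForm_bilinear r A hA g⟩

end Kernel

/-! ### Degeneracy instants and jumps of the indices -/

section Jumps

open Filter Topology

/-- Pascal's rule twice: the subtracted coefficient is one of the summands, and another summand is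
positive because d ≥ 1. -/
theorem mult_pos {d : ℕ} (hd : 1 ≤ d) {i : ℕ} (hi : 3 ≤ i) : 0 < mult d i := by
  obtain ⟨n, rfl⟩ := Nat.exists_eq_add_of_le' hi
  have e1 : d + (n + 3) - 1 = d + n + 1 + 1 := by omega
  have e2 : d + (n + 3) - 3 = d + n := by omega
  have e3 : n + 3 - 1 = n + 1 + 1 := rfl
  rw [mult, e1, e2, e3, Nat.add_sub_cancel, Nat.choose_succ_succ', Nat.choose_succ_succ']
  have : 0 < (d + n + 1).choose (n + 1 + 1) := Nat.choose_pos (by omega)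
  omega

theorem harmDim_pos {d : ℕ} (hd : 1 ≤ d) (n : ℕ) : 0 < harmDim d n := by
  match n with
  | 0 => rw [harmDim_zero]; exact one_pos
  | 1 => rw [harmDim_one]; exact d.succ_pos
  | n + 2 =>
    have h := harmDim_eq_mult d (i := n + 3) (by omega)
    have := mult_pos hd (i := n + 3) (by omega)
    rw [← h] at this
    exact_mod_cast this

variable {j k : ℕ}

theorem sq_mem {r : ℝ} (hr : r ∈ Ioo (0 : ℝ) 1) : 0 < r ^ 2 ∧ 0 < 1 - r ^ 2 :=
  ⟨pow_pos hr.1 2, by nlinarith [hr.1, hr.2]⟩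

theorem modeEig_one_one (r : ℝ) : modeEig j k r 1 1 = 0 := by simp [modeEig]

theorem continuousAt_div_sq {r : ℝ} (hr : r ∈ Ioo (0 : ℝ) 1) (c : ℝ) :
    ContinuousAt (fun r : ℝ => c / r ^ 2) r ∧ ContinuousAt (fun r : ℝ => c / (1 - r ^ 2)) r := by
  obtain ⟨h1, h2⟩ := sq_mem hr
  have e : ContinuousAt (fun r : ℝ => r ^ 2) r := (continuous_pow 2).continuousAt
  exact ⟨continuousAt_const.div e h1.ne', continuousAt_const.div (continuousAt_const.sub e) h2.ne'⟩

theorem continuousAt_modeEig {r : ℝ} (hr : r ∈ Ioo (0 : ℝ) 1) (a b : ℕ) :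
    ContinuousAt (fun r => modeEig j k r a b) r := by
  exact (continuousAt_div_sq hr _).1.add (continuousAt_div_sq hr _).2

/-- At least linear growth in the degree, uniformly in s < 1; it bounds the degrees of negative
modes. -/
theorem sub_one_le_div {d a : ℕ} {s : ℝ} (hd : 1 ≤ d) (ha : 1 ≤ a) (h0 : 0 < s) (h1 : s < 1) :
    (a : ℝ) - 1 ≤ ((a : ℝ) - 1) * (a + d) / s := by
  have ha' : (0 : ℝ) ≤ a - 1 := sub_nonneg.2 (by exact_mod_cast ha)
  have hd' : (1 : ℝ) ≤ a + d := by exact_mod_cast (by omega : 1 ≤ a + d)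
  rw [le_div_iff₀ h0]
  exact mul_le_mul_of_nonneg_left (h1.le.trans hd') ha'

/-- Locally uniformly in `r`, there are only finitely many negative modes. -/
theorem exists_finset_negative_modes (hj : 1 ≤ j) (hk : 1 ≤ k) {r₀ : ℝ} (hr₀ : r₀ ∈ Ioo (0 : ℝ) 1) :
    ∃ S : Finset (ℕ × ℕ), ∀ᶠ r in 𝓝 r₀, ∀ a b, modeEig j k r a b < 0 → (a, b) ∈ S := by
  -- A negative mode (a, 0) with a ≥ 1 satisfies a - 1 < k/(1 - r²), and (0, b) with b ≥ 1 satisfies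
  -- b - 1 < j/r². M exceeds both bounds at r₀ and, by continuity, nearby.
  obtain ⟨M, hM⟩ := exists_nat_gt (1 + k / (1 - r₀ ^ 2) + j / r₀ ^ 2)
  have hc1 : ContinuousAt (fun r : ℝ => 1 + k / (1 - r ^ 2) + j / r ^ 2) r₀ :=
    (continuousAt_const.add (continuousAt_div_sq hr₀ _).2).add (continuousAt_div_sq hr₀ _).1
  refine ⟨Finset.range (M + 1) ×ˢ Finset.range (M + 1), ?_⟩
  filter_upwards [hc1.eventually_lt_const hM, Ioo_mem_nhds hr₀.1 hr₀.2] with r hr hr' a b hab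
  obtain ⟨h1, h2⟩ := sq_mem hr'
  have p1 : 0 ≤ (k : ℝ) / (1 - r ^ 2) := by positivity
  have p2 : 0 ≤ (j : ℝ) / r ^ 2 := by positivity
  simp only [Finset.mem_product, Finset.mem_range, Nat.lt_succ_iff]
  rcases Nat.eq_zero_or_pos a with rfl | ha
  · refine ⟨M.zero_le, ?_⟩
    rcases Nat.eq_zero_or_pos b with rfl | hb
    · exact M.zero_le
    · have := sub_one_le_div hk hb h2 (by linarith)
      rw [modeEig, Nat.cast_zero, zero_sub, zero_add, neg_one_mul, neg_div] at hab
      exact_mod_cast (by linarith : (b : ℝ) < M).le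
  · rcases Nat.eq_zero_or_pos b with rfl | hb
    · refine ⟨?_, M.zero_le⟩
      have := sub_one_le_div hj ha h1 (by linarith)
      rw [modeEig, Nat.cast_zero, zero_sub, zero_add, neg_one_mul, neg_div] at hab
      exact_mod_cast (by linarith : (a : ℝ) < M).le
    · exact absurd hab (not_lt.2 (modeEig_nonneg hr' ha hb))

theorem exists_finset_eq_negative_modes (hj : 1 ≤ j) (hk : 1 ≤ k) {r : ℝ} (hr : r ∈ Ioo (0 : ℝ) 1) :
    ∃ D : Finset (ℕ × ℕ), ∀ a b, (a, b) ∈ D ↔ modeEig j k r a b < 0 := by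
  classical
  obtain ⟨S, hS⟩ := exists_finset_negative_modes hj hk hr
  refine ⟨{p ∈ S | modeEig j k r p.1 p.2 < 0}, fun a b => ?_⟩
  rw [Finset.mem_filter]
  exact ⟨fun h => h.2, fun h => ⟨hS.self_of_nhds a b h, h⟩⟩

/-- Near an instant with the only null mode `p₀` besides `(1, 1)`, only the sign of `p₀` varies. -/
theorem exists_negative_modes_near (hj : 1 ≤ j) (hk : 1 ≤ k) {r₀ : ℝ} (hr₀ : r₀ ∈ Ioo (0 : ℝ) 1)
    {p₀ : ℕ × ℕ} (hp₀ : modeEig j k r₀ p₀.1 p₀.2 = 0)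
    (huniq : ∀ a b, modeEig j k r₀ a b = 0 → (a, b) = (1, 1) ∨ (a, b) = p₀) :
    ∃ ε > (0 : ℝ), Ioo (r₀ - ε) (r₀ + ε) ⊆ Ioo 0 1 ∧ ∃ D : Finset (ℕ × ℕ), p₀ ∉ D ∧
      ∀ r ∈ Ioo (r₀ - ε) (r₀ + ε), ∀ a b, modeEig j k r a b < 0 ↔
        (a, b) ∈ D ∨ ((a, b) = p₀ ∧ modeEig j k r p₀.1 p₀.2 < 0) := by
  classical
  obtain ⟨S, hS⟩ := exists_finset_negative_modes hj hk hr₀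
  -- Eigenvalues that are nonzero at r₀ keep their sign nearby. One neighbourhood serves all because
  -- only the finite set S can contain negative modes.
  have hsign : ∀ᶠ r in 𝓝 r₀, ∀ p ∈ S,
      (modeEig j k r₀ p.1 p.2 < 0 → modeEig j k r p.1 p.2 < 0) ∧
      (0 < modeEig j k r₀ p.1 p.2 → 0 < modeEig j k r p.1 p.2) := by
    rw [Filter.eventually_all_finset]
    intro p _
    have hc := continuousAt_modeEig (j := j) (k := k) hr₀ p.1 p.2
    rcases lt_trichotomy (modeEig j k r₀ p.1 p.2) 0 with h | h | h
    · filter_upwards [hc.eventually_lt_const h] with r hr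
      exact ⟨fun _ => hr, fun h' => absurd h' h.not_gt⟩
    · exact Eventually.of_forall fun r => ⟨fun h' => absurd h h'.ne, fun h' => absurd h h'.ne'⟩
    · filter_upwards [hc.eventually_const_lt h] with r hr
      exact ⟨fun h' => absurd h' h.not_gt, fun _ => hr⟩
  obtain ⟨ε, hε, H⟩ := Metric.eventually_nhds_iff_ball.1
    ((hS.and hsign).and (Ioo_mem_nhds hr₀.1 hr₀.2))
  rw [Real.ball_eq_Ioo] at H
  refine ⟨ε, hε, fun r hr => (H r hr).2, {p ∈ S | modeEig j k r₀ p.1 p.2 < 0}, ?_, ?_⟩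
  · rw [Finset.mem_filter, hp₀]
    exact fun h => lt_irrefl _ h.2
  · intro r hr a b
    obtain ⟨⟨h1, h2⟩, -⟩ := H r hr
    rw [Finset.mem_filter]
    constructor
    · intro h
      have hS' := h1 a b h
      rcases lt_trichotomy (modeEig j k r₀ a b) 0 with h' | h' | h'
      · exact Or.inl ⟨hS', h'⟩
      · rcases huniq a b h' with e | rfl
        · rw [Prod.mk.injEq] at e
          rw [e.1, e.2, modeEig_one_one] at h
          exact absurd h (lt_irrefl _)
        · exact Or.inr ⟨rfl, h⟩
      · exact absurd ((h2 (a, b) hS').2 h') h.not_gt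
    · rintro (⟨h, h'⟩ | ⟨rfl, h⟩)
      · exact (h2 (a, b) h).1 h'
      · exact h

/-- The indices jump at an instant at which a mode changes its sign. -/
theorem hasJump_of_mode (hj : 1 ≤ j) (hk : 1 ≤ k) {α : ℝ≥0} (hα : α < 1) {r₀ : ℝ}
    (hr₀ : r₀ ∈ Ioo (0 : ℝ) 1) {p₀ : ℕ × ℕ} (hp₀ : modeEig j k r₀ p₀.1 p₀.2 = 0)
    (huniq : ∀ a b, modeEig j k r₀ a b = 0 → (a, b) = (1, 1) ∨ (a, b) = p₀)
    (hsign : (∀ r ∈ Ioo (0 : ℝ) 1, modeEig j k r p₀.1 p₀.2 < 0 ↔ r₀ < r) ∨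
      (∀ r ∈ Ioo (0 : ℝ) 1, modeEig j k r p₀.1 p₀.2 < 0 ↔ r < r₀)) :
    HasJump (fun r => strongMorseIndex j k α r (-logSlope j k (Real.arcsin r))) r₀
        (harmDim j p₀.1 * harmDim k p₀.2 : ℕ) ∧
      HasJump (fun r => weakMorseIndex j k α r (-logSlope j k (Real.arcsin r))) r₀
        (harmDim j p₀.1 * harmDim k p₀.2 : ℕ) := by
  classical
  obtain ⟨ε, hε, hsub, D, hpD, hD⟩ := exists_negative_modes_near hj hk hr₀ hp₀ huniq
  have hmem : ∀ r ∈ Ioo (r₀ - ε) (r₀ + ε), ∀ a b,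
      (a, b) ∈ (if modeEig j k r p₀.1 p₀.2 < 0 then insert p₀ D else D) ↔ modeEig j k r a b < 0 := by
    intro r hr a b
    refine Iff.trans ?_ (hD r hr a b).symm
    split_ifs with h
    · simp [h, or_comm]
    · simp [h]
  have hp0 : p₀ ≠ (0, 0) := by
    rintro rfl
    exact (modeEig_zero_neg hj hr₀).ne hp₀
  -- The constant mode is negative on both sides, so its removal lowers both counts equally and the
  -- weak index has the same jump.
  have h0 : (0, 0) ∈ D := by
    have hr : r₀ ∈ Ioo (r₀ - ε) (r₀ + ε) := ⟨by linarith, by linarith⟩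
    exact ((hD r₀ hr 0 0).1 (modeEig_zero_neg hj hr₀)).resolve_right fun h => hp0 h.1.symm
  have hstrong := fun r hr => strongMorseIndex_eq hj hk hα (hsub hr) (hmem r hr)
  have hweak := fun r hr => weakMorseIndex_eq hj hk hα (hsub hr) (hmem r hr)
  have hcard : (modesOf j k (insert p₀ D)).card =
      harmDim j p₀.1 * harmDim k p₀.2 + (modesOf j k D).card := by
    rw [card_modesOf, card_modesOf, Finset.sum_insert hpD]
  have c1 := card_modesOf_sdiff (j := j) (k := k) h0
  have c2 := card_modesOf_sdiff (j := j) (k := k) (Finset.mem_insert_of_mem (b := p₀) h0)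
  have hleft : Ioo (r₀ - ε) r₀ ⊆ Ioo (r₀ - ε) (r₀ + ε) := Ioo_subset_Ioo_right (by linarith)
  have hright : Ioo r₀ (r₀ + ε) ⊆ Ioo (r₀ - ε) (r₀ + ε) := Ioo_subset_Ioo_left (by linarith)
  rcases hsign with hs | hs
  · have hl : ∀ r ∈ Ioo (r₀ - ε) r₀, ¬ modeEig j k r p₀.1 p₀.2 < 0 := fun r hr =>
      mt (hs r (hsub (hleft hr))).1 hr.2.not_gt
    have hr : ∀ r ∈ Ioo r₀ (r₀ + ε), modeEig j k r p₀.1 p₀.2 < 0 := fun r hr =>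
      (hs r (hsub (hright hr))).2 hr.1
    refine ⟨⟨ε, hε, _, _, fun r h => (hstrong r (hleft h)).trans (by rw [if_neg (hl r h)]),
      fun r h => (hstrong r (hright h)).trans (by rw [if_pos (hr r h)]), ?_⟩,
      ⟨ε, hε, _, _, fun r h => (hweak r (hleft h)).trans (by rw [if_neg (hl r h)]),
      fun r h => (hweak r (hright h)).trans (by rw [if_pos (hr r h)]), ?_⟩⟩
    · rw [hcard, abs_of_nonneg] <;> push_cast <;> nlinarith
    · rw [abs_of_nonneg] <;> omega
  · have hl : ∀ r ∈ Ioo (r₀ - ε) r₀, modeEig j k r p₀.1 p₀.2 < 0 := fun r hr =>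
      (hs r (hsub (hleft hr))).2 hr.2
    have hr : ∀ r ∈ Ioo r₀ (r₀ + ε), ¬ modeEig j k r p₀.1 p₀.2 < 0 := fun r hr =>
      mt (hs r (hsub (hright hr))).1 hr.1.not_gt
    refine ⟨⟨ε, hε, _, _, fun r h => (hstrong r (hleft h)).trans (by rw [if_pos (hl r h)]),
      fun r h => (hstrong r (hright h)).trans (by rw [if_neg (hr r h)]), ?_⟩,
      ⟨ε, hε, _, _, fun r h => (hweak r (hleft h)).trans (by rw [if_pos (hl r h)]),
      fun r h => (hweak r (hright h)).trans (by rw [if_neg (hr r h)]), ?_⟩⟩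
    · rw [hcard, abs_of_nonpos] <;> omega
    · rw [abs_of_nonpos] <;> omega

/-! ### The null modes -/

theorem modeEig_left {r : ℝ} (hr : r ∈ Ioo (0 : ℝ) 1) (a : ℕ) :
    modeEig j k r a 0 = (((a : ℝ) - 1) * (a + j) - (k + ((a : ℝ) - 1) * (a + j)) * r ^ 2) /
      (r ^ 2 * (1 - r ^ 2)) := by
  obtain ⟨h1, h2⟩ := sq_mem hr
  rw [modeEig, div_add_div _ _ h1.ne' h2.ne', Nat.cast_zero]
  congr 1
  ring

theorem modeEig_right {r : ℝ} (hr : r ∈ Ioo (0 : ℝ) 1) (b : ℕ) :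
    modeEig j k r 0 b = ((j + ((b : ℝ) - 1) * (b + k)) * r ^ 2 - j) / (r ^ 2 * (1 - r ^ 2)) := by
  obtain ⟨h1, h2⟩ := sq_mem hr
  rw [modeEig, div_add_div _ _ h1.ne' h2.ne', Nat.cast_zero]
  congr 1
  ring

theorem sqrt_div_mem_Ioo {x y : ℝ} (hx : 0 < x) (hy : 0 < y) : √(x / (y + x)) ∈ Ioo (0 : ℝ) 1 := by
  refine ⟨Real.sqrt_pos.2 (by positivity), ?_⟩
  rw [Real.sqrt_lt' one_pos, one_pow, div_lt_one (by positivity)]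
  linarith

theorem lt_mul_sub_one {d a : ℕ} (hd : 1 ≤ d) (ha : 2 ≤ a) : (d : ℝ) < ((a : ℝ) - 1) * (a + d) := by
  have ha' : (2 : ℝ) ≤ a := by exact_mod_cast ha
  have hd' : (1 : ℝ) ≤ d := by exact_mod_cast hd
  nlinarith

/-- The difference of the two sides factors as (a - b)(a + b + d - 1), with a positive second
factor. -/
theorem mul_sub_one_injective {d a b : ℕ} (hd : 1 ≤ d) (h : ((a : ℝ) - 1) * (a + d) = ((b : ℝ) - 1) * (b + d))
    (hab : 1 ≤ a + b) : a = b := by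
  have hd' : (1 : ℝ) ≤ d := by exact_mod_cast hd
  have hab' : (1 : ℝ) ≤ a + b := by exact_mod_cast hab
  have e : ((a : ℝ) - b) * (a + b + d - 1) = 0 := by linear_combination h
  have h' := (mul_eq_zero.1 e).resolve_right (by linarith)
  exact_mod_cast sub_eq_zero.1 h'

theorem modeEig_one_left_neg (hk : 1 ≤ k) {r : ℝ} (hr : r ∈ Ioo (0 : ℝ) 1) : modeEig j k r 1 0 < 0 := by
  obtain ⟨h1, h2⟩ := sq_mem hr
  have hk' : (0 : ℝ) < k := by exact_mod_cast hk
  rw [modeEig_left hr]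
  refine div_neg_of_neg_of_pos ?_ (mul_pos h1 h2)
  have := mul_pos hk' h1
  simpa using this

theorem modeEig_one_right_neg (hj : 1 ≤ j) {r : ℝ} (hr : r ∈ Ioo (0 : ℝ) 1) : modeEig j k r 0 1 < 0 := by
  obtain ⟨h1, h2⟩ := sq_mem hr
  have hj' : (0 : ℝ) < j := by exact_mod_cast hj
  rw [modeEig_right hr]
  refine div_neg_of_neg_of_pos ?_ (mul_pos h1 h2)
  have := mul_pos hj' h2
  simp only [Nat.cast_one, sub_self, zero_mul, add_zero]
  linarith

/-- A null mode of degrees different from `(1, 1)` depends on one of the factors only. -/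
theorem null_mode_cases (hj : 1 ≤ j) (hk : 1 ≤ k) {r : ℝ} (hr : r ∈ Ioo (0 : ℝ) 1) {a b : ℕ}
    (h : modeEig j k r a b = 0) : (a, b) = (1, 1) ∨ (2 ≤ a ∧ b = 0) ∨ (a = 0 ∧ 2 ≤ b) := by
  match a, b with
  | 0, 0 => exact absurd h (modeEig_zero_neg hj hr).ne
  | 0, 1 => exact absurd h (modeEig_one_right_neg hj hr).ne
  | 1, 0 => exact absurd h (modeEig_one_left_neg hk hr).ne
  | 0, b + 2 => exact Or.inr (Or.inr ⟨rfl, by omega⟩)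
  | a + 2, 0 => exact Or.inr (Or.inl ⟨by omega, rfl⟩)
  | a + 1, b + 1 => exact Or.inl (modeEig_eq_zero hr (by omega) (by omega) h)

theorem left_null_iff {r : ℝ} (hr : r ∈ Ioo (0 : ℝ) 1) (a : ℕ) :
    modeEig j k r a 0 = 0 ↔ (k + ((a : ℝ) - 1) * (a + j)) * r ^ 2 = ((a : ℝ) - 1) * (a + j) := by
  obtain ⟨h1, h2⟩ := sq_mem hr
  rw [modeEig_left hr, div_eq_zero_iff, or_iff_left (mul_pos h1 h2).ne', sub_eq_zero, eq_comm]

theorem right_null_iff {r : ℝ} (hr : r ∈ Ioo (0 : ℝ) 1) (b : ℕ) :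
    modeEig j k r 0 b = 0 ↔ (j + ((b : ℝ) - 1) * (b + k)) * r ^ 2 = j := by
  obtain ⟨h1, h2⟩ := sq_mem hr
  rw [modeEig_right hr, div_eq_zero_iff, or_iff_left (mul_pos h1 h2).ne', sub_eq_zero]

/-- At every instant there is at most one pair of degrees of null modes besides `(1, 1)`. -/
theorem null_mode_unique (hj : 1 ≤ j) (hk : 1 ≤ k) {r : ℝ} (hr : r ∈ Ioo (0 : ℝ) 1) {a b a' b' : ℕ}
    (h : modeEig j k r a b = 0) (hne : (a, b) ≠ (1, 1)) (h' : modeEig j k r a' b' = 0) :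
    (a', b') = (1, 1) ∨ (a', b') = (a, b) := by
  obtain ⟨h1, h2⟩ := sq_mem hr
  have hj' : (0 : ℝ) < j := by exact_mod_cast hj
  have hk' : (0 : ℝ) < k := by exact_mod_cast hk
  -- With β > j and γ > k, simultaneous vanishing would give k r² = β(1 - r²) > j(1 - r²) = γ r² > k
  -- r².
  have cross : ∀ a b : ℕ, 2 ≤ a → 2 ≤ b → modeEig j k r a 0 = 0 → modeEig j k r 0 b = 0 → False := by
    intro a b ha hb e1 e2
    have l1 := lt_mul_sub_one hj ha
    have l2 := lt_mul_sub_one hk hb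
    rw [left_null_iff hr] at e1
    rw [right_null_iff hr] at e2
    set β := ((a : ℝ) - 1) * (a + j)
    set γ := ((b : ℝ) - 1) * (b + k)
    have e3 : β * (1 - r ^ 2) = k * r ^ 2 := by linear_combination -e1
    have e4 : γ * r ^ 2 = j * (1 - r ^ 2) := by linear_combination e2
    have l3 := mul_lt_mul_of_pos_right l1 h2
    have l4 := mul_lt_mul_of_pos_right l2 h1
    linarith
  refine (null_mode_cases hj hk hr h').imp id fun c' => ?_
  rcases (null_mode_cases hj hk hr h).resolve_left hne with ⟨ha, rfl⟩ | ⟨rfl, hb⟩ <;>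
    rcases c' with ⟨ha', rfl⟩ | ⟨rfl, hb'⟩
  · rw [left_null_iff hr] at h h'
    have e : (((a' : ℝ) - 1) * (a' + j) - ((a : ℝ) - 1) * (a + j)) * (1 - r ^ 2) = 0 := by
      linear_combination h - h'
    rw [mul_sub_one_injective hj (sub_eq_zero.1 ((mul_eq_zero.1 e).resolve_right h2.ne')) (by omega)]
  · exact (cross a b' ha hb' h h').elim
  · exact (cross a' b ha' hb h' h).elim
  · rw [right_null_iff hr] at h h'
    have e : (((b' : ℝ) - 1) * (b' + k) - ((b : ℝ) - 1) * (b + k)) * r ^ 2 = 0 := by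
      linear_combination h' - h
    rw [mul_sub_one_injective hk (sub_eq_zero.1 ((mul_eq_zero.1 e).resolve_right h1.ne')) (by omega)]

/-- With β = (a - 1)(a + j) > 0 the sign is that of β - (k + β)r²: the mode turns negative as r
increases, and the index grows across r_i. -/
theorem modeEig_left_neg_iff (hj : 1 ≤ j) {a : ℕ} (ha : 2 ≤ a) {r : ℝ} (hr : r ∈ Ioo (0 : ℝ) 1) :
    modeEig j k r a 0 < 0 ↔ √(((a : ℝ) - 1) * (a + j) / (k + ((a : ℝ) - 1) * (a + j))) < r := by
  obtain ⟨h1, h2⟩ := sq_mem hr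
  have l := (Nat.cast_nonneg j).trans_lt (lt_mul_sub_one hj ha)
  rw [modeEig_left hr, div_neg_iff, Real.sqrt_lt' hr.1, div_lt_iff₀ (by positivity)]
  have := mul_pos h1 h2
  constructor
  · rintro (h | h) <;> linarith
  · exact fun h => Or.inr ⟨by linarith, this⟩

/-- Here the sign is that of (j + γ)r² - j with γ = (b - 1)(b + k), which increases with r; the
index drops across s_l. -/
theorem modeEig_right_neg_iff (hk : 1 ≤ k) {b : ℕ} (hb : 2 ≤ b) {r : ℝ} (hr : r ∈ Ioo (0 : ℝ) 1) :
    modeEig j k r 0 b < 0 ↔ r < √((j : ℝ) / (j + ((b : ℝ) - 1) * (b + k))) := by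
  obtain ⟨h1, h2⟩ := sq_mem hr
  have l := (Nat.cast_nonneg k).trans_lt (lt_mul_sub_one hk hb)
  rw [modeEig_right hr, div_neg_iff, Real.lt_sqrt hr.1.le, lt_div_iff₀ (by positivity)]
  have := mul_pos h1 h2
  constructor
  · rintro (h | h) <;> linarith
  · exact fun h => Or.inr ⟨by linarith, this⟩

theorem modeEig_left_eq_zero_iff (hj : 1 ≤ j) {a : ℕ} (ha : 2 ≤ a) {r : ℝ} (hr : r ∈ Ioo (0 : ℝ) 1) :
    modeEig j k r a 0 = 0 ↔ r = √(((a : ℝ) - 1) * (a + j) / (k + ((a : ℝ) - 1) * (a + j))) := by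
  have l := (Nat.cast_nonneg j).trans_lt (lt_mul_sub_one hj ha)
  rw [left_null_iff hr, eq_comm (a := r), Real.sqrt_eq_iff_eq_sq (by positivity) hr.1.le,
    div_eq_iff (by positivity), mul_comm (r ^ 2), eq_comm]

theorem modeEig_right_eq_zero_iff (hk : 1 ≤ k) {b : ℕ} (hb : 2 ≤ b) {r : ℝ} (hr : r ∈ Ioo (0 : ℝ) 1) :
    modeEig j k r 0 b = 0 ↔ r = √((j : ℝ) / (j + ((b : ℝ) - 1) * (b + k))) := by
  have l := (Nat.cast_nonneg k).trans_lt (lt_mul_sub_one hk hb)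
  rw [right_null_iff hr, eq_comm (a := r), Real.sqrt_eq_iff_eq_sq (by positivity) hr.1.le,
    div_eq_iff (by positivity), mul_comm (r ^ 2), eq_comm]

/-- The instant with index i belongs to harmonics of degree a = i - 1, for which (i - 2)(j + i - 1)
= (a - 1)(a + j). -/
theorem rInst_succ {m : ℕ} (hjm : j < m) (a : ℕ) : rInst m j (a + 1) =
    √(((a : ℝ) - 1) * (a + j) / ((m - j : ℕ) + ((a : ℝ) - 1) * (a + j))) := by
  have e : beta j (a + 1) = ((a : ℝ) - 1) * (a + j) := by
    rw [beta]
    push_cast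
    ring
  rw [rInst, e, Nat.cast_sub hjm.le]

theorem sInst_succ {m : ℕ} (hjm : j < m) (b : ℕ) : sInst m j (b + 1) =
    √((j : ℝ) / (j + ((b : ℝ) - 1) * (b + (m - j : ℕ)))) := by
  rw [sInst, Nat.cast_sub hjm.le]
  congr 3
  push_cast
  ring

/-- A vanishing eigenvalue produces a null function only if harmonics of those degrees exist, which
`harmDim_pos` guarantees. -/
theorem isDegenerate_iff (hj : 1 ≤ j) (hk : 1 ≤ k) {α : ℝ≥0} (hα : α < 1) {r : ℝ}
    (hr : r ∈ Ioo (0 : ℝ) 1) :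
    ¬ IsNondegenerate j k α r (-logSlope j k (Real.arcsin r)) ↔
      (∃ a, 2 ≤ a ∧ modeEig j k r a 0 = 0) ∨ (∃ b, 2 ≤ b ∧ modeEig j k r 0 b = 0) := by
  rw [isNondegenerate_iff hj hk hα hr]
  push Not
  constructor
  · rintro ⟨i, hi, hne⟩
    rcases (null_mode_cases hj hk hr hi).resolve_left hne with ⟨h1, h2⟩ | ⟨h1, h2⟩
    · exact Or.inl ⟨_, h1, by rwa [h2] at hi⟩
    · exact Or.inr ⟨_, h2, by rwa [h1] at hi⟩
  · have hex : ∀ a b, modeEig j k r a b = 0 → (a, b) ≠ (1, 1) → ∃ i : HarmIdx j × HarmIdx k,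
        modeEig j k r i.1.1 i.2.1 = 0 ∧ (i.1.1, i.2.1) ≠ (1, 1) := fun a b h hne =>
      ⟨(⟨a, ⟨0, harmDim_pos hj a⟩⟩, ⟨b, ⟨0, harmDim_pos hk b⟩⟩), h, hne⟩
    rintro (⟨a, ha, h⟩ | ⟨b, hb, h⟩)
    · exact hex a 0 h (by simp)
    · exact hex 0 b h (by simp)

theorem hasJump_left (hj : 1 ≤ j) (hk : 1 ≤ k) {α : ℝ≥0} (hα : α < 1) {a : ℕ} (ha : 2 ≤ a) {r₀ : ℝ}
    (hr₀ : r₀ ∈ Ioo (0 : ℝ) 1)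
    (hr₀a : r₀ = √(((a : ℝ) - 1) * (a + j) / (k + ((a : ℝ) - 1) * (a + j)))) :
    HasJump (fun r => strongMorseIndex j k α r (-logSlope j k (Real.arcsin r))) r₀ (harmDim j a) ∧
      HasJump (fun r => weakMorseIndex j k α r (-logSlope j k (Real.arcsin r))) r₀ (harmDim j a) := by
  have h0 := (modeEig_left_eq_zero_iff hj ha hr₀).2 hr₀a
  have h := hasJump_of_mode hj hk hα hr₀ (p₀ := (a, 0)) h0
    (fun a' b' h' => null_mode_unique hj hk hr₀ h0 (by simp) h')
    (Or.inl fun r hr => by rw [hr₀a]; exact modeEig_left_neg_iff hj ha hr)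
  rwa [harmDim_zero, mul_one] at h

theorem hasJump_right (hj : 1 ≤ j) (hk : 1 ≤ k) {α : ℝ≥0} (hα : α < 1) {b : ℕ} (hb : 2 ≤ b) {r₀ : ℝ}
    (hr₀ : r₀ ∈ Ioo (0 : ℝ) 1) (hr₀b : r₀ = √((j : ℝ) / (j + ((b : ℝ) - 1) * (b + k)))) :
    HasJump (fun r => strongMorseIndex j k α r (-logSlope j k (Real.arcsin r))) r₀ (harmDim k b) ∧
      HasJump (fun r => weakMorseIndex j k α r (-logSlope j k (Real.arcsin r))) r₀ (harmDim k b) := by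
  have h0 := (modeEig_right_eq_zero_iff hk hb hr₀).2 hr₀b
  have h := hasJump_of_mode hj hk hα hr₀ (p₀ := (0, b)) h0
    (fun a' b' h' => null_mode_unique hj hk hr₀ h0 (by simp) h')
    (Or.inr fun r hr => by rw [hr₀b]; exact modeEig_right_neg_iff hk hb hr)
  rwa [harmDim_zero, one_mul] at h

theorem rInst_mem {m : ℕ} (hj : 1 ≤ j) (hjm : j < m) {a : ℕ} (ha : 2 ≤ a) :
    rInst m j (a + 1) ∈ Ioo (0 : ℝ) 1 := by
  have l := (Nat.cast_nonneg j).trans_lt (lt_mul_sub_one hj ha)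
  rw [rInst_succ hjm]
  exact sqrt_div_mem_Ioo l (by exact_mod_cast Nat.sub_pos_of_lt hjm)

theorem sInst_mem {m : ℕ} (hj : 1 ≤ j) (hjm : j < m) {b : ℕ} (hb : 2 ≤ b) :
    sInst m j (b + 1) ∈ Ioo (0 : ℝ) 1 := by
  have l := (Nat.cast_nonneg (m - j)).trans_lt (lt_mul_sub_one (Nat.sub_pos_of_lt hjm) hb)
  rw [sInst_succ hjm, add_comm (j : ℝ)]
  exact sqrt_div_mem_Ioo (by exact_mod_cast hj) l

end Jumps

end CliffordCMC

end

open CliffordCMC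

theorem proposition4p4 (m j : ℕ) (hj : 1 ≤ j) (hjm : j < m) (α : ℝ≥0) (hα0 : 0 < α) (hα1 : α < 1) :
    ∃ lam : ℝ → ℝ,
      -- each torus is a constrained critical point, with Lagrange multiplier `lam r`
      (∀ r ∈ Ioo (0 : ℝ) 1, ∀ c : ℝ,
        CliffordCMC.IsLagrangeMultiplier j (m - j) α r c ↔ c = lam r) ∧
      -- strong and weak index
      (∀ r ∈ Ioo (0 : ℝ) 1, ∃ n : ℕ,
        CliffordCMC.weakMorseIndex j (m - j) α r (lam r) = n ∧
        CliffordCMC.strongMorseIndex j (m - j) α r (lam r) = n + 1) ∧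
      -- degeneracy instants
      (∀ r ∈ Ioo (0 : ℝ) 1,
        ¬ CliffordCMC.IsNondegenerate j (m - j) α r (lam r) ↔
          (∃ i : ℕ, 3 ≤ i ∧ r = CliffordCMC.rInst m j i) ∨
          (∃ l : ℕ, 3 ≤ l ∧ r = CliffordCMC.sInst m j l)) ∧
      -- jumps of the Morse indices
      (∀ i : ℕ, 3 ≤ i →
        CliffordCMC.rInst m j i ∈ Ioo (0 : ℝ) 1 ∧ 0 < CliffordCMC.mult j i ∧
        CliffordCMC.HasJump (fun r => CliffordCMC.strongMorseIndex j (m - j) α r (lam r))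
          (CliffordCMC.rInst m j i) (CliffordCMC.mult j i) ∧
        CliffordCMC.HasJump (fun r => CliffordCMC.weakMorseIndex j (m - j) α r (lam r))
          (CliffordCMC.rInst m j i) (CliffordCMC.mult j i)) ∧
      (∀ l : ℕ, 3 ≤ l →
        CliffordCMC.sInst m j l ∈ Ioo (0 : ℝ) 1 ∧ 0 < CliffordCMC.mult (m - j) l ∧
        CliffordCMC.HasJump (fun r => CliffordCMC.strongMorseIndex j (m - j) α r (lam r))
          (CliffordCMC.sInst m j l) (CliffordCMC.mult (m - j) l) ∧
        CliffordCMC.HasJump (fun r => CliffordCMC.weakMorseIndex j (m - j) α r (lam r))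
          (CliffordCMC.sInst m j l) (CliffordCMC.mult (m - j) l)) := by
  have hk : 1 ≤ m - j := Nat.sub_pos_of_lt hjm
  refine ⟨fun r => -logSlope j (m - j) (Real.arcsin r), fun r hr c => isLagrangeMultiplier_iff hα1 hr c,
    fun r hr => ?_, fun r hr => ?_, fun i hi => ?_, fun l hl => ?_⟩
  · obtain ⟨D, hD⟩ := exists_finset_eq_negative_modes hj hk hr
    refine ⟨_, weakMorseIndex_eq hj hk hα1 hr hD, ?_⟩
    rw [strongMorseIndex_eq hj hk hα1 hr hD,
      ← card_modesOf_sdiff ((hD 0 0).2 (modeEig_zero_neg hj hr)), Nat.cast_succ]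
  · rw [isDegenerate_iff hj hk hα1 hr]
    refine or_congr ⟨?_, ?_⟩ ⟨?_, ?_⟩
    · rintro ⟨a, ha, h⟩
      exact ⟨a + 1, by omega, by rw [rInst_succ hjm]; exact (modeEig_left_eq_zero_iff hj ha hr).1 h⟩
    · rintro ⟨i, hi, h⟩
      obtain ⟨a, rfl⟩ := Nat.exists_eq_add_of_le' (by omega : 1 ≤ i)
      rw [rInst_succ hjm] at h
      exact ⟨a, by omega, (modeEig_left_eq_zero_iff hj (by omega) hr).2 h⟩
    · rintro ⟨b, hb, h⟩
      exact ⟨b + 1, by omega, by rw [sInst_succ hjm]; exact (modeEig_right_eq_zero_iff hk hb hr).1 h⟩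
    · rintro ⟨l, hl, h⟩
      obtain ⟨b, rfl⟩ := Nat.exists_eq_add_of_le' (by omega : 1 ≤ l)
      rw [sInst_succ hjm] at h
      exact ⟨b, by omega, (modeEig_right_eq_zero_iff hk (by omega) hr).2 h⟩
  · obtain ⟨a, rfl⟩ := Nat.exists_eq_add_of_le' (by omega : 1 ≤ i)
    have ha : 2 ≤ a := by omega
    have hr := rInst_mem hj hjm ha
    rw [← harmDim_eq_mult j hi, Nat.add_sub_cancel]
    exact ⟨hr, by exact_mod_cast harmDim_pos hj a, hasJump_left hj hk hα1 ha hr (rInst_succ hjm a)⟩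
  · obtain ⟨b, rfl⟩ := Nat.exists_eq_add_of_le' (by omega : 1 ≤ l)
    have hb : 2 ≤ b := by omega
    have hr := sInst_mem hj hjm hb
    rw [← harmDim_eq_mult (m - j) hl, Nat.add_sub_cancel]
    exact ⟨hr, by exact_mod_cast harmDim_pos hk b, hasJump_right hj hk hα1 hb hr (sInst_succ hjm b)⟩
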